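/- Let $n,k$ be positive integers, $A_1,\dots,A_k\in\mathbb R^{n\times n}$, and let $x_0\in\mathbb R^n$ be fixed. Consider the switched linear system $x_{t+1}=A_{s_t}x_t+w_t$, $t\ge 0$, where the modes $s_t\in\{1,\dots,k\}$ are i.i.d. with $\mathbb P(s_t=i)=p_i>0$, $\sum_i p_i=1$, and each $s_t$ is independent of $(x_0,\dots,x_t,s_0,\dots,s_{t-1})$. Let $\mathcal F_{t-1}=\sigma(x_0,\dots,x_t,s_0,\dots,s_t)$. Assume: 1. $\mathbb E\|w_t\|<\infty$ and $\mathbb E[w_t\mid\mathcal F_{t-1}]=0$ for all $t$; there is $\alpha>2$ with $\sup_{t\ge0}\mathbb E[\|w_t\|^\alpha\mid\mathcal F_{t-1}]<\infty$ a.s.; and there is a (deterministic) symmetric positive definite matrix $C$ such that almost surely $\liminf_{T\to\infty}\frac1T\sum_{t=0}^{T-1}w_tw_t^{\top}=C$, where the liminf is meant in the sense of quadratic forms: $\liminf_{T\to\infty}\frac1T\sum_{t=0}^{T-1}(v^{\top}w_t)^2=v^{\top}Cv$ for every $v\in\mathbb R^n$. 2. $\prod_{i=1}^k\sigma_i^{p_i}<1$,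 where $\sigma_i$ is the largest singular value of $A_i$. For $T\ge0$ let $\mathcal T_{i,T}=\{t\le T: s_t=i\}$ and $X_{i,T}=\sum_{t\in\mathcal T_{i,T}}x_tx_t^{\top}$, and let $\hat A_{i,T}$ be any minimizer over $B\in\mathbb R^{n\times n}$ of $\sum_{t\in\mathcal T_{i,T}}\|x_{t+1}-Bx_t\|^2$ (the switched least squares estimate). For a matrix $M$ let $\|M\|_\infty$ be the largest absolute value of its entries. Then for every $i\in\{1,\dots,k\}$, almost surely, $$\lim_{T\to\infty}\|\hat A_{i,T}-A_i\|_\infty=0\qquad\text{and}\qquad \|\hat A_{i,T}-A_i\|_\infty=O\!\left(\sqrt{\frac{\log\lambda_{\max}(X_{i,T})}{\lambda_{\min}(X_{i,T})}}\right)\quad (T\to\infty),$$ where the constant in $O(\cdot)$ may depend on the realization. -/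

import Mathlib

open MeasureTheory ProbabilityTheory Filter Topology Asymptotics
open scoped ENNReal Matrix

noncomputable section

namespace SwitchedLS

/-- Largest magnitude of an eigenvalue. It is applied to symmetric real matrices only, whose
eigenvalues are all real. -/
def lambdaMax {n : ℕ} (M : Matrix (Fin n) (Fin n) ℝ) : ℝ :=
  sSup ((fun r : ℝ => |r|) '' spectrum ℝ M)

/-- Smallest magnitude of an eigenvalue. It is applied to symmetric real matrices only, whose
eigenvalues are all real. -/
def lambdaMin {n : ℕ} (M : Matrix (Fin n) (Fin n) ℝ) : ℝ :=
  sInf ((fun r : ℝ => |r|) '' spectrum ℝ M)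

/-- Maximum singular value (spectral norm) `√(λ_max(Aᵀ A))`. -/
def sigmaMax {n : ℕ} (A : Matrix (Fin n) (Fin n) ℝ) : ℝ :=
  √(lambdaMax (Aᵀ * A))

/-- `‖M‖_∞`: the largest absolute value of an entry. -/
def maxAbs {n : ℕ} (M : Matrix (Fin n) (Fin n) ℝ) : ℝ :=
  ⨆ ij : Fin n × Fin n, |M ij.1 ij.2|

/-- The rank-one matrix `v vᵀ`. -/
def outer {n : ℕ} (v : EuclideanSpace ℝ (Fin n)) : Matrix (Fin n) (Fin n) ℝ :=
  Matrix.vecMulVec v.ofLp v.ofLp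

/-- `liminf_T S_T = C` for a sequence of symmetric matrices, in the sense of quadratic forms (the
sense that goes with the positive semidefinite order):
`liminf_T vᵀ S_T v = vᵀ C v` for every vector `v`. The liminf is taken in the extended reals. -/
def IsMatrixLiminf {n : ℕ} (S : ℕ → Matrix (Fin n) (Fin n) ℝ)
    (C : Matrix (Fin n) (Fin n) ℝ) : Prop :=
  ∀ v : Fin n → ℝ,
    liminf (fun T => ((v ⬝ᵥ (S T *ᵥ v) : ℝ) : EReal)) atTop = ((v ⬝ᵥ (C *ᵥ v) : ℝ) : EReal)

/-- Continuous component of the switched linear system started at the fixed value `x0`: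
`x_{t+1} = A_{s_t} x_t + w_t`. -/
def state {Ω : Type*} {n k : ℕ} (A : Fin k → Matrix (Fin n) (Fin n) ℝ)
    (x0 : EuclideanSpace ℝ (Fin n)) (s : ℕ → Ω → Fin k)
    (w : ℕ → Ω → EuclideanSpace ℝ (Fin n)) : ℕ → Ω → EuclideanSpace ℝ (Fin n)
  | 0, _ => x0
  | t + 1, ω => Matrix.toEuclideanLin (A (s t ω)) (state A x0 s w t ω) + w t ω

/-- The sigma-algebra `σ(x_{0:t}, s_{0:t})` (the one written `ℱ_{t-1}`), with respect to which the
noise `w_t` is centred. -/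
abbrev history {Ω : Type*} {n k : ℕ} (x : ℕ → Ω → EuclideanSpace ℝ (Fin n)) (s : ℕ → Ω → Fin k)
    (t : ℕ) : MeasurableSpace Ω :=
  (⨆ j ∈ Set.Iic t, MeasurableSpace.comap (x j) inferInstance) ⊔
    (⨆ j ∈ Set.Iic t, MeasurableSpace.comap (s j) inferInstance)

/-- The sigma-algebra `σ(x_{0:t}, s_{0:t-1})` of everything that happened before the mode `s_t`
is drawn. -/
abbrev past {Ω : Type*} {n k : ℕ} (x : ℕ → Ω → EuclideanSpace ℝ (Fin n)) (s : ℕ → Ω → Fin k)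
    (t : ℕ) : MeasurableSpace Ω :=
  (⨆ j ∈ Set.Iic t, MeasurableSpace.comap (x j) inferInstance) ⊔
    (⨆ j ∈ Set.Iio t, MeasurableSpace.comap (s j) inferInstance)

/-- I.i.d. switching: the modes are independent, `s_t` has the probability mass function `p`, all
of whose values are non-zero, and `s_t` is drawn independently of `(x_{0:t}, s_{0:t-1})`. -/
structure IIDSwitching {Ω : Type*} [MeasurableSpace Ω] (μ : Measure Ω) {n k : ℕ}
    (x : ℕ → Ω → EuclideanSpace ℝ (Fin n)) (s : ℕ → Ω → Fin k) (p : Fin k → ℝ) : Prop where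
  measurable : ∀ t, Measurable (s t)
  pmf_pos : ∀ i, 0 < p i
  pmf_sum : ∑ i, p i = 1
  law : ∀ t i, μ {ω | s t ω = i} = ENNReal.ofReal (p i)
  indep : iIndepFun s μ
  indep_past : ∀ t, Indep (MeasurableSpace.comap (s t) inferInstance) (past x s t) μ

/-- The assumption on the noise: `w` is a martingale difference sequence,
`sup_t E[‖w_t‖^α | ℱ_{t-1}] < ∞` almost surely, and almost surely
`liminf_T (1/T) ∑_{t<T} w_t w_tᵀ = C`.

The conditional `α`-moment is the conditional expectation of a `[0,∞]`-valued function, so that it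
makes sense without integrability of `‖w_t‖^α`. -/
structure NoiseAssumption {Ω : Type*} [MeasurableSpace Ω] (μ : Measure Ω) {n k : ℕ}
    (x : ℕ → Ω → EuclideanSpace ℝ (Fin n)) (s : ℕ → Ω → Fin k)
    (w : ℕ → Ω → EuclideanSpace ℝ (Fin n)) (α : ℝ) (C : Matrix (Fin n) (Fin n) ℝ) : Prop where
  measurable : ∀ t, Measurable (w t)
  integrable : ∀ t, Integrable (w t) μ
  condExp_eq_zero : ∀ t, μ[w t | history x s t] =ᵐ[μ] 0
  condMoment : ∀ᵐ ω ∂μ, ⨆ t, (μ⁻[fun ω' => ‖w t ω'‖ₑ ^ α | history x s t]) ω < ∞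
  covariance : ∀ᵐ ω ∂μ,
    IsMatrixLiminf (fun T => (1 / (T : ℝ)) • ∑ t ∈ Finset.range T, outer (w t ω)) C

/-- `𝒯_{i,T}`: the times `t ≤ T` at which the mode equals `i`, along one trajectory of modes. -/
def modeTimes {k : ℕ} (s : ℕ → Fin k) (i : Fin k) (T : ℕ) : Finset ℕ :=
  (Finset.range (T + 1)).filter (fun t => s t = i)

/-- Unnormalized empirical covariance `X_{i,T} = ∑_{t ∈ 𝒯_{i,T}} x_t x_tᵀ` along a trajectory. -/
def empCov {n k : ℕ} (x : ℕ → EuclideanSpace ℝ (Fin n)) (s : ℕ → Fin k) (i : Fin k) (T : ℕ) :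
    Matrix (Fin n) (Fin n) ℝ :=
  ∑ t ∈ modeTimes s i T, outer (x t)

/-- `B` is a switched least squares estimate for mode `i` at time `T`: it minimizes
`∑_{t ∈ 𝒯_{i,T}} ‖x_{t+1} - B x_t‖²` over all matrices. -/
def IsLeastSquares {n k : ℕ} (x : ℕ → EuclideanSpace ℝ (Fin n)) (s : ℕ → Fin k) (i : Fin k)
    (T : ℕ) (B : Matrix (Fin n) (Fin n) ℝ) : Prop :=
  IsMinOn (fun D : Matrix (Fin n) (Fin n) ℝ =>
    ∑ t ∈ modeTimes s i T, ‖x (t + 1) - Matrix.toEuclideanLin D (x t)‖ ^ 2) Set.univ B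

end SwitchedLS

end

open SwitchedLS

open SwitchedLS

/-! ### Moment bounds for sums of martingale differences. -/

section MartingaleDifferences

variable {Ω : Type*} {m0 : MeasurableSpace Ω} {μ : Measure Ω}

/-! The estimation error is governed by two quantities along a trajectory: the excitation `lambdaMin
(empCov ..)`, which grows at least linearly in T, and the logarithm of the accumulated energy of the
state, which is o(T). The squared error is at most a constant times the second over the first, which
gives both the limit and the rate.

The probabilistic core is the self-normalized bound of Lai and Wei
(`IsNoise.two_mul_dotProduct_weightedSum_le`): for predictable regressors z_t and V = 1 + ∑ z zᵀ,
the form SᵀV⁻¹S of S = ∑ ε_t z_t is O(log(1 + ∑ ‖z_t‖²)) almost surely. It follows from rank-one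
updates of V⁻¹: the noise-squared terms have weights whose sum telescopes through log det V, and the
cross term is a martingale dominated by its own quadratic variation, which the recursion subtracts.
The strong laws behind this use only moments of an order above 2, through a truncation estimate for
martingale differences of order 1 < p ≤ 2. As the conditional moments are bounded only by a random
constant, the noise is localized on the events that they stay below an integer K (`truncNoise`).

The bound is applied twice. With z_t = 1{s_t = i} x_t, it controls the right side of the basic
inequality of least squares (`lambdaMin_mul_sum_sq_le`); no formula for the minimizer is needed.
With z_t = 1{s_{t+1} = i} A_{s_t} x_t, it controls the cross term in the square of x_{t+1} = A_{s_t}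
x_t + w_t, so the excitation is bounded below by that of the noise alone at the selected times
(`sum_selected_sq_ge`). This second regressor looks one mode ahead, which is harmless since s_{t+1}
is independent of everything before it, w_t included (`isNoise_truncNoise_lookahead`). For the same
reason, selecting times by s_{t+1} keeps asymptotically the fraction p_i of the noise energy
(`ae_abs_sum_modeInd_mul_le`), and compactness of the sphere makes the assumption on C uniform in
the direction (`exists_uniform_sum_sq_ge`).

Stability enters only through growth: the product condition and the law of large numbers for the
modes make ‖x_t‖ subexponential (`ae_log_sum_norm_sq_le`), so every logarithm above is o(T). -/

theorem integral_sq_sum_martingaleDiff [IsProbabilityMeasure μ] {F : Filtration ℕ m0}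
    {Z : ℕ → Ω → ℝ} {R : ℝ} (hmeas : ∀ k, StronglyMeasurable[F (k + 1)] (Z k))
    (hbdd : ∀ k, ∀ᵐ ω ∂μ, |Z k ω| ≤ R) (hce : ∀ k, μ[Z k | F k] =ᵐ[μ] 0) (N : ℕ) :
    ∫ ω, (∑ k ∈ Finset.range N, Z k ω) ^ 2 ∂μ = ∑ k ∈ Finset.range N, ∫ ω, Z k ω ^ 2 ∂μ := by
  have hsm : ∀ k, AEStronglyMeasurable (Z k) μ :=
    fun k => ((hmeas k).mono (F.le _)).aestronglyMeasurable
  have hint : ∀ k, Integrable (Z k) μ := fun k =>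
    Integrable.of_bound (hsm k) R (by simpa using hbdd k)
  induction N with
  | zero => simp
  | succ N ih =>
    set M : Ω → ℝ := fun ω => ∑ k ∈ Finset.range N, Z k ω with hM
    have hMmeas : StronglyMeasurable[F N] M := by
      refine Finset.stronglyMeasurable_fun_sum _ fun k hk => ?_
      exact (hmeas k).mono (F.mono (Finset.mem_range.1 hk))
    have hMb : ∀ᵐ ω ∂μ, |M ω| ≤ N * R := by
      filter_upwards [ae_all_iff.2 hbdd] with ω h
      calc |M ω| ≤ ∑ k ∈ Finset.range N, |Z k ω| := Finset.abs_sum_le_sum_abs _ _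
        _ ≤ ∑ k ∈ Finset.range N, R := Finset.sum_le_sum fun k _ => h k
        _ = N * R := by simp
    have hMsm := (hMmeas.mono (F.le N)).aestronglyMeasurable (μ := μ)
    have hMZ : Integrable (M * Z N) μ := by
      refine (hint N).bdd_mul (c := N * R) hMsm ?_
      simpa using hMb
    have hZZ : Integrable (fun ω => Z N ω ^ 2) μ := by
      have : Integrable (Z N * Z N) μ := (hint N).bdd_mul (c := R) (hsm N) (by simpa using hbdd N)
      refine this.congr (ae_of_all _ fun ω => ?_)
      simp [sq]
    have hMM : Integrable (fun ω => M ω ^ 2) μ := by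
      have hMi : Integrable M μ := Integrable.of_bound hMsm (N * R) (by simpa using hMb)
      have : Integrable (M * M) μ := hMi.bdd_mul (c := N * R) hMsm (by simpa using hMb)
      refine this.congr (ae_of_all _ fun ω => ?_)
      simp [sq]
    have h0 : ∫ ω, M ω * Z N ω ∂μ = 0 := by
      have h1 : μ[M * Z N | F N] =ᵐ[μ] 0 := by
        refine (condExp_mul_of_stronglyMeasurable_left hMmeas hMZ (hint N)).trans ?_
        filter_upwards [hce N] with ω h
        simp [h]
      have h2 := integral_condExp (μ := μ) (F.le N) (f := M * Z N)
      rw [integral_congr_ae h1] at h2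
      simpa using h2.symm
    rw [Finset.sum_range_succ, ← ih]
    have h3 : ∀ ω, (∑ k ∈ Finset.range (N + 1), Z k ω) ^ 2
        = M ω ^ 2 + (2 * (M ω * Z N ω) + Z N ω ^ 2) := by
      intro ω
      rw [Finset.sum_range_succ]; simp only [hM]; ring
    simp_rw [h3]
    have hMZ' : Integrable (fun ω => M ω * Z N ω) μ := hMZ
    have h4 : Integrable (fun ω => 2 * (M ω * Z N ω) + Z N ω ^ 2) μ := (hMZ'.const_mul 2).add hZZ
    rw [integral_add hMM h4, integral_add (hMZ'.const_mul 2) hZZ, integral_const_mul, h0]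
    simp [hM]

/-- Truncation at height 1: the small part satisfies A² ≤ |Y|^p because p ≤ 2, the large part |B| ≤
|Y|^p because p > 1. After conditional centring, the small parts are orthogonal in L² and the large
parts are summed in L¹. The constant 6 is 4 (variance of a centred small part) plus 2 (L¹ norm of a
centred large part). -/
theorem integral_abs_sum_martingaleDiff_le [IsProbabilityMeasure μ] {F : Filtration ℕ m0}
    {Y : ℕ → Ω → ℝ} {p : ℝ} (hp1 : 1 < p) (hp2 : p ≤ 2)
    (hmeas : ∀ k, StronglyMeasurable[F (k + 1)] (Y k)) (hint : ∀ k, Integrable (Y k) μ)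
    (hce : ∀ k, μ[Y k | F k] =ᵐ[μ] 0) (hintp : ∀ k, Integrable (fun ω => |Y k ω| ^ p) μ) (N : ℕ) :
    ∫ ω, |∑ k ∈ Finset.range N, Y k ω| ∂μ
      ≤ 1 + 6 * ∑ k ∈ Finset.range N, ∫ ω, |Y k ω| ^ p ∂μ := by
  set S : ℕ → Set Ω := fun k => {ω | |Y k ω| ≤ 1} with hS
  have hSmeas : ∀ k, MeasurableSet[F (k + 1)] (S k) := fun k =>
    (continuous_abs.measurable.comp (hmeas k).measurable) measurableSet_Iic
  set A : ℕ → Ω → ℝ := fun k => (S k).indicator (Y k) with hA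
  set B : ℕ → Ω → ℝ := fun k => (S k)ᶜ.indicator (Y k) with hB
  have hAm : ∀ k, StronglyMeasurable[F (k + 1)] (A k) := fun k => (hmeas k).indicator (hSmeas k)
  have hAint : ∀ k, Integrable (A k) μ := fun k => (hint k).indicator (F.le _ _ (hSmeas k))
  have hBint : ∀ k, Integrable (B k) μ := fun k =>
    (hint k).indicator (F.le _ _ (hSmeas k)).compl
  have hAB : ∀ k ω, A k ω + B k ω = Y k ω := fun k ω => by
    simp only [hA, hB]; exact congrFun (Set.indicator_self_add_compl (S k) (Y k)) ω
  have hA1 : ∀ k ω, |A k ω| ≤ 1 := by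
    intro k ω
    by_cases h : ω ∈ S k
    · simp only [hA, Set.indicator_of_mem h]; exact h
    · simp [hA, Set.indicator_of_notMem h]
  have hA2 : ∀ k ω, A k ω ^ 2 ≤ |Y k ω| ^ p := by
    intro k ω
    by_cases h : ω ∈ S k
    · simp only [hA, Set.indicator_of_mem h]
      rw [← sq_abs, ← Real.rpow_two]
      rcases eq_or_lt_of_le (abs_nonneg (Y k ω)) with h0 | h0
      · rw [← h0, Real.zero_rpow (by norm_num), Real.zero_rpow (by linarith)]
      · exact Real.rpow_le_rpow_of_exponent_ge h0 h hp2
    · simp only [hA, Set.indicator_of_notMem h, zero_pow two_ne_zero]; positivity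
  have hB2 : ∀ k ω, |B k ω| ≤ |Y k ω| ^ p := by
    intro k ω
    by_cases h : ω ∈ S k
    · simp only [hB, Set.indicator_of_notMem (Set.notMem_compl_iff.2 h), abs_zero]; positivity
    · simp only [hB, Set.indicator_of_mem (Set.mem_compl h)]
      have h1 : 1 < |Y k ω| := not_le.1 h
      simpa using Real.rpow_le_rpow_of_exponent_le h1.le hp1.le
  set Z : ℕ → Ω → ℝ := fun k => A k - μ[A k | F k] with hZ
  set D : ℕ → Ω → ℝ := fun k => B k - μ[B k | F k] with hD
  have hZm : ∀ k, StronglyMeasurable[F (k + 1)] (Z k) := fun k =>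
    (hAm k).sub (stronglyMeasurable_condExp.mono (F.mono (Nat.le_succ k)))
  have hcA : ∀ k, ∀ᵐ ω ∂μ, |(μ[A k | F k]) ω| ≤ 1 := fun k =>
    ae_bdd_abs_condExp_of_ae_bdd_abs (ae_of_all _ (hA1 k))
  have hZb : ∀ k, ∀ᵐ ω ∂μ, |Z k ω| ≤ 2 := by
    intro k
    filter_upwards [hcA k] with ω h
    calc |Z k ω| ≤ |A k ω| + |(μ[A k | F k]) ω| := abs_sub _ _
      _ ≤ 2 := by linarith [hA1 k ω]
  have hZc : ∀ k, μ[Z k | F k] =ᵐ[μ] 0 := by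
    intro k
    refine (condExp_sub (hAint k) integrable_condExp _).trans ?_
    rw [condExp_of_stronglyMeasurable (F.le k) stronglyMeasurable_condExp integrable_condExp]
    simp
  have hZint : ∀ k, Integrable (Z k) μ := fun k => (hAint k).sub integrable_condExp
  have hDint : ∀ k, Integrable (D k) μ := fun k => (hBint k).sub integrable_condExp
  -- The two conditional means cancel because that of Y vanishes.
  have hsum : ∀ᵐ ω ∂μ, ∀ k, Y k ω = Z k ω + D k ω := by
    refine ae_all_iff.2 fun k => ?_
    have h1 : μ[A k + B k | F k] =ᵐ[μ] μ[A k | F k] + μ[B k | F k] :=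
      condExp_add (hAint k) (hBint k) _
    have h2 : A k + B k = Y k := funext (hAB k)
    rw [h2] at h1
    filter_upwards [h1, hce k] with ω h1 h2
    have := hAB k ω
    simp only [hZ, hD, Pi.sub_apply]
    simp only [h2, Pi.add_apply, Pi.zero_apply] at h1
    linarith
  have hZ2i : ∀ k, Integrable (fun ω => Z k ω ^ 2) μ := by
    intro k
    have : Integrable (Z k * Z k) μ := (hZint k).bdd_mul (c := 2) (hZint k).1 (by simpa using hZb k)
    refine this.congr (ae_of_all _ fun ω => ?_)
    simp [sq]
  have hZ2 : ∀ k, ∫ ω, Z k ω ^ 2 ∂μ ≤ 4 * ∫ ω, |Y k ω| ^ p ∂μ := by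
    intro k
    have hA2i : Integrable (fun ω => |A k ω| ^ (2 : ℝ)) μ := by
      refine Integrable.of_bound (C := 1) ?_ (ae_of_all _ fun ω => ?_)
      · exact ((hAint k).1.aemeasurable.abs.pow_const 2).aestronglyMeasurable
      · rw [Real.rpow_two, Real.norm_eq_abs, abs_of_nonneg (by positivity),
          sq_le_one_iff_abs_le_one, abs_abs]
        exact hA1 k ω
    have h1 : ∫ ω, |(μ[A k | F k]) ω| ^ (2 : ℝ) ∂μ ≤ ∫ ω, |A k ω| ^ (2 : ℝ) ∂μ := by
      have := integral_norm_condExp_rpow_le (μ := μ) (m := F k) (p := 2)  (f := A k) (by norm_num)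
        (by simpa only [Real.norm_eq_abs] using hA2i)
      simpa only [Real.norm_eq_abs] using this
    have h2 : ∫ ω, |A k ω| ^ (2 : ℝ) ∂μ ≤ ∫ ω, |Y k ω| ^ p ∂μ := by
      refine integral_mono hA2i (hintp k) fun ω => ?_
      simpa using hA2 k ω
    have hci : Integrable (fun ω => |(μ[A k | F k]) ω| ^ (2 : ℝ)) μ := by
      refine Integrable.of_bound (C := 1) ?_ ?_
      · exact ((integrable_condExp (f := A k) (m := F k) (μ := μ)).1.aemeasurable.abs.pow_const
          2).aestronglyMeasurable
      · filter_upwards [hcA k] with ω h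
        rw [Real.rpow_two, Real.norm_eq_abs, abs_of_nonneg (by positivity), sq_abs]
        nlinarith [abs_nonneg ((μ[A k | F k]) ω), sq_abs ((μ[A k | F k]) ω)]
    calc ∫ ω, Z k ω ^ 2 ∂μ
        ≤ ∫ ω, (2 * |A k ω| ^ (2 : ℝ) + 2 * |(μ[A k | F k]) ω| ^ (2 : ℝ)) ∂μ := by
          refine integral_mono (hZ2i k) ((hA2i.const_mul 2).add (hci.const_mul 2)) fun ω => ?_
          simp only [Real.rpow_two, sq_abs, hZ, Pi.sub_apply]
          nlinarith [sq_nonneg (A k ω + (μ[A k | F k]) ω)]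
      _ = 2 * ∫ ω, |A k ω| ^ (2 : ℝ) ∂μ + 2 * ∫ ω, |(μ[A k | F k]) ω| ^ (2 : ℝ) ∂μ := by
          rw [integral_add (hA2i.const_mul 2) (hci.const_mul 2), integral_const_mul,
            integral_const_mul]
      _ ≤ _ := by linarith
  have hD1 : ∀ k, ∫ ω, |D k ω| ∂μ ≤ 2 * ∫ ω, |Y k ω| ^ p ∂μ := by
    intro k
    have h1 : ∫ ω, |(μ[B k | F k]) ω| ∂μ ≤ ∫ ω, |B k ω| ∂μ := integral_abs_condExp_le _
    have h2 : ∫ ω, |B k ω| ∂μ ≤ ∫ ω, |Y k ω| ^ p ∂μ := integral_mono (hBint k).abs (hintp k) (hB2 k)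
    have hci : Integrable (fun ω => |(μ[B k | F k]) ω|) μ := integrable_condExp.abs
    calc ∫ ω, |D k ω| ∂μ ≤ ∫ ω, (|B k ω| + |(μ[B k | F k]) ω|) ∂μ :=
          integral_mono (hDint k).abs ((hBint k).abs.add hci) fun ω => abs_sub _ _
      _ = ∫ ω, |B k ω| ∂μ + ∫ ω, |(μ[B k | F k]) ω| ∂μ := integral_add (hBint k).abs hci
      _ ≤ _ := by linarith
  set M : Ω → ℝ := fun ω => ∑ k ∈ Finset.range N, Z k ω with hM
  have hMm : AEStronglyMeasurable M μ :=
    Finset.aestronglyMeasurable_fun_sum _ fun k _ => (hZint k).1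
  have hMb : ∀ᵐ ω ∂μ, |M ω| ≤ N * 2 := by
    filter_upwards [ae_all_iff.2 hZb] with ω h
    calc |M ω| ≤ ∑ k ∈ Finset.range N, |Z k ω| := Finset.abs_sum_le_sum_abs _ _
      _ ≤ ∑ k ∈ Finset.range N, 2 := Finset.sum_le_sum fun k _ => h k
      _ = N * 2 := by simp
  have hMi : Integrable M μ := Integrable.of_bound hMm (N * 2) (by simpa using hMb)
  have hM2 : Integrable (fun ω => M ω ^ 2) μ := by
    have : Integrable (M * M) μ := hMi.bdd_mul (c := N * 2) hMm (by simpa using hMb)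
    refine this.congr (ae_of_all _ fun ω => ?_)
    simp [sq]
  have hDs : Integrable (fun ω => ∑ k ∈ Finset.range N, |D k ω|) μ :=
    integrable_finsetSum _ fun k _ => (hDint k).abs
  calc ∫ ω, |∑ k ∈ Finset.range N, Y k ω| ∂μ
      ≤ ∫ ω, ((1 + M ω ^ 2) + ∑ k ∈ Finset.range N, |D k ω|) ∂μ := by
        refine integral_mono_ae (integrable_finsetSum _ fun k _ => hint k).abs
          (((integrable_const 1).add hM2).add hDs) ?_
        filter_upwards [hsum] with ω h
        simp only [h, Finset.sum_add_distrib]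
        refine (abs_add_le _ _).trans (add_le_add ?_ (Finset.abs_sum_le_sum_abs _ _))
        change |M ω| ≤ _
        nlinarith [sq_nonneg (|M ω| - 1), sq_abs (M ω)]
    _ = 1 + ∑ k ∈ Finset.range N, ∫ ω, Z k ω ^ 2 ∂μ + ∑ k ∈ Finset.range N, ∫ ω, |D k ω| ∂μ := by
        have h4 : Integrable (fun ω => 1 + M ω ^ 2) μ := (integrable_const 1).add hM2
        rw [integral_add h4 hDs, integral_add (integrable_const 1) hM2,
          integral_sq_sum_martingaleDiff hZm hZb hZc,
          integral_finsetSum _ fun k _ => (hDint k).abs]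
        simp
    _ ≤ 1 + ∑ k ∈ Finset.range N, 4 * ∫ ω, |Y k ω| ^ p ∂μ
        + ∑ k ∈ Finset.range N, 2 * ∫ ω, |Y k ω| ^ p ∂μ := by
        gcongr with k _ k _
        · exact hZ2 k
        · exact hD1 k
    _ = _ := by rw [← Finset.mul_sum, ← Finset.mul_sum]; ring

/-- A series of martingale differences whose `p`-th moments are summable, `1 < p ≤ 2`, has almost
surely bounded partial sums. -/
theorem ae_bounded_sum_martingaleDiff [IsProbabilityMeasure μ] {F : Filtration ℕ m0}
    {Y : ℕ → Ω → ℝ} {p : ℝ} (hp1 : 1 < p) (hp2 : p ≤ 2)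
    (hmeas : ∀ k, StronglyMeasurable[F (k + 1)] (Y k)) (hint : ∀ k, Integrable (Y k) μ)
    (hce : ∀ k, μ[Y k | F k] =ᵐ[μ] 0) (hintp : ∀ k, Integrable (fun ω => |Y k ω| ^ p) μ)
    {c : ℝ} (hc : ∀ N, ∑ k ∈ Finset.range N, ∫ ω, |Y k ω| ^ p ∂μ ≤ c) :
    ∀ᵐ ω ∂μ, ∃ B, ∀ N, |∑ k ∈ Finset.range N, Y k ω| ≤ B := by
  set f : ℕ → Ω → ℝ := fun N ω => ∑ k ∈ Finset.range N, Y k ω with hf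
  have hfi : ∀ N, Integrable (f N) μ := fun N => integrable_finsetSum _ fun k _ => hint k
  have hmart : Martingale f F μ := by
    refine martingale_of_condExp_sub_eq_zero_nat (fun N => ?_) hfi fun N => ?_
    · exact Finset.stronglyMeasurable_fun_sum _ fun k hk =>
        (hmeas k).mono (F.mono (Finset.mem_range.1 hk))
    · have : f (N + 1) - f N = Y N := by
        ext ω; simp [hf, Finset.sum_range_succ]
      rw [this]; exact hce N
  -- Boundedness in L¹ is all that Doob's convergence theorem requires, and a convergent sequence is
  -- bounded.
  have hb : ∀ N, eLpNorm (f N) 1 μ ≤ (1 + 6 * c).toNNReal := by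
    intro N
    rw [eLpNorm_one_eq_lintegral_enorm, ← ofReal_integral_norm_eq_lintegral_enorm (hfi N)]
    refine ENNReal.ofReal_le_ofReal ?_
    refine (integral_abs_sum_martingaleDiff_le hp1 hp2 hmeas hint hce hintp N).trans ?_
    linarith [hc N]
  filter_upwards [hmart.submartingale.exists_ae_tendsto_of_bdd hb] with ω ⟨l, hl⟩
  obtain ⟨B, hB⟩ := (Metric.isBounded_range_of_tendsto _ hl).exists_norm_le
  exact ⟨B, fun N => hB _ ⟨N, rfl⟩⟩

end MartingaleDifferences

/-! ### Kronecker's lemma and a convergent series. -/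

/-- A bounded form of Kronecker's lemma. -/
theorem abs_sum_mul_le_of_monotone {y U : ℕ → ℝ} {B : ℝ} (hU : Monotone U) (hU0 : 0 ≤ U 0)
    (hB : ∀ N, |∑ k ∈ Finset.range N, y k| ≤ B) (N : ℕ) :
    |∑ k ∈ Finset.range (N + 1), U k * y k| ≤ 2 * B * U N := by
  set s : ℕ → ℝ := fun N => ∑ k ∈ Finset.range N, y k with hs
  have hB0 : 0 ≤ B := (abs_nonneg _).trans (hB 0)
  -- Summation by parts; monotonicity of U then makes the increments telescope.
  have h : ∀ N, ∑ k ∈ Finset.range (N + 1), U k * y k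
      = U N * s (N + 1) - ∑ k ∈ Finset.range N, (U (k + 1) - U k) * s (k + 1) := by
    intro N
    induction N with
    | zero => simp [hs]
    | succ N ih =>
      rw [Finset.sum_range_succ, ih, Finset.sum_range_succ _ N]
      have : s (N + 1 + 1) = s (N + 1) + y (N + 1) := by simp [hs, Finset.sum_range_succ]
      rw [this]; ring
  have hUN : ∀ N, 0 ≤ U N := fun N => hU0.trans (hU (Nat.zero_le N))
  rw [h]
  have h1 : |U N * s (N + 1)| ≤ B * U N := by
    rw [abs_mul, abs_of_nonneg (hUN N), mul_comm]
    exact mul_le_mul_of_nonneg_right (hB _) (hUN N)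
  have h2 : |∑ k ∈ Finset.range N, (U (k + 1) - U k) * s (k + 1)| ≤ B * U N := by
    calc _ ≤ ∑ k ∈ Finset.range N, |(U (k + 1) - U k) * s (k + 1)| := Finset.abs_sum_le_sum_abs _ _
      _ ≤ ∑ k ∈ Finset.range N, (U (k + 1) - U k) * B := by
        refine Finset.sum_le_sum fun k _ => ?_
        have := hU (Nat.le_succ k)
        rw [abs_mul, abs_of_nonneg (by simpa using this)]
        exact mul_le_mul_of_nonneg_left (hB _) (by simpa using this)
      _ = (U N - U 0) * B := by rw [← Finset.sum_mul, Finset.sum_range_sub]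
      _ ≤ _ := by nlinarith
  exact (abs_sub _ _).trans (by linarith)

/-- The left side is a lower Riemann sum for the integral of x^(-p) over [a, b], whose value is the
right side. -/
theorem sub_mul_rpow_neg_le {a b p : ℝ} (ha : 0 < a) (hab : a ≤ b) (hp : 1 < p) :
    (b - a) * b ^ (-p) ≤ (a ^ (1 - p) - b ^ (1 - p)) / (p - 1) := by
  have hb : 0 < b := ha.trans_le hab
  have h1 : b ^ (-p) = b ^ (1 - p) / b := by
    rw [show -p = (1 - p) - 1 by ring, Real.rpow_sub_one hb.ne']
  have h2 : a ^ (1 - p) = b ^ (1 - p) * (a / b) ^ (1 - p) := by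
    rw [← Real.mul_rpow hb.le (by positivity), mul_div_cancel₀ _ hb.ne']
  have h3 : 1 + (p - 1) * (1 - a / b) ≤ (a / b) ^ (1 - p) := by
    rw [Real.rpow_def_of_pos (by positivity)]
    have := Real.add_one_le_exp (Real.log (a / b) * (1 - p))
    have := Real.log_le_sub_one_of_pos (show 0 < a / b by positivity)
    nlinarith
  have h4 : 0 < b ^ (1 - p) := by positivity
  rw [h1, h2, le_div_iff₀ (by linarith)]
  have h5 : (b - a) * (b ^ (1 - p) / b) = b ^ (1 - p) * (1 - a / b) := by field_simp
  rw [h5]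
  nlinarith [mul_le_mul_of_nonneg_left h3 h4.le]

/-- Each denominator contains the current term, so each summand is at most the integral of x^(-p)
between consecutive partial sums; the whole is at most the integral over [1, ∞). -/
theorem sum_div_rpow_le {u : ℕ → ℝ} (hu : ∀ k, 0 ≤ u k) {p : ℝ} (hp : 1 < p) (N : ℕ) :
    ∑ k ∈ Finset.range N, u k / (1 + ∑ j ∈ Finset.range (k + 1), u j) ^ p ≤ 1 / (p - 1) := by
  set U : ℕ → ℝ := fun k => 1 + ∑ j ∈ Finset.range k, u j with hU
  have hU1 : ∀ k, 1 ≤ U k := fun k => by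
    have := Finset.sum_nonneg fun j (_ : j ∈ Finset.range k) => hu j
    simp only [hU]; linarith
  have h : ∑ k ∈ Finset.range N, u k / U (k + 1) ^ p ≤ (1 - U N ^ (1 - p)) / (p - 1) := by
    induction N with
    | zero => simp [hU]
    | succ N ih =>
      rw [Finset.sum_range_succ]
      have h1 : U (N + 1) = U N + u N := by simp [hU, Finset.sum_range_succ, add_assoc]
      have h2 := sub_mul_rpow_neg_le (a := U N) (b := U (N + 1)) (p := p)
        (by linarith [hU1 N]) (by linarith [hu N]) hp
      have h3 : (U (N + 1) - U N) * U (N + 1) ^ (-p) = u N / U (N + 1) ^ p := by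
        rw [Real.rpow_neg (by linarith [hU1 (N + 1)]), h1]; ring
      rw [h3] at h2
      calc _ ≤ _ := add_le_add ih h2
        _ = _ := by ring
  refine h.trans ?_
  have : 0 ≤ U N ^ (1 - p) := Real.rpow_nonneg (by linarith [hU1 N]) _
  gcongr
  linarith

/-! ### Strong laws for noise with bounded conditional moments. -/

section MartingaleNoise

variable {Ω : Type*} {m0 : MeasurableSpace Ω} {μ : Measure Ω}

/-- A scalar martingale difference sequence whose conditional absolute moments of order `q` are
bounded by the constant `K`. -/
structure IsNoise (μ : Measure Ω) (F : Filtration ℕ m0) (ε : ℕ → Ω → ℝ) (q K : ℝ) : Prop where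
  stronglyMeasurable : ∀ t, StronglyMeasurable[F (t + 1)] (ε t)
  integrable : ∀ t, Integrable (ε t) μ
  condExp_eq_zero : ∀ t, μ[ε t | F t] =ᵐ[μ] 0
  integrable_rpow : ∀ t, Integrable (fun ω => |ε t ω| ^ q) μ
  condMoment_le : ∀ t, ∀ᵐ ω ∂μ, (μ[fun ω => |ε t ω| ^ q | F t]) ω ≤ K

theorem IsNoise.nonneg [IsProbabilityMeasure μ] {F : Filtration ℕ m0} {ε : ℕ → Ω → ℝ} {q K : ℝ}
    (h : IsNoise μ F ε q K) : 0 ≤ K := by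
  have h1 : 0 ≤ᵐ[μ] μ[fun ω => |ε 0 ω| ^ q | F 0] :=
    condExp_nonneg (ae_of_all _ fun ω => by positivity)
  obtain ⟨ω, h1, h2⟩ := (h1.and (h.condMoment_le 0)).exists
  exact h1.trans h2

theorem integral_mul_le_of_condExp_le [IsProbabilityMeasure μ] {m : MeasurableSpace Ω}
    (hm : m ≤ m0) {f g : Ω → ℝ} {K R : ℝ} (hf : StronglyMeasurable[m] f) (hf0 : ∀ ω, 0 ≤ f ω)
    (hfR : ∀ ω, f ω ≤ R) (hg : Integrable g μ) (hK : ∀ᵐ ω ∂μ, (μ[g | m]) ω ≤ K) :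
    ∫ ω, f ω * g ω ∂μ ≤ K * ∫ ω, f ω ∂μ := by
  have hfm := (hf.mono hm).aestronglyMeasurable (μ := μ)
  have hfb : ∀ᵐ ω ∂μ, ‖f ω‖ ≤ R := ae_of_all _ fun ω => by
    rw [Real.norm_eq_abs, abs_of_nonneg (hf0 ω)]; exact hfR ω
  have hfg : Integrable (f * g) μ := hg.bdd_mul hfm hfb
  have hfc : Integrable (fun ω => f ω * (μ[g | m]) ω) μ := integrable_condExp.bdd_mul hfm hfb
  have h1 := condExp_mul_of_stronglyMeasurable_left hf hfg hg
  calc ∫ ω, f ω * g ω ∂μ = ∫ ω, (μ[f * g | m]) ω ∂μ := (integral_condExp hm).symm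
    _ = ∫ ω, f ω * (μ[g | m]) ω ∂μ := integral_congr_ae h1
    _ ≤ ∫ ω, K * f ω ∂μ := by
      refine integral_mono_ae hfc ((Integrable.of_bound hfm R hfb).const_mul K) ?_
      filter_upwards [hK] with ω h
      rw [mul_comm K]
      exact mul_le_mul_of_nonneg_left h (hf0 ω)
    _ = _ := integral_const_mul _ _

/-- A strong law for weighted sums of martingale differences with bounded conditional moments of
an order `1 < p ≤ 2`. -/
theorem IsNoise.weighted_sum_bounded [IsProbabilityMeasure μ] {F : Filtration ℕ m0}
    {ξ : ℕ → Ω → ℝ} {p K : ℝ} (hξ : IsNoise μ F ξ p K) (hp1 : 1 < p) (hp2 : p ≤ 2)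
    {c U : ℕ → Ω → ℝ} (hc : ∀ k, StronglyMeasurable[F k] (c k))
    (hU : ∀ k, StronglyMeasurable[F k] (U k)) (hUmono : ∀ ω, Monotone fun k => U k ω)
    (hU1 : ∀ k ω, 0 < U k ω) (hcU : ∀ k ω, |c k ω| ≤ U k ω) {C : ℝ}
    (hC : ∀ N ω, ∑ k ∈ Finset.range N, (|c k ω| / U k ω) ^ p ≤ C) :
    ∀ᵐ ω ∂μ, ∃ B, ∀ N, |∑ k ∈ Finset.range (N + 1), c k ω * ξ k ω| ≤ B * U N ω := by
  -- Dividing by the predictable normalizer leaves a martingale transform with summable p-th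
  -- moments; Kronecker's lemma then puts the normalizer back.
  set g : ℕ → Ω → ℝ := fun k ω => c k ω / U k ω with hg
  have hgm : ∀ k, StronglyMeasurable[F k] (g k) := fun k =>
    ((hc k).measurable.div (hU k).measurable).stronglyMeasurable
  have hgm' : ∀ k, AEStronglyMeasurable (g k) μ := fun k =>
    ((hgm k).mono (F.le k)).aestronglyMeasurable
  have hgabs : ∀ k ω, |g k ω| = |c k ω| / U k ω := fun k ω => by
    simp only [hg, abs_div, abs_of_pos (hU1 k ω)]
  have hg1 : ∀ k ω, |g k ω| ≤ 1 := fun k ω => by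
    rw [hgabs, div_le_one (hU1 k ω)]; exact hcU k ω
  have hgp1 : ∀ k ω, |g k ω| ^ p ≤ 1 := fun k ω =>
    Real.rpow_le_one (abs_nonneg _) (hg1 k ω) (by linarith)
  have hgpm : ∀ k, StronglyMeasurable[F k] (fun ω => |g k ω| ^ p) := fun k =>
    ((continuous_abs.measurable.comp (hgm k).measurable).pow_const p).stronglyMeasurable
  have hgpi : ∀ k, Integrable (fun ω => |g k ω| ^ p) μ := fun k =>
    Integrable.of_bound ((hgpm k).mono (F.le k)).aestronglyMeasurable 1 (ae_of_all _ fun ω => by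
      rw [Real.norm_eq_abs, abs_of_nonneg (by positivity)]; exact hgp1 k ω)
  have hYi : ∀ k, Integrable (g k * ξ k) μ := fun k =>
    (hξ.integrable k).bdd_mul (hgm' k) (ae_of_all _ (hg1 k))
  have hpow : ∀ k ω, |(g k * ξ k) ω| ^ p = |g k ω| ^ p * |ξ k ω| ^ p := fun k ω => by
    rw [Pi.mul_apply, abs_mul, Real.mul_rpow (abs_nonneg _) (abs_nonneg _)]
  have key := ae_bounded_sum_martingaleDiff (μ := μ) (F := F) (Y := fun k => g k * ξ k) (p := p)
    (c := K * C) hp1 hp2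
    (fun k => ((hgm k).mono (F.mono (Nat.le_succ k))).mul (hξ.stronglyMeasurable k)) hYi
    (fun k => by
      refine (condExp_mul_of_stronglyMeasurable_left (hgm k) (hYi k) (hξ.integrable k)).trans ?_
      filter_upwards [hξ.condExp_eq_zero k] with ω h
      simp [h])
    (fun k => by
      simp_rw [hpow]
      exact (hξ.integrable_rpow k).bdd_mul (c := 1)
        ((hgpm k).mono (F.le k)).aestronglyMeasurable (ae_of_all _ fun ω => by
          rw [Real.norm_eq_abs, abs_of_nonneg (by positivity)]; exact hgp1 k ω))
    (fun N => by
      simp_rw [hpow]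
      calc ∑ k ∈ Finset.range N, ∫ ω, |g k ω| ^ p * |ξ k ω| ^ p ∂μ
          ≤ ∑ k ∈ Finset.range N, K * ∫ ω, |g k ω| ^ p ∂μ :=
            Finset.sum_le_sum fun k _ => integral_mul_le_of_condExp_le (F.le k) (hgpm k)
              (fun ω => by positivity) (hgp1 k) (hξ.integrable_rpow k) (hξ.condMoment_le k)
        _ = K * ∫ ω, ∑ k ∈ Finset.range N, |g k ω| ^ p ∂μ := by
            rw [integral_finsetSum _ fun k _ => hgpi k, Finset.mul_sum]
        _ ≤ K * ∫ _, C ∂μ := by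
            refine mul_le_mul_of_nonneg_left ?_ hξ.nonneg
            refine integral_mono (integrable_finsetSum _ fun k _ => hgpi k) (integrable_const C)
              fun ω => ?_
            simp only [hgabs]
            exact hC N ω
        _ = K * C := by simp)
  filter_upwards [key] with ω ⟨B, hB⟩
  refine ⟨2 * B, fun N => ?_⟩
  have := abs_sum_mul_le_of_monotone (hUmono ω) (hU1 0 ω).le hB N
  refine le_trans (le_of_eq ?_) this
  congr 1
  refine Finset.sum_congr rfl fun k _ => ?_
  have := (hU1 k ω).ne'
  simp only [hg, Pi.mul_apply]
  field_simp

theorem IsNoise.condExp_sq_le [IsProbabilityMeasure μ] {F : Filtration ℕ m0} {ε : ℕ → Ω → ℝ}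
    {q K : ℝ} (hε : IsNoise μ F ε q K) (hq : 2 ≤ q) (t : ℕ) :
    Integrable (fun ω => ε t ω ^ 2) μ ∧
      ∀ᵐ ω ∂μ, (μ[fun ω => ε t ω ^ 2 | F t]) ω ≤ 1 + K := by
  have hle : ∀ ω, ε t ω ^ 2 ≤ 1 + |ε t ω| ^ q := fun ω => by
    rw [← sq_abs, ← Real.rpow_two]
    rcases le_total |ε t ω| 1 with h | h
    · have := Real.rpow_le_one (abs_nonneg _) h (show (0 : ℝ) ≤ 2 by norm_num)
      have : 0 ≤ |ε t ω| ^ q := by positivity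
      linarith
    · have := Real.rpow_le_rpow_of_exponent_le h hq
      linarith
  have hi1 : Integrable (fun ω => 1 + |ε t ω| ^ q) μ :=
    (integrable_const 1).add (hε.integrable_rpow t)
  have hi : Integrable (fun ω => ε t ω ^ 2) μ := by
    refine hi1.mono' ((hε.integrable t).1.pow 2) (ae_of_all _ fun ω => ?_)
    rw [Real.norm_eq_abs, abs_of_nonneg (by positivity)]
    exact hle ω
  refine ⟨hi, ?_⟩
  have h1 : μ[fun ω => ε t ω ^ 2 | F t] ≤ᵐ[μ] μ[fun ω => 1 + |ε t ω| ^ q | F t] :=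
    condExp_mono hi hi1 (ae_of_all _ hle)
  have h2 : μ[fun ω => 1 + |ε t ω| ^ q | F t] =ᵐ[μ]
      μ[fun _ => (1 : ℝ) | F t] + μ[fun ω => |ε t ω| ^ q | F t] :=
    condExp_add (integrable_const 1) (hε.integrable_rpow t) _
  filter_upwards [h1, h2, hε.condMoment_le t] with ω h1 h2 h3
  rw [h2, Pi.add_apply, condExp_const (F.le t)] at h1
  linarith

/-- Split ε² into its conditional mean, at most 1 + K, and a centred remainder. The remainder has
conditional moments of order q/2, which lies in (1, 2] because 2 < q ≤ 4, so the strong law applies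
with the running sum of the weights as normalizer. -/
theorem IsNoise.weighted_sum_sq_le [IsProbabilityMeasure μ] {F : Filtration ℕ m0}
    {ε : ℕ → Ω → ℝ} {q K : ℝ} (hε : IsNoise μ F ε q K) (hq : 2 < q) (hq4 : q ≤ 4)
    {u : ℕ → Ω → ℝ} (hu : ∀ k, StronglyMeasurable[F k] (u k)) (hu0 : ∀ k ω, 0 ≤ u k ω)
    (hu1 : ∀ k ω, u k ω ≤ 1) :
    ∀ᵐ ω ∂μ, ∃ B, ∀ N, ∑ k ∈ Finset.range N, u k ω * ε k ω ^ 2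
      ≤ B * (1 + ∑ k ∈ Finset.range N, u k ω) := by
  set p := q / 2 with hp
  have hp1 : 1 < p := by rw [hp]; linarith
  have hp2 : p ≤ 2 := by rw [hp]; linarith
  have hK := hε.nonneg
  set v : ℕ → Ω → ℝ := fun k => μ[fun ω => ε k ω ^ 2 | F k] with hv
  have hvm : ∀ k, StronglyMeasurable[F k] (v k) := fun k => stronglyMeasurable_condExp
  have hv0 : ∀ k, 0 ≤ᵐ[μ] v k := fun k => condExp_nonneg (ae_of_all _ fun ω => by positivity)
  have hvK : ∀ k, ∀ᵐ ω ∂μ, v k ω ≤ 1 + K := fun k => (hε.condExp_sq_le hq.le k).2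
  have hi2 : ∀ k, Integrable (fun ω => ε k ω ^ 2) μ := fun k => (hε.condExp_sq_le hq.le k).1
  set ξ : ℕ → Ω → ℝ := fun k ω => ε k ω ^ 2 - v k ω with hξ
  have hξi : ∀ k, Integrable (ξ k) μ := fun k => (hi2 k).sub integrable_condExp
  have hbd : ∀ k, ∀ᵐ ω ∂μ, |ξ k ω| ^ p ≤ |ε k ω| ^ q + (1 + K) ^ p := by
    intro k
    filter_upwards [hv0 k, hvK k] with ω h0 h1
    have h0 : 0 ≤ v k ω := h0
    have h2 : |ε k ω| ^ q = (ε k ω ^ 2) ^ p := by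
      rw [hp, ← sq_abs, ← Real.rpow_two, ← Real.rpow_mul (abs_nonneg _)]; congr 1; ring
    rw [h2]
    have h3 : 0 ≤ (ε k ω ^ 2) ^ p := by positivity
    have h4 : 0 ≤ (1 + K) ^ p := by positivity
    simp only [hξ]
    rcases le_total (v k ω) (ε k ω ^ 2) with h | h
    · have : |ε k ω ^ 2 - v k ω| ^ p ≤ (ε k ω ^ 2) ^ p := by
        refine Real.rpow_le_rpow (abs_nonneg _) ?_ (by linarith)
        rw [abs_of_nonneg (by linarith)]; linarith
      linarith
    · have : |ε k ω ^ 2 - v k ω| ^ p ≤ (1 + K) ^ p := by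
        refine Real.rpow_le_rpow (abs_nonneg _) ?_ (by linarith)
        rw [abs_of_nonpos (by linarith)]; nlinarith [sq_nonneg (ε k ω)]
      linarith
  have hbi : ∀ k, Integrable (fun ω => |ε k ω| ^ q + (1 + K) ^ p) μ := fun k =>
    (hε.integrable_rpow k).add (integrable_const _)
  have hξpi : ∀ k, Integrable (fun ω => |ξ k ω| ^ p) μ := by
    intro k
    refine (hbi k).mono' ((hξi k).1.aemeasurable.abs.pow_const p).aestronglyMeasurable ?_
    filter_upwards [hbd k] with ω h
    rw [Real.norm_eq_abs, abs_of_nonneg (by positivity)]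
    exact h
  have hnoise : IsNoise μ F ξ p (K + (1 + K) ^ p) := by
    refine ⟨fun k => ?_, hξi, fun k => ?_, hξpi, fun k => ?_⟩
    · exact ((hε.stronglyMeasurable k).pow 2).sub ((hvm k).mono (F.mono (Nat.le_succ k)))
    · refine (condExp_sub (hi2 k) integrable_condExp _).trans ?_
      rw [condExp_of_stronglyMeasurable (F.le k) (hvm k) integrable_condExp]
      simp [hv]
    · have h1 := condExp_mono (m := F k) (hξpi k) (hbi k) (hbd k)
      have h2 : μ[fun ω => |ε k ω| ^ q + (1 + K) ^ p | F k] =ᵐ[μ]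
          μ[fun ω => |ε k ω| ^ q | F k] + μ[fun _ => (1 + K) ^ p | F k] :=
        condExp_add (hε.integrable_rpow k) (integrable_const _) _
      filter_upwards [h1, h2, hε.condMoment_le k] with ω h1 h2 h3
      rw [h2, Pi.add_apply, condExp_const (F.le k)] at h1
      linarith
  set U : ℕ → Ω → ℝ := fun k ω => 1 + ∑ j ∈ Finset.range (k + 1), u j ω with hU
  have hUmono : ∀ ω, Monotone fun k => U k ω := fun ω => monotone_nat_of_le_succ fun k => by
    simp only [hU]; rw [Finset.sum_range_succ _ (k + 1)]; linarith [hu0 (k + 1) ω]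
  have hU1 : ∀ k ω, 1 ≤ U k ω := fun k ω => by
    have := Finset.sum_nonneg fun j (_ : j ∈ Finset.range (k + 1)) => hu0 j ω
    simp only [hU]; linarith
  have key := hnoise.weighted_sum_bounded hp1 hp2 (c := u) (U := U) hu
    (fun k => stronglyMeasurable_const.add (Finset.stronglyMeasurable_fun_sum _ fun j hj =>
      (hu j).mono (F.mono (Nat.lt_succ_iff.1 (Finset.mem_range.1 hj)))))
    hUmono (fun k ω => by linarith [hU1 k ω])
    (fun k ω => by rw [abs_of_nonneg (hu0 k ω)]; exact (hu1 k ω).trans (hU1 k ω))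
    (C := 1 / (p - 1)) (fun N ω => by
      refine le_trans (Finset.sum_le_sum fun k _ => ?_) (sum_div_rpow_le (hu0 · ω) hp1 N)
      rw [abs_of_nonneg (hu0 k ω), Real.div_rpow (hu0 k ω) (by linarith [hU1 k ω])]
      have hpos : 0 < U k ω ^ p := Real.rpow_pos_of_pos (by linarith [hU1 k ω]) _
      refine div_le_div_of_nonneg_right ?_ hpos.le
      rcases eq_or_lt_of_le (hu0 k ω) with h | h
      · rw [← h, Real.zero_rpow (by linarith)]
      · simpa using Real.rpow_le_rpow_of_exponent_ge h (hu1 k ω) hp1.le)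
  filter_upwards [key, ae_all_iff.2 hvK] with ω ⟨B, hB⟩ hvK
  have hB0 : 0 ≤ B := by
    by_contra h
    have := (abs_nonneg _).trans (hB 0)
    nlinarith [hU1 0 ω]
  refine ⟨B + (1 + K), fun N => ?_⟩
  rcases N with _ | N
  · simp; linarith
  have h1 : ∑ k ∈ Finset.range (N + 1), u k ω * ε k ω ^ 2
      = ∑ k ∈ Finset.range (N + 1), u k ω * ξ k ω + ∑ k ∈ Finset.range (N + 1), u k ω * v k ω := by
    rw [← Finset.sum_add_distrib]
    refine Finset.sum_congr rfl fun k _ => ?_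
    simp only [hξ]; ring
  have h2 : ∑ k ∈ Finset.range (N + 1), u k ω * v k ω
      ≤ (1 + K) * ∑ k ∈ Finset.range (N + 1), u k ω := by
    rw [Finset.mul_sum]
    refine Finset.sum_le_sum fun k _ => ?_
    rw [mul_comm]
    exact mul_le_mul_of_nonneg_right (hvK k) (hu0 k ω)
  have h3 := (le_abs_self _).trans (hB N)
  rw [h1]
  simp only [hU] at h3
  nlinarith

/-- A martingale is eventually dominated by its own quadratic variation Q. The normalizer is
Q^(3/4): an exponent above 1/2 makes the series of c²/Q^(3/2) converge, one below 1 lets Q absorb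
the result. -/
theorem IsNoise.abs_sum_mul_le [IsProbabilityMeasure μ] {F : Filtration ℕ m0}
    {ε : ℕ → Ω → ℝ} {q K : ℝ} (hε : IsNoise μ F ε q K) (hq : 2 ≤ q)
    {c : ℕ → Ω → ℝ} (hc : ∀ k, StronglyMeasurable[F k] (c k)) :
    ∀ᵐ ω ∂μ, ∃ B, ∀ N, 2 * |∑ k ∈ Finset.range N, c k ω * ε k ω|
      ≤ B + ∑ k ∈ Finset.range N, c k ω ^ 2 := by
  have hnoise : IsNoise μ F ε 2 (1 + K) := by
    refine ⟨hε.stronglyMeasurable, hε.integrable, hε.condExp_eq_zero, fun k => ?_, fun k => ?_⟩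
    · simpa using (hε.condExp_sq_le hq k).1
    · simpa using (hε.condExp_sq_le hq k).2
  set Q : ℕ → Ω → ℝ := fun k ω => 1 + ∑ j ∈ Finset.range (k + 1), c j ω ^ 2 with hQ
  have hQmono : ∀ ω, Monotone fun k => Q k ω := fun ω => monotone_nat_of_le_succ fun k => by
    simp only [hQ]; rw [Finset.sum_range_succ _ (k + 1)]; nlinarith [sq_nonneg (c (k + 1) ω)]
  have hQ1 : ∀ k ω, 1 ≤ Q k ω := fun k ω => by
    have := Finset.sum_nonneg fun j (_ : j ∈ Finset.range (k + 1)) => sq_nonneg (c j ω)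
    simp only [hQ]; linarith
  have hQm : ∀ k, StronglyMeasurable[F k] (Q k) := fun k =>
    stronglyMeasurable_const.add (Finset.stronglyMeasurable_fun_sum _ fun j hj =>
      ((hc j).mono (F.mono (Nat.lt_succ_iff.1 (Finset.mem_range.1 hj)))).pow 2)
  have hU2 : ∀ k ω, (Q k ω ^ (3 / 4 : ℝ)) ^ (2 : ℝ) = Q k ω ^ (3 / 2 : ℝ) := fun k ω => by
    rw [← Real.rpow_mul (by linarith [hQ1 k ω])]; norm_num
  have key := hnoise.weighted_sum_bounded (by norm_num) le_rfl (c := c)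
    (U := fun k ω => Q k ω ^ (3 / 4 : ℝ)) hc
    (fun k => ((hQm k).measurable.pow_const _).stronglyMeasurable)
    (fun ω i j hij => Real.rpow_le_rpow (by linarith [hQ1 i ω]) (hQmono ω hij) (by norm_num))
    (fun k ω => Real.rpow_pos_of_pos (by linarith [hQ1 k ω]) _)
    (fun k ω => by
      have h0 : 0 ≤ Q k ω ^ (3 / 4 : ℝ) := Real.rpow_nonneg (by linarith [hQ1 k ω]) _
      refine abs_le_of_sq_le_sq ?_ h0
      rw [← Real.rpow_two (Q k ω ^ (3 / 4 : ℝ)), hU2]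
      have h1 : Q k ω ^ (1 : ℝ) ≤ Q k ω ^ (3 / 2 : ℝ) :=
        Real.rpow_le_rpow_of_exponent_le (hQ1 k ω) (by norm_num)
      have h2 : c k ω ^ 2 ≤ ∑ j ∈ Finset.range (k + 1), c j ω ^ 2 :=
        Finset.single_le_sum (f := fun j => c j ω ^ 2) (fun j _ => sq_nonneg _)
          (Finset.self_mem_range_succ k)
      rw [Real.rpow_one] at h1
      simp only [hQ] at h1 ⊢
      linarith)
    (C := 1 / (3 / 2 - 1)) (fun N ω => by
      refine le_trans (le_of_eq (Finset.sum_congr rfl fun k _ => ?_))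
        (sum_div_rpow_le (u := fun k => c k ω ^ 2) (fun k => sq_nonneg _)
          (show (1 : ℝ) < 3 / 2 by norm_num) N)
      rw [Real.div_rpow (abs_nonneg _) (Real.rpow_nonneg (by linarith [hQ1 k ω]) _), hU2,
        Real.rpow_two, sq_abs])
  filter_upwards [key] with ω ⟨B, hB⟩
  have hB0 : 0 ≤ B := by
    by_contra h
    have h1 := (abs_nonneg _).trans (hB 0)
    have h2 : 0 < Q 0 ω ^ (3 / 4 : ℝ) := Real.rpow_pos_of_pos (by linarith [hQ1 0 ω]) _
    nlinarith
  refine ⟨(2 * B) ^ 4 + 1, fun N => ?_⟩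
  rcases N with _ | N
  · simp; positivity
  set y := Q N ω ^ (1 / 4 : ℝ) with hy
  have hQ0 : 0 ≤ Q N ω := by linarith [hQ1 N ω]
  have hy0 : 0 ≤ y := Real.rpow_nonneg hQ0 _
  have hy3 : Q N ω ^ (3 / 4 : ℝ) = y ^ 3 := by
    rw [hy, ← Real.rpow_natCast, ← Real.rpow_mul hQ0]; norm_num
  have hy4 : Q N ω = y ^ 4 := by
    rw [hy, ← Real.rpow_natCast, ← Real.rpow_mul hQ0]; norm_num
  have h1 := hB N
  rw [hy3] at h1
  -- The larger of 2B and y dominates.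
  have h2 : 2 * B * y ^ 3 ≤ (2 * B) ^ 4 + y ^ 4 := by
    rcases le_total (2 * B) y with h | h
    · have : 2 * B * y ^ 3 ≤ y * y ^ 3 := by gcongr
      have : 0 ≤ (2 * B) ^ 4 := by positivity
      nlinarith
    · have : 2 * B * y ^ 3 ≤ 2 * B * (2 * B) ^ 3 := by gcongr
      have : 0 ≤ y ^ 4 := by positivity
      nlinarith
  have h3 : 1 + ∑ k ∈ Finset.range (N + 1), c k ω ^ 2 = y ^ 4 := hy4
  linarith

end MartingaleNoise

/-! ### Self-normalized sums and rank-one updates. -/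

section SelfNormalized

variable {n : ℕ}

/-- The regularized Gram matrix `1 + ∑ zₜ zₜᵀ`. -/
def gram (z : ℕ → Fin n → ℝ) (N : ℕ) : Matrix (Fin n) (Fin n) ℝ :=
  1 + ∑ t ∈ Finset.range N, Matrix.vecMulVec (z t) (z t)

/-- The inverse of the regularized Gram matrix, by rank-one updates. -/
noncomputable def gramInv (z : ℕ → Fin n → ℝ) : ℕ → Matrix (Fin n) (Fin n) ℝ
  | 0 => 1
  | N + 1 => gramInv z N - (1 + z N ⬝ᵥ (gramInv z N *ᵥ z N))⁻¹ •
      Matrix.vecMulVec (gramInv z N *ᵥ z N) (gramInv z N *ᵥ z N)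

theorem gram_succ (z : ℕ → Fin n → ℝ) (N : ℕ) :
    gram z (N + 1) = gram z N + Matrix.vecMulVec (z N) (z N) := by
  simp [gram, Finset.sum_range_succ, add_assoc]

theorem gram_isSymm (z : ℕ → Fin n → ℝ) (N : ℕ) : (gram z N)ᵀ = gram z N := by
  simp [gram, Matrix.transpose_sum, Matrix.transpose_vecMulVec]

theorem gramInv_isSymm (z : ℕ → Fin n → ℝ) (N : ℕ) : (gramInv z N)ᵀ = gramInv z N := by
  induction N with
  | zero => simp [gramInv]
  | succ N ih => simp [gramInv, ih, Matrix.transpose_vecMulVec]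

theorem dotProduct_mulVec_comm_of_isSymm {M : Matrix (Fin n) (Fin n) ℝ} (hM : Mᵀ = M)
    (x y : Fin n → ℝ) : x ⬝ᵥ (M *ᵥ y) = y ⬝ᵥ (M *ᵥ x) := by
  rw [Matrix.dotProduct_mulVec, ← Matrix.mulVec_transpose, hM, dotProduct_comm]

theorem dotProduct_vecMulVec_mulVec (x y a b : Fin n → ℝ) :
    x ⬝ᵥ (Matrix.vecMulVec a b *ᵥ y) = (x ⬝ᵥ a) * (b ⬝ᵥ y) := by
  rw [Matrix.vecMulVec_mulVec]
  simp [mul_comm]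

theorem dotProduct_gram_mulVec (z : ℕ → Fin n → ℝ) (N : ℕ) (x : Fin n → ℝ) :
    x ⬝ᵥ (gram z N *ᵥ x) = x ⬝ᵥ x + ∑ t ∈ Finset.range N, (x ⬝ᵥ z t) ^ 2 := by
  induction N with
  | zero => simp [gram]
  | succ N ih =>
    rw [gram_succ, Matrix.add_mulVec, dotProduct_add, ih, dotProduct_vecMulVec_mulVec,
      Finset.sum_range_succ, dotProduct_comm (z N) x]
    ring

theorem gram_quadratic_nonneg (z : ℕ → Fin n → ℝ) (N : ℕ) (x : Fin n → ℝ) :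
    0 ≤ x ⬝ᵥ (gram z N *ᵥ x) := by
  rw [dotProduct_gram_mulVec]
  have h1 : 0 ≤ x ⬝ᵥ x := by simpa using dotProduct_star_self_nonneg x
  have := Finset.sum_nonneg fun t (_ : t ∈ Finset.range N) => sq_nonneg (x ⬝ᵥ z t)
  linarith

theorem gramInv_quadratic_nonneg {z : ℕ → Fin n → ℝ} {N : ℕ} (h : gram z N * gramInv z N = 1)
    (x : Fin n → ℝ) : 0 ≤ x ⬝ᵥ (gramInv z N *ᵥ x) := by
  have h1 : x = gram z N *ᵥ (gramInv z N *ᵥ x) := by rw [Matrix.mulVec_mulVec, h, Matrix.one_mulVec]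
  have h2 := gram_quadratic_nonneg z N (gramInv z N *ᵥ x)
  rwa [← h1, dotProduct_comm] at h2

theorem gram_mul_gramInv (z : ℕ → Fin n → ℝ) (N : ℕ) : gram z N * gramInv z N = 1 := by
  induction N with
  | zero => simp [gram, gramInv]
  | succ N ih =>
    have h0 := gramInv_quadratic_nonneg ih (z N)
    set P := gramInv z N with hP
    set y := P *ᵥ z N with hy
    have h1 : gram z N *ᵥ y = z N := by rw [hy, Matrix.mulVec_mulVec, ih, Matrix.one_mulVec]
    have h2 : z N ᵥ* P = y := by rw [hy, ← Matrix.vecMul_transpose, hP, gramInv_isSymm]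
    rw [gram_succ, gramInv, ← hP, ← hy, Matrix.add_mul, Matrix.mul_sub, Matrix.mul_sub, ih,
      Matrix.mul_smul, Matrix.mul_smul, Matrix.mul_vecMulVec, h1, Matrix.vecMulVec_mul, h2,
      Matrix.vecMulVec_mul_vecMulVec]
    have h3 : (1 + z N ⬝ᵥ y) ≠ 0 := by positivity
    ext i j
    simp only [Matrix.add_apply, Matrix.sub_apply, Matrix.smul_apply, Matrix.vecMulVec_apply,
      smul_eq_mul, Matrix.vecMulVec_smul]
    field_simp
    ring

/-- The matrix determinant lemma, in the form that makes log det telescope in `sum_leverage_le`. -/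
theorem det_gram_succ (z : ℕ → Fin n → ℝ) (N : ℕ) :
    (gram z (N + 1)).det = (gram z N).det * (1 + z N ⬝ᵥ (gramInv z N *ᵥ z N)) := by
  have h1 : gram z (N + 1) = gram z N *
      (1 + Matrix.replicateCol Unit (gramInv z N *ᵥ z N) * Matrix.replicateRow Unit (z N)) := by
    rw [gram_succ, Matrix.mul_add, Matrix.mul_one, ← Matrix.vecMulVec_eq, Matrix.mul_vecMulVec,
      Matrix.mulVec_mulVec, gram_mul_gramInv, Matrix.one_mulVec]
  rw [h1, Matrix.det_mul, Matrix.det_one_add_replicateCol_mul_replicateRow]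

theorem det_gram_pos (z : ℕ → Fin n → ℝ) (N : ℕ) : 0 < (gram z N).det := by
  induction N with
  | zero => simp [gram]
  | succ N ih =>
    rw [det_gram_succ]
    have := gramInv_quadratic_nonneg (gram_mul_gramInv z N) (z N)
    positivity

theorem dotProduct_sq_le (x y : Fin n → ℝ) : (x ⬝ᵥ y) ^ 2 ≤ (x ⬝ᵥ x) * (y ⬝ᵥ y) := by
  have := Finset.sum_mul_sq_le_sq_mul_sq Finset.univ x y
  simpa [dotProduct, sq] using this

/-- Each of the n eigenvalues is a Rayleigh quotient, bounded by Cauchy–Schwarz. -/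
theorem det_gram_le (z : ℕ → Fin n → ℝ) (N : ℕ) :
    (gram z N).det ≤ (1 + ∑ t ∈ Finset.range N, z t ⬝ᵥ z t) ^ n := by
  have hH : (gram z N).IsHermitian := by
    rw [Matrix.IsHermitian, Matrix.conjTranspose_eq_transpose_of_trivial, gram_isSymm]
  have hev : ∀ i, 0 ≤ hH.eigenvalues i ∧
      hH.eigenvalues i ≤ 1 + ∑ t ∈ Finset.range N, z t ⬝ᵥ z t := by
    intro i
    set v : Fin n → ℝ := (hH.eigenvectorBasis i).ofLp with hv
    have h1 : gram z N *ᵥ v = hH.eigenvalues i • v := hH.mulVec_eigenvectorBasis i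
    have h2 : v ⬝ᵥ v = 1 := by
      have := hH.eigenvectorBasis.orthonormal.1 i
      have h3 : ‖hH.eigenvectorBasis i‖ ^ 2 = 1 := by rw [this]; norm_num
      rw [EuclideanSpace.real_norm_sq_eq] at h3
      simpa [dotProduct, sq] using h3
    have h3 : hH.eigenvalues i = v ⬝ᵥ (gram z N *ᵥ v) := by
      rw [h1, dotProduct_smul, h2]; simp
    rw [h3]
    refine ⟨gram_quadratic_nonneg z N v, ?_⟩
    rw [dotProduct_gram_mulVec, h2]
    gcongr with t _
    have := dotProduct_sq_le v (z t)
    rwa [h2, one_mul] at this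
  rw [hH.det_eq_prod_eigenvalues]
  calc ∏ i, ((hH.eigenvalues i : ℝ)) ≤ ∏ _i : Fin n, (1 + ∑ t ∈ Finset.range N, z t ⬝ᵥ z t) :=
        Finset.prod_le_prod (fun i _ => (hev i).1) fun i _ => (hev i).2
    _ = _ := by simp

/-- The weights `zᵀ P z / (1 + zᵀ P z)` of the squared noise in the recursion for the
self-normalized sum. -/
noncomputable def leverage (z : ℕ → Fin n → ℝ) (N : ℕ) : ℝ :=
  (z N ⬝ᵥ (gramInv z N *ᵥ z N)) / (1 + z N ⬝ᵥ (gramInv z N *ᵥ z N))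

theorem leverage_nonneg (z : ℕ → Fin n → ℝ) (N : ℕ) : 0 ≤ leverage z N := by
  have := gramInv_quadratic_nonneg (gram_mul_gramInv z N) (z N)
  unfold leverage; positivity

theorem leverage_le_one (z : ℕ → Fin n → ℝ) (N : ℕ) : leverage z N ≤ 1 := by
  have := gramInv_quadratic_nonneg (gram_mul_gramInv z N) (z N)
  unfold leverage
  rw [div_le_one (by positivity)]; linarith

/-- With h = zᵀPz, the weight h/(1 + h) = 1 − 1/(1 + h) is at most log(1 + h), which is the
increment of log det V. -/
theorem sum_leverage_le (z : ℕ → Fin n → ℝ) (N : ℕ) :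
    ∑ t ∈ Finset.range N, leverage z t
      ≤ n * Real.log (1 + ∑ t ∈ Finset.range N, z t ⬝ᵥ z t) := by
  have h : ∑ t ∈ Finset.range N, leverage z t ≤ Real.log (gram z N).det := by
    induction N with
    | zero => simp [gram]
    | succ N ih =>
      have h0 := gramInv_quadratic_nonneg (gram_mul_gramInv z N) (z N)
      set h := z N ⬝ᵥ (gramInv z N *ᵥ z N) with hh
      rw [Finset.sum_range_succ, det_gram_succ, ← hh,
        Real.log_mul (det_gram_pos z N).ne' (by positivity)]
      have h1 : leverage z N ≤ Real.log (1 + h) := by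
        have h2 := Real.one_sub_inv_le_log_of_pos (show 0 < 1 + h by positivity)
        refine le_trans (le_of_eq ?_) h2
        rw [leverage, ← hh]
        field_simp
        ring
      linarith
  refine h.trans ?_
  rw [← Real.log_pow]
  exact Real.log_le_log (det_gram_pos z N) (det_gram_le z N)

/-- `∑ eₜ zₜ`. -/
def weightedSum (z : ℕ → Fin n → ℝ) (e : ℕ → ℝ) (N : ℕ) : Fin n → ℝ :=
  ∑ t ∈ Finset.range N, e t • z t

/-- The coefficient of the noise in the recursion for the self-normalized sum. -/
noncomputable def crossCoeff (z : ℕ → Fin n → ℝ) (e : ℕ → ℝ) (N : ℕ) : ℝ :=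
  (z N ⬝ᵥ (gramInv z N *ᵥ weightedSum z e N)) / (1 + z N ⬝ᵥ (gramInv z N *ᵥ z N))

/-- The rank-one update gives the increment 2ce − c²(1 + h) + leverage · e² exactly; the factor 1 +
h ≥ 1 is then dropped. The surviving −c² is what later absorbs the martingale ∑ ce. -/
theorem selfNormalized_le (z : ℕ → Fin n → ℝ) (e : ℕ → ℝ) (N : ℕ) :
    weightedSum z e N ⬝ᵥ (gramInv z N *ᵥ weightedSum z e N)
      ≤ ∑ t ∈ Finset.range N,
        (2 * (crossCoeff z e t * e t) - crossCoeff z e t ^ 2 + leverage z t * e t ^ 2) := by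
  induction N with
  | zero => simp [weightedSum]
  | succ N ih =>
    have h0 := gramInv_quadratic_nonneg (gram_mul_gramInv z N) (z N)
    have hs : weightedSum z e (N + 1) = weightedSum z e N + e N • z N := by
      simp [weightedSum, Finset.sum_range_succ]
    have hsymm := dotProduct_mulVec_comm_of_isSymm (gramInv_isSymm z N)
      (weightedSum z e N) (z N)
    rw [Finset.sum_range_succ, hs, gramInv, leverage, crossCoeff]
    set P := gramInv z N
    set S := weightedSum z e N
    set x := z N
    simp only [Matrix.sub_mulVec, Matrix.smul_mulVec, dotProduct_sub, dotProduct_smul,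
      dotProduct_vecMulVec_mulVec, Matrix.mulVec_add, dotProduct_add, add_dotProduct,
      Matrix.mulVec_smul, smul_dotProduct, smul_eq_mul, dotProduct_comm (P *ᵥ x), hsymm]
    set h := x ⬝ᵥ (P *ᵥ x)
    set a := x ⬝ᵥ (P *ᵥ S)
    set L := S ⬝ᵥ (P *ᵥ S)
    have h1 : (0 : ℝ) < 1 + h := by positivity
    have key : (L + e N * a + e N * (a + e N * h)) -
        (1 + h)⁻¹ * ((a + e N * h) * (a + e N * h))
        = L + (2 * (a / (1 + h) * e N) - (a / (1 + h)) ^ 2 * (1 + h) + h / (1 + h) * e N ^ 2) := by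
      field_simp
      ring
    have h2 : (a / (1 + h)) ^ 2 ≤ (a / (1 + h)) ^ 2 * (1 + h) :=
      le_mul_of_one_le_right (sq_nonneg _) (by linarith)
    linarith

/-- Expand the nonnegative form of V at θ − V⁻¹S. Being linear in S, this form of the bound suits
both applications and avoids inverse matrices there. -/
theorem two_mul_dotProduct_le (z : ℕ → Fin n → ℝ) (N : ℕ) (θ S : Fin n → ℝ) :
    2 * (θ ⬝ᵥ S) ≤ θ ⬝ᵥ (gram z N *ᵥ θ) + S ⬝ᵥ (gramInv z N *ᵥ S) := by
  set η := gramInv z N *ᵥ S with hη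
  have h1 : gram z N *ᵥ η = S := by
    rw [hη, Matrix.mulVec_mulVec, gram_mul_gramInv, Matrix.one_mulVec]
  have h2 := gram_quadratic_nonneg z N (θ - η)
  have h3 := dotProduct_mulVec_comm_of_isSymm (gram_isSymm z N) η θ
  simp only [Matrix.mulVec_sub, dotProduct_sub, sub_dotProduct, h1, h3] at h2
  rw [dotProduct_comm η S] at h2
  linarith

theorem measurable_dotProduct {Ω : Type*} {m : MeasurableSpace Ω} {x y : Ω → Fin n → ℝ}
    (hx : ∀ i, Measurable fun ω => x ω i) (hy : ∀ i, Measurable fun ω => y ω i) :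
    Measurable fun ω => x ω ⬝ᵥ y ω :=
  Finset.measurable_fun_sum _ fun i _ => (hx i).mul (hy i)

/-- The inverse after N updates involves only z_t with t < N, so the leverage and the cross
coefficient at time N are predictable. -/
theorem measurable_gramInv {Ω : Type*} {m : MeasurableSpace Ω} {z : ℕ → Ω → Fin n → ℝ} (N : ℕ)
    (hz : ∀ t < N, ∀ i, Measurable fun ω => z t ω i) (i j : Fin n) :
    Measurable fun ω => gramInv (fun t => z t ω) N i j := by
  induction N generalizing i j with
  | zero => simp only [gramInv]; exact measurable_const
  | succ N ih =>
    have h1 : ∀ i, Measurable fun ω => (gramInv (fun t => z t ω) N *ᵥ z N ω) i := fun i =>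
      measurable_dotProduct (ih (fun t ht => hz t (by omega)) i) (hz N (by omega))
    simp only [gramInv, Matrix.sub_apply, Matrix.smul_apply, Matrix.vecMulVec_apply, smul_eq_mul]
    exact (ih (fun t ht => hz t (by omega)) i j).sub
      ((measurable_const.add (measurable_dotProduct (hz N (by omega)) h1)).inv.mul
        ((h1 i).mul (h1 j)))

variable {Ω : Type*} {m0 : MeasurableSpace Ω} {μ : Measure Ω}

/-- The self-normalized bound of Lai and Wei, in variational form. -/
theorem IsNoise.two_mul_dotProduct_weightedSum_le [IsProbabilityMeasure μ] {F : Filtration ℕ m0}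
    {ε : ℕ → Ω → ℝ} {q K : ℝ} (hε : IsNoise μ F ε q K) (hq : 2 < q) (hq4 : q ≤ 4)
    {z : ℕ → Ω → Fin n → ℝ} (hz : ∀ t i, Measurable[F t] fun ω => z t ω i) :
    ∀ᵐ ω ∂μ, ∃ C, 0 ≤ C ∧ ∀ (N : ℕ) (θ : Fin n → ℝ),
      2 * (θ ⬝ᵥ ∑ t ∈ Finset.range N, ε t ω • z t ω)
        ≤ θ ⬝ᵥ θ + ∑ t ∈ Finset.range N, (θ ⬝ᵥ z t ω) ^ 2
          + C * (1 + Real.log (1 + ∑ t ∈ Finset.range N, z t ω ⬝ᵥ z t ω)) := by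
  have hPm : ∀ N i j, Measurable[F N] fun ω => gramInv (fun t => z t ω) N i j := fun N i j =>
    measurable_gramInv N (fun t ht i => (hz t i).mono (F.mono ht.le) le_rfl) i j
  have hPz : ∀ N i, Measurable[F N] fun ω => (gramInv (fun t => z t ω) N *ᵥ z N ω) i :=
    fun N i => measurable_dotProduct (hPm N i) (hz N)
  have hh : ∀ N, Measurable[F N] fun ω =>
      z N ω ⬝ᵥ (gramInv (fun t => z t ω) N *ᵥ z N ω) := fun N =>
    measurable_dotProduct (hz N) (hPz N)
  have hS : ∀ N i, Measurable[F N] fun ω =>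
      weightedSum (fun t => z t ω) (fun t => ε t ω) N i := fun N i => by
    simp only [weightedSum, Finset.sum_apply, Pi.smul_apply, smul_eq_mul]
    refine Finset.measurable_fun_sum _ fun t ht => ?_
    have ht' := Finset.mem_range.1 ht
    exact ((hε.stronglyMeasurable t).measurable.mono (F.mono ht') le_rfl).mul
      ((hz t i).mono (F.mono ht'.le) le_rfl)
  have hu : ∀ N, Measurable[F N] fun ω => leverage (fun t => z t ω) N := fun N =>
    (hh N).div (measurable_const.add (hh N))
  have hc : ∀ N, Measurable[F N] fun ω => crossCoeff (fun t => z t ω) (fun t => ε t ω) N :=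
    fun N => (measurable_dotProduct (hz N) fun i => measurable_dotProduct (hPm N i) (hS N)).div
      (measurable_const.add (hh N))
  filter_upwards [hε.weighted_sum_sq_le hq hq4 (fun N => (hu N).stronglyMeasurable)
    (fun N ω => leverage_nonneg _ N) (fun N ω => leverage_le_one _ N),
    hε.abs_sum_mul_le hq.le (fun N => (hc N).stronglyMeasurable)] with ω ⟨B, hB⟩ ⟨B', hB'⟩
  have hB0 : 0 ≤ B := by simpa using hB 0
  have hB0' : 0 ≤ B' := by simpa using hB' 0
  -- B' is what remains of the cross term once its quadratic variation has cancelled; B(1 + n) pays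
  -- for the leverage-weighted squares.
  refine ⟨B' + B * (1 + n), by positivity, fun N θ => ?_⟩
  have h1 := two_mul_dotProduct_le (fun t => z t ω) N θ
    (weightedSum (fun t => z t ω) (fun t => ε t ω) N)
  have h2 := selfNormalized_le (fun t => z t ω) (fun t => ε t ω) N
  rw [dotProduct_gram_mulVec] at h1
  rw [Finset.sum_add_distrib, Finset.sum_sub_distrib, ← Finset.mul_sum] at h2
  have h3 := hB N
  have h4 := hB' N
  have h5 := sum_leverage_le (fun t => z t ω) N
  have h6 := le_abs_self (∑ t ∈ Finset.range N,
    crossCoeff (fun t => z t ω) (fun t => ε t ω) t * ε t ω)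
  have h7 : 0 ≤ Real.log (1 + ∑ t ∈ Finset.range N, z t ω ⬝ᵥ z t ω) := by
    refine Real.log_nonneg ?_
    have := Finset.sum_nonneg fun t (_ : t ∈ Finset.range N) =>
      (show 0 ≤ z t ω ⬝ᵥ z t ω by simpa using dotProduct_star_self_nonneg (z t ω))
    linarith
  set Λ := Real.log (1 + ∑ t ∈ Finset.range N, z t ω ⬝ᵥ z t ω)
  have h8 := mul_le_mul_of_nonneg_left h5 hB0
  have h9 : 0 ≤ B * Λ := by positivity
  have h10 : 0 ≤ B' * Λ := by positivity
  have h11 : 0 ≤ B * n := by positivity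
  have h12 : ∑ t ∈ Finset.range N, ε t ω • z t ω
    = weightedSum (fun t => z t ω) (fun t => ε t ω) N := rfl
  rw [h12]
  nlinarith

end SelfNormalized

/-! ### Conditioning on independent information, and localization. -/

section ConditionalExpectation

variable {Ω : Type*} {m0 : MeasurableSpace Ω} {μ : Measure Ω}

theorem setIntegral_inter_eq_of_indep [IsProbabilityMeasure μ] {J m' : MeasurableSpace Ω}
    (hJ : J ≤ m0) (hm' : m' ≤ m0) (hindep : Indep m' J μ) {f : Ω → ℝ}
    (hf : StronglyMeasurable[J] f) (hfi : Integrable f μ) {a b : Set Ω}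
    (ha : MeasurableSet[J] a) (hb : MeasurableSet[m'] b) :
    ∫ ω in a ∩ b, f ω ∂μ = μ.real b * ∫ ω in a, f ω ∂μ := by
  have hone : StronglyMeasurable[m'] (b.indicator fun _ => (1 : ℝ)) :=
    stronglyMeasurable_const.indicator hb
  have honei : Integrable (b.indicator fun _ => (1 : ℝ)) μ :=
    (integrable_const 1).indicator (hm' _ hb)
  have hfa : StronglyMeasurable[J] (a.indicator f) := hf.indicator ha
  have hprod : a.indicator f * b.indicator (fun _ => (1 : ℝ)) = (a ∩ b).indicator f := by
    ext ω
    by_cases h1 : ω ∈ a <;> by_cases h2 : ω ∈ b <;> simp [h1, h2]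
  have hpi : Integrable (a.indicator f * b.indicator (fun _ => (1 : ℝ))) μ := by
    rw [hprod]; exact hfi.indicator ((hJ _ ha).inter (hm' _ hb))
  have h1 := condExp_mul_of_stronglyMeasurable_left hfa hpi honei
  have h2 := condExp_indep_eq hm' hJ hone hindep
  rw [← integral_indicator ((hJ _ ha).inter (hm' _ hb)), ← hprod, ← integral_condExp hJ,
    integral_congr_ae h1, ← integral_indicator (hJ _ ha), ← integral_const_mul]
  refine integral_congr_ae ?_
  filter_upwards [h2] with ω h2
  rw [Pi.mul_apply, h2, integral_indicator_const _ (hm' _ hb)]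
  simp [mul_comm]

/-- Enlarging the conditioning by information independent of everything in sight does not change a
conditional expectation. -/
theorem condExp_sup_eq_of_indep [IsProbabilityMeasure μ] {m J m' : MeasurableSpace Ω}
    (hmJ : m ≤ J) (hJ : J ≤ m0) (hm' : m' ≤ m0) (hindep : Indep m' J μ) {f : Ω → ℝ}
    (hf : StronglyMeasurable[J] f) (hfi : Integrable f μ) :
    μ[f | m ⊔ m'] =ᵐ[μ] μ[f | m] := by
  have hm : m ≤ m0 := hmJ.trans hJ
  have hsup : m ⊔ m' ≤ m0 := sup_le hm hm'
  have hgi : Integrable (μ[f | m]) μ := integrable_condExp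
  have hgm : StronglyMeasurable[m] (μ[f | m]) := stronglyMeasurable_condExp
  refine (ae_eq_condExp_of_forall_setIntegral_eq hsup hfi (fun _ _ _ => hgi.integrableOn) ?_
    (hgm.mono le_sup_left).aestronglyMeasurable).symm
  -- The join is generated by the π-system of intersections a ∩ b, on which independence factors out
  -- μ(b).
  have hgen : m ⊔ m' = MeasurableSpace.generateFrom
      {c | ∃ a b, MeasurableSet[m] a ∧ MeasurableSet[m'] b ∧ c = a ∩ b} := by
    refine le_antisymm (sup_le ?_ ?_) (MeasurableSpace.generateFrom_le ?_)
    · exact fun a ha => MeasurableSpace.measurableSet_generateFrom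
        ⟨a, Set.univ, ha, MeasurableSet.univ, by simp⟩
    · exact fun b hb => MeasurableSpace.measurableSet_generateFrom
        ⟨Set.univ, b, MeasurableSet.univ, hb, by simp⟩
    · rintro c ⟨a, b, ha, hb, rfl⟩
      exact MeasurableSet.inter ((le_sup_left : m ≤ m ⊔ m') _ ha)
        ((le_sup_right : m' ≤ m ⊔ m') _ hb)
  have hpi : IsPiSystem {c | ∃ a b, MeasurableSet[m] a ∧ MeasurableSet[m'] b ∧ c = a ∩ b} := by
    rintro c ⟨a, b, ha, hb, rfl⟩ c' ⟨a', b', ha', hb', rfl⟩ _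
    exact ⟨a ∩ a', b ∩ b', ha.inter ha', hb.inter hb', Set.inter_inter_inter_comm a b a' b'⟩
  have huniv : ∫ ω, (μ[f | m]) ω ∂μ = ∫ ω, f ω ∂μ := integral_condExp hm
  have key : ∀ c, MeasurableSet[m ⊔ m'] c → ∫ ω in c, (μ[f | m]) ω ∂μ = ∫ ω in c, f ω ∂μ := by
    refine MeasurableSpace.induction_on_inter hgen hpi (by simp) ?_ ?_ ?_
    · rintro c ⟨a, b, ha, hb, rfl⟩
      rw [setIntegral_inter_eq_of_indep hJ hm' hindep (hgm.mono hmJ) hgi (hmJ _ ha) hb,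
        setIntegral_inter_eq_of_indep hJ hm' hindep hf hfi (hmJ _ ha) hb,
        setIntegral_condExp hm hfi ha]
    · intro c hc h
      have h1 := integral_add_compl (hsup _ hc) hgi
      have h2 := integral_add_compl (hsup _ hc) hfi
      linarith
    · intro c hd hc h
      rw [integral_iUnion (fun i => hsup _ (hc i)) hd hgi.integrableOn,
        integral_iUnion (fun i => hsup _ (hc i)) hd hfi.integrableOn]
      exact tsum_congr h
  exact fun c hc _ => key c hc

/-- Used to let the filtration see the next mode: m' t is generated by s_{t+1}, and J t is a past
that already contains the noise at time t. -/
theorem IsNoise.of_indep_sup [IsProbabilityMeasure μ] {F F' : Filtration ℕ m0} {ε : ℕ → Ω → ℝ}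
    {q K : ℝ} (h : IsNoise μ F ε q K) {J m' : ℕ → MeasurableSpace Ω}
    (hF' : ∀ t, F' t = F t ⊔ m' t) (hFJ : ∀ t, F t ≤ J t) (hJ : ∀ t, J t ≤ m0)
    (hm' : ∀ t, m' t ≤ m0) (hindep : ∀ t, Indep (m' t) (J t) μ)
    (hε : ∀ t, StronglyMeasurable[J t] (ε t)) : IsNoise μ F' ε q K := by
  refine ⟨fun t => (h.stronglyMeasurable t).mono ?_, h.integrable, fun t => ?_, h.integrable_rpow,
    fun t => ?_⟩
  · rw [hF']; exact le_sup_left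
  · rw [hF']
    exact (condExp_sup_eq_of_indep (hFJ t) (hJ t) (hm' t) (hindep t) (hε t)
      (h.integrable t)).trans (h.condExp_eq_zero t)
  · rw [hF']
    have h1 : StronglyMeasurable[J t] fun ω => |ε t ω| ^ q :=
      ((continuous_abs.measurable.comp (hε t).measurable).pow_const q).stronglyMeasurable
    filter_upwards [condExp_sup_eq_of_indep (hFJ t) (hJ t) (hm' t) (hindep t) h1
      (h.integrable_rpow t), h.condMoment_le t] with ω h2 h3
    rwa [h2]

theorem condLExp_indicator [IsProbabilityMeasure μ] {m : MeasurableSpace Ω} (hm : m ≤ m0)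
    (X : Ω → ℝ≥0∞) {B : Set Ω} (hB : MeasurableSet[m] B) :
    B.indicator (μ⁻[X | m]) =ᵐ[μ] μ⁻[B.indicator X | m] := by
  refine ae_eq_condLExp hm μ _ ((measurable_condLExp m μ X).indicator hB) fun c hc => ?_
  rw [setLIntegral_indicator (hm _ hB), setLIntegral_indicator (hm _ hB),
    setLIntegral_condLExp hm _ _ (hB.inter hc)]

/-- The power need not be integrable on the whole space, but on an event of the conditioning
σ-algebra where its extended conditional expectation is at most K, its integral is at most K. -/
theorem condExp_rpow_indicator_le [IsProbabilityMeasure μ] {m : MeasurableSpace Ω} (hm : m ≤ m0)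
    {E : Type*} [NormedAddCommGroup E] [MeasurableSpace E] [BorelSpace E] {X : Ω → E}
    (hX : Measurable[m0] X) {α : ℝ} (K : ℕ) :
    let B := {ω | (μ⁻[fun ω => ‖X ω‖ₑ ^ α | m]) ω ≤ K}
    Integrable (B.indicator fun ω => ‖X ω‖ ^ α) μ ∧
      ∀ᵐ ω ∂μ, (μ[B.indicator fun ω => ‖X ω‖ ^ α | m]) ω ≤ K := by
  intro B
  set g : Ω → ℝ≥0∞ := fun ω => ‖X ω‖ₑ ^ α with hg
  have hBm : MeasurableSet[m] B := measurable_condLExp m μ g measurableSet_Iic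
  have hgm : Measurable[m0] g :=
    (measurable_enorm.pow_const α).comp hX
  have hind := condLExp_indicator hm g hBm (μ := μ)
  have hfin : ∫⁻ ω, B.indicator g ω ∂μ ≠ ∞ := by
    have h1 : ∫⁻ ω, B.indicator g ω ∂μ ≤ K := by
      rw [← lintegral_condLExp hm, ← lintegral_congr_ae hind]
      calc ∫⁻ ω, B.indicator (μ⁻[g | m]) ω ∂μ ≤ ∫⁻ _, (K : ℝ≥0∞) ∂μ := by
            refine lintegral_mono fun ω => ?_
            by_cases h : ω ∈ B
            · simp only [Set.indicator_of_mem h]; exact h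
            · simp [Set.indicator_of_notMem h]
        _ = K := by simp
    exact ne_top_of_le_ne_top (ENNReal.natCast_ne_top K) h1
  have htoReal : (fun ω => (B.indicator g ω).toReal) = B.indicator fun ω => ‖X ω‖ ^ α := by
    ext ω
    by_cases h : ω ∈ B
    · simp [h, hg, ← ENNReal.toReal_rpow]
    · simp [h]
  have hBg : Measurable[m0] (B.indicator g) := hgm.indicator (hm _ hBm)
  rw [← htoReal]
  refine ⟨integrable_toReal_of_lintegral_ne_top hBg.aemeasurable hfin, ?_⟩
  filter_upwards [toReal_condLExp m hBg.aemeasurable hfin, hind] with ω h1 h2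
  rw [← h1, ← h2]
  refine ENNReal.toReal_le_of_le_ofReal (Nat.cast_nonneg K) ?_
  by_cases h : ω ∈ B
  · simp only [Set.indicator_of_mem h, ENNReal.ofReal_natCast]; exact h
  · simp [Set.indicator_of_notMem h]

end ConditionalExpectation

/-! ### The two filtrations of the system. -/

section SigmaAlgebras

variable {Ω : Type*} {m0 : MeasurableSpace Ω} {n k : ℕ} {x : ℕ → Ω → EuclideanSpace ℝ (Fin n)}
  {s : ℕ → Ω → Fin k}

theorem measurable_state_history {j t : ℕ} (h : j ≤ t) : Measurable[history x s t] (x j) :=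
  (comap_measurable (x j)).mono ((le_iSup₂
    (f := fun j (_ : j ∈ Set.Iic t) => MeasurableSpace.comap (x j) inferInstance) j h).trans le_sup_left)
    le_rfl

theorem measurable_mode_history {j t : ℕ} (h : j ≤ t) : Measurable[history x s t] (s j) :=
  (comap_measurable (s j)).mono ((le_iSup₂
    (f := fun j (_ : j ∈ Set.Iic t) => MeasurableSpace.comap (s j) inferInstance) j h).trans le_sup_right)
    le_rfl

theorem measurable_state_past {j t : ℕ} (h : j ≤ t) : Measurable[past x s t] (x j) :=
  (comap_measurable (x j)).mono ((le_iSup₂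
    (f := fun j (_ : j ∈ Set.Iic t) => MeasurableSpace.comap (x j) inferInstance) j h).trans le_sup_left)
    le_rfl

theorem measurable_mode_past {j t : ℕ} (h : j < t) : Measurable[past x s t] (s j) :=
  (comap_measurable (s j)).mono ((le_iSup₂
    (f := fun j (_ : j ∈ Set.Iio t) => MeasurableSpace.comap (s j) inferInstance) j h).trans le_sup_right)
    le_rfl

theorem history_le {m : MeasurableSpace Ω} {t : ℕ} (hx : ∀ j ≤ t, Measurable[m] (x j))
    (hs : ∀ j ≤ t, Measurable[m] (s j)) : history x s t ≤ m :=
  sup_le (iSup₂_le fun j hj => (hx j hj).comap_le) (iSup₂_le fun j hj => (hs j hj).comap_le)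

theorem past_le {m : MeasurableSpace Ω} {t : ℕ} (hx : ∀ j ≤ t, Measurable[m] (x j))
    (hs : ∀ j < t, Measurable[m] (s j)) : past x s t ≤ m :=
  sup_le (iSup₂_le fun j hj => (hx j hj).comap_le) (iSup₂_le fun j hj => (hs j hj).comap_le)

theorem history_le_past_succ (t : ℕ) : history x s t ≤ past x s (t + 1) :=
  history_le (fun _ hj => measurable_state_past (by omega)) fun _ hj =>
    measurable_mode_past (by omega)

theorem past_le_history (t : ℕ) : past x s t ≤ history x s t :=
  past_le (fun _ hj => measurable_state_history hj) fun _ hj => measurable_mode_history hj.le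

/-- The filtration `σ(x_{0:t}, s_{0:t})`. -/
def historyFiltration (hx : ∀ t, Measurable (x t)) (hs : ∀ t, Measurable (s t)) :
    Filtration ℕ m0 where
  seq := history x s
  mono' _ _ hij := history_le (fun _ hj => measurable_state_history (hj.trans hij)) fun _ hj =>
    measurable_mode_history (hj.trans hij)
  le' _ := history_le (fun j _ => hx j) fun j _ => hs j

/-- The filtration `σ(x_{0:t}, s_{0:t+1})`. -/
def lookaheadFiltration (hx : ∀ t, Measurable (x t)) (hs : ∀ t, Measurable (s t)) :
    Filtration ℕ m0 where
  seq t := history x s t ⊔ MeasurableSpace.comap (s (t + 1)) inferInstance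
  mono' := monotone_nat_of_le_succ fun t => by
    refine sup_le ((historyFiltration hx hs).mono (Nat.le_succ t) |>.trans le_sup_left) ?_
    exact (measurable_mode_history le_rfl).comap_le.trans le_sup_left
  le' _ := sup_le (history_le (fun j _ => hx j) fun j _ => hs j) (hs _).comap_le

end SigmaAlgebras

/-! ### Measurability along the system. -/

section SwitchedSystem

variable {Ω : Type*} {m0 : MeasurableSpace Ω} {n k : ℕ} {A : Fin k → Matrix (Fin n) (Fin n) ℝ}
  {x0 : EuclideanSpace ℝ (Fin n)} {s : ℕ → Ω → Fin k} {w : ℕ → Ω → EuclideanSpace ℝ (Fin n)}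

theorem measurable_toEuclideanLin_apply {m : MeasurableSpace Ω}
    (A : Fin k → Matrix (Fin n) (Fin n) ℝ) {σ : Ω → Fin k} {y : Ω → EuclideanSpace ℝ (Fin n)}
    (hσ : Measurable σ) (hy : Measurable y) :
    Measurable fun ω => Matrix.toEuclideanLin (A (σ ω)) (y ω) := by
  have h : ∀ i, Measurable fun y : EuclideanSpace ℝ (Fin n) => Matrix.toEuclideanLin (A i) y :=
    fun i => (LinearMap.continuous_of_finiteDimensional (Matrix.toEuclideanLin (A i))).measurable
  have h2 : (fun ω => Matrix.toEuclideanLin (A (σ ω)) (y ω)) = fun ω => ∑ i,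
      (σ ⁻¹' {i}).indicator (fun ω => Matrix.toEuclideanLin (A i) (y ω)) ω := by
    ext1 ω
    rw [Finset.sum_eq_single (σ ω)]
    · simp
    · intro i _ hi
      exact Set.indicator_of_notMem (fun h => hi (by simpa using h.symm)) _
    · simp
  rw [h2]
  exact Finset.measurable_fun_sum _ fun i _ =>
    ((h i).comp hy).indicator (hσ (measurableSet_singleton i))

theorem measurable_state (hs : ∀ t, Measurable (s t)) (hw : ∀ t, Measurable (w t)) (t : ℕ) :
    Measurable (state A x0 s w t) := by
  induction t with
  | zero => exact measurable_const
  | succ t ih => exact (measurable_toEuclideanLin_apply A (hs t) ih).add (hw t)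

/-- The noise w_t can be read off from x_{t+1}, x_t and s_t, hence is known before s_{t+1} is drawn.
-/
theorem measurable_noise_past (t : ℕ) : Measurable[past (state A x0 s w) s (t + 1)] (w t) := by
  have h : w t = fun ω => state A x0 s w (t + 1) ω
      - Matrix.toEuclideanLin (A (s t ω)) (state A x0 s w t ω) := by
    ext1 ω; simp [state]
  rw [h]
  exact (measurable_state_past (x := state A x0 s w) (s := s) le_rfl).sub
    (measurable_toEuclideanLin_apply A (measurable_mode_past (Nat.lt_succ_self t))
      (measurable_state_past (Nat.le_succ t)))

end SwitchedSystem

/-- The indicator of the event that the mode at time `t` is `i`. -/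
noncomputable def modeInd {Ω : Type*} {k : ℕ} (s : ℕ → Ω → Fin k) (i : Fin k) (t : ℕ) : Ω → ℝ :=
  (s t ⁻¹' {i}).indicator fun _ => 1

theorem modeInd_eq {Ω : Type*} {k : ℕ} (s : ℕ → Ω → Fin k) (i : Fin k) (t : ℕ) (ω : Ω) : modeInd s i t ω = if s t ω = i then 1 else 0 := by
  by_cases h : s t ω = i <;> simp [modeInd, h]

/-! ### Localization of the noise. -/

section TruncatedNoise

variable {Ω : Type*} [MeasurableSpace Ω] {μ : Measure Ω} {n k : ℕ}
  {A : Fin k → Matrix (Fin n) (Fin n) ℝ} {x0 : EuclideanSpace ℝ (Fin n)} {s : ℕ → Ω → Fin k}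
  {w : ℕ → Ω → EuclideanSpace ℝ (Fin n)} {p : Fin k → ℝ} {α : ℝ}
  {C : Matrix (Fin n) (Fin n) ℝ}

/-- The event that the conditional moment of `w_t` is at most `K`. -/
def momentSet (μ : Measure Ω) (x : ℕ → Ω → EuclideanSpace ℝ (Fin n)) (s : ℕ → Ω → Fin k)
    (w : ℕ → Ω → EuclideanSpace ℝ (Fin n)) (α : ℝ) (K t : ℕ) : Set Ω :=
  {ω | (μ⁻[fun ω' => ‖w t ω'‖ₑ ^ α | history x s t]) ω ≤ K}

/-- A coordinate of the noise, set to zero where its conditional moment exceeds `K`. -/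
noncomputable def truncNoise (μ : Measure Ω) (x : ℕ → Ω → EuclideanSpace ℝ (Fin n))
    (s : ℕ → Ω → Fin k) (w : ℕ → Ω → EuclideanSpace ℝ (Fin n)) (α : ℝ) (K : ℕ) (r : Fin n)
    (t : ℕ) : Ω → ℝ :=
  (momentSet μ x s w α K t).indicator fun ω => w t ω r

theorem measurableSet_momentSet (x : ℕ → Ω → EuclideanSpace ℝ (Fin n)) (K t : ℕ) :
    MeasurableSet[history x s t] (momentSet μ x s w α K t) :=
  measurable_condLExp (history x s t) μ (fun ω' => ‖w t ω'‖ₑ ^ α) measurableSet_Iic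

/-- A finite supremum lies below some integer K, and for that K the localized noise equals the true
one at all times (`truncNoise_eq`). Almost sure statements proved for every K therefore transfer. -/
theorem ae_exists_forall_mem_momentSet
    (hw : NoiseAssumption μ (state A x0 s w) s w α C) :
    ∀ᵐ ω ∂μ, ∃ K : ℕ, ∀ t, ω ∈ momentSet μ (state A x0 s w) s w α K t := by
  filter_upwards [hw.condMoment] with ω h
  obtain ⟨K, hK⟩ := ENNReal.exists_nat_gt h.ne
  exact ⟨K, fun t => (le_iSup (fun t =>
    (μ⁻[fun ω' => ‖w t ω'‖ₑ ^ α | history (state A x0 s w) s t]) ω) t).trans hK.le⟩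

theorem stronglyMeasurable_truncNoise_past (K : ℕ) (r : Fin n) (t : ℕ) :
    StronglyMeasurable[past (state A x0 s w) s (t + 1)]
      (truncNoise μ (state A x0 s w) s w α K r t) := by
  have h : Measurable fun v : EuclideanSpace ℝ (Fin n) => v r := by fun_prop
  exact ((h.comp (measurable_noise_past t)).stronglyMeasurable).indicator
    (history_le_past_succ t _ (measurableSet_momentSet _ K t))

theorem abs_apply_le_norm (v : EuclideanSpace ℝ (Fin n)) (r : Fin n) : |v r| ≤ ‖v‖ := by
  simpa using PiLp.norm_apply_le v r

theorem rpow_le_one_add_rpow {a b q α : ℝ} (ha : 0 ≤ a) (hab : a ≤ b) (hq : 0 ≤ q)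
    (hqα : q ≤ α) : a ^ q ≤ 1 + b ^ α := by
  have h0 : 0 ≤ b ^ α := Real.rpow_nonneg (ha.trans hab) _
  rcases le_total a 1 with h | h
  · linarith [Real.rpow_le_one ha h hq]
  · have h1 := Real.rpow_le_rpow ha hab hq
    have h2 := Real.rpow_le_rpow_of_exponent_le (h.trans hab) hqα
    linarith

/-- The localizing event belongs to the history at time t, so multiplying by its indicator preserves
the martingale difference property. The 1 in 1 + K comes from lowering the moment order from α to q.
-/
theorem isNoise_truncNoise [IsProbabilityMeasure μ] (hs : IIDSwitching μ (state A x0 s w) s p)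
    (hw : NoiseAssumption μ (state A x0 s w) s w α C) {q : ℝ} (hq : 0 < q) (hqα : q ≤ α) (K : ℕ)
    (r : Fin n) :
    IsNoise μ (historyFiltration (measurable_state (A := A) (x0 := x0) hs.measurable hw.measurable)
        hs.measurable)
      (truncNoise μ (state A x0 s w) s w α K r) q (1 + K) := by
  set x := state A x0 s w with hx
  set F := historyFiltration (x := x) (measurable_state hs.measurable hw.measurable) hs.measurable
    with hF
  have hFt : ∀ t, F t = history x s t := fun t => rfl
  have hle : ∀ t, history x s t ≤ _ := F.le
  have hcoord : ∀ t, Integrable (fun ω => w t ω r) μ := fun t =>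
    (EuclideanSpace.proj (𝕜 := ℝ) r).integrable_comp (hw.integrable t)
  have hBm : ∀ t, MeasurableSet[history x s t] (momentSet μ x s w α K t) :=
    measurableSet_momentSet x K
  have hmom : ∀ t, Integrable ((momentSet μ x s w α K t).indicator fun ω => ‖w t ω‖ ^ α) μ ∧
      ∀ᵐ ω ∂μ, (μ[(momentSet μ x s w α K t).indicator fun ω => ‖w t ω‖ ^ α | history x s t]) ω
        ≤ K := fun t => condExp_rpow_indicator_le (hle t) (hw.measurable t) K
  have hint : ∀ t, Integrable (truncNoise μ x s w α K r t) μ := fun t =>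
    (hcoord t).indicator (hle t _ (hBm t))
  have hbd : ∀ t ω, |truncNoise μ x s w α K r t ω| ^ q
      ≤ 1 + (momentSet μ x s w α K t).indicator (fun ω => ‖w t ω‖ ^ α) ω := by
    intro t ω
    by_cases h : ω ∈ momentSet μ x s w α K t
    · simp only [truncNoise, Set.indicator_of_mem h]
      exact rpow_le_one_add_rpow (abs_nonneg _) (abs_apply_le_norm _ r) hq.le hqα
    · simp only [truncNoise, Set.indicator_of_notMem h, abs_zero, Real.zero_rpow hq.ne']
      norm_num
  have hbi : ∀ t, Integrable (fun ω => 1 + (momentSet μ x s w α K t).indicator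
      (fun ω => ‖w t ω‖ ^ α) ω) μ := fun t => (integrable_const 1).add (hmom t).1
  have hpi : ∀ t, Integrable (fun ω => |truncNoise μ x s w α K r t ω| ^ q) μ := by
    intro t
    refine (hbi t).mono' ((hint t).1.aemeasurable.abs.pow_const q).aestronglyMeasurable
      (ae_of_all _ fun ω => ?_)
    rw [Real.norm_eq_abs, abs_of_nonneg (by positivity)]
    exact hbd t ω
  refine ⟨fun t => ?_, hint, fun t => ?_, hpi, fun t => ?_⟩
  · exact (stronglyMeasurable_truncNoise_past K r t).mono (past_le_history (t + 1))
  · have h1 : μ[truncNoise μ x s w α K r t | history x s t] =ᵐ[μ]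
        (momentSet μ x s w α K t).indicator (μ[fun ω => w t ω r | history x s t]) :=
      condExp_indicator (hcoord t) (hBm t)
    have h2 := (EuclideanSpace.proj (𝕜 := ℝ) r).comp_condExp_comm (m := history x s t)
      (hw.integrable t)
    have h3 : (EuclideanSpace.proj (𝕜 := ℝ) r : EuclideanSpace ℝ (Fin n) → ℝ) ∘ w t
        = fun ω => w t ω r := rfl
    rw [h3] at h2
    rw [hFt]
    filter_upwards [h1, h2, hw.condExp_eq_zero t] with ω h1 h2 h4
    rw [h1]
    by_cases h : ω ∈ momentSet μ x s w α K t
    · rw [Set.indicator_of_mem h, ← h2]; simp [h4]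
    · simp [Set.indicator_of_notMem h]
  · have h1 := condExp_mono (m := F t) (hpi t) (hbi t) (ae_of_all _ (hbd t))
    have h2 : μ[fun ω => 1 + (momentSet μ x s w α K t).indicator (fun ω => ‖w t ω‖ ^ α) ω | F t]
        =ᵐ[μ] μ[fun _ => (1 : ℝ) | F t]
          + μ[(momentSet μ x s w α K t).indicator (fun ω => ‖w t ω‖ ^ α) | F t] :=
      condExp_add (integrable_const 1) (hmom t).1 _
    filter_upwards [h1, h2, (hmom t).2] with ω h1 h2 h3
    rw [h2, Pi.add_apply, condExp_const (F.le t)] at h1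
    rw [hFt] at h1 ⊢
    linarith

theorem isNoise_truncNoise_lookahead [IsProbabilityMeasure μ]
    (hs : IIDSwitching μ (state A x0 s w) s p)
    (hw : NoiseAssumption μ (state A x0 s w) s w α C) {q : ℝ} (hq : 0 < q) (hqα : q ≤ α) (K : ℕ)
    (r : Fin n) :
    IsNoise μ (lookaheadFiltration (measurable_state (A := A) (x0 := x0) hs.measurable hw.measurable)
        hs.measurable)
      (truncNoise μ (state A x0 s w) s w α K r) q (1 + K) :=
  (isNoise_truncNoise hs hw hq hqα K r).of_indep_sup
    (J := fun t => past (state A x0 s w) s (t + 1))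
    (m' := fun t => MeasurableSpace.comap (s (t + 1)) inferInstance) (fun _ => rfl)
    history_le_past_succ
    (fun _ => past_le (fun j _ => measurable_state hs.measurable hw.measurable j)
      fun j _ => hs.measurable j)
    (fun _ => (hs.measurable _).comap_le) (fun t => hs.indep_past (t + 1))
    (stronglyMeasurable_truncNoise_past K r)

theorem truncNoise_eq {x : ℕ → Ω → EuclideanSpace ℝ (Fin n)} {K : ℕ} {ω : Ω}
    (h : ∀ t, ω ∈ momentSet μ x s w α K t) (r : Fin n) (t : ℕ) :
    truncNoise μ x s w α K r t ω = w t ω r :=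
  Set.indicator_of_mem (h t) _

theorem abs_modeInd_sub_le (hs : IIDSwitching μ (state A x0 s w) s p) (i : Fin k) (t : ℕ) (ω : Ω) :
    |modeInd s i t ω - p i| ≤ 1 := by
  have h1 : p i ≤ 1 := by
    rw [← hs.pmf_sum]
    exact Finset.single_le_sum (fun j _ => (hs.pmf_pos j).le) (Finset.mem_univ i)
  have h2 := hs.pmf_pos i
  rw [modeInd_eq, abs_le]
  split_ifs <;> constructor <;> linarith

theorem integral_modeInd (hs : IIDSwitching μ (state A x0 s w) s p) (i : Fin k) (t : ℕ) :
    ∫ ω, modeInd s i t ω ∂μ = p i := by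
  rw [modeInd, integral_indicator_const _ (hs.measurable t (measurableSet_singleton i))]
  have : μ (s t ⁻¹' {i}) = ENNReal.ofReal (p i) := hs.law t i
  simp [Measure.real, this, (hs.pmf_pos i).le]

end TruncatedNoise

/-! ### Almost sure laws for the noise and the modes. -/

section NoiseLaws

variable {Ω : Type*} [MeasurableSpace Ω] {μ : Measure Ω} [IsProbabilityMeasure μ] {n k : ℕ}
  {A : Fin k → Matrix (Fin n) (Fin n) ℝ} {x0 : EuclideanSpace ℝ (Fin n)} {s : ℕ → Ω → Fin k}
  {w : ℕ → Ω → EuclideanSpace ℝ (Fin n)} {p : Fin k → ℝ} {α : ℝ}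
  {C : Matrix (Fin n) (Fin n) ℝ}

theorem ae_two_mul_dotProduct_sum_noise_le (hs : IIDSwitching μ (state A x0 s w) s p)
    (hw : NoiseAssumption μ (state A x0 s w) s w α C) (hα : 2 < α) {z : ℕ → Ω → Fin n → ℝ}
    (hz : ∀ t i, Measurable[history (state A x0 s w) s t ⊔
      MeasurableSpace.comap (s (t + 1)) inferInstance] fun ω => z t ω i) :
    ∀ᵐ ω ∂μ, ∀ r, ∃ c, 0 ≤ c ∧ ∀ (N : ℕ) (θ : Fin n → ℝ),
      2 * (θ ⬝ᵥ ∑ t ∈ Finset.range N, w t ω r • z t ω)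
        ≤ θ ⬝ᵥ θ + ∑ t ∈ Finset.range N, (θ ⬝ᵥ z t ω) ^ 2
          + c * (1 + Real.log (1 + ∑ t ∈ Finset.range N, z t ω ⬝ᵥ z t ω)) := by
  refine ae_all_iff.2 fun r => ?_
  -- The order is capped at 4 so that squares have order at most 2, as the truncation estimate
  -- demands.
  have hq : 2 < min α 4 := lt_min hα (by norm_num)
  have key : ∀ K : ℕ, _ := fun K =>
    (isNoise_truncNoise_lookahead hs hw (by linarith) (min_le_left α 4) K
      r).two_mul_dotProduct_weightedSum_le hq (min_le_right α 4) hz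
  filter_upwards [ae_all_iff.2 key, ae_exists_forall_mem_momentSet hw] with ω h ⟨K, hK⟩
  simpa only [truncNoise_eq hK] using h K

theorem ae_sum_noise_sq_le (hs : IIDSwitching μ (state A x0 s w) s p)
    (hw : NoiseAssumption μ (state A x0 s w) s w α C) (hα : 2 < α) :
    ∀ᵐ ω ∂μ, ∃ B, ∀ N : ℕ, ∑ t ∈ Finset.range N, ‖w t ω‖ ^ 2 ≤ B * (1 + N) := by
  have hq : 2 < min α 4 := lt_min hα (by norm_num)
  have key : ∀ (K : ℕ) (r : Fin n), _ := fun K r =>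
    (isNoise_truncNoise hs hw (by linarith) (min_le_left α 4) K r).weighted_sum_sq_le hq
      (min_le_right α 4) (u := fun _ _ => 1) (fun _ => stronglyMeasurable_const)
      (fun _ _ => zero_le_one) (fun _ _ => le_rfl)
  filter_upwards [ae_all_iff.2 fun K => ae_all_iff.2 (key K), ae_exists_forall_mem_momentSet hw]
    with ω h ⟨K, hK⟩
  choose B hB using h K
  refine ⟨∑ r, B r, fun N => ?_⟩
  simp only [truncNoise_eq hK, one_mul, Finset.sum_const, Finset.card_range, nsmul_eq_mul,
    mul_one] at hB
  calc ∑ t ∈ Finset.range N, ‖w t ω‖ ^ 2 = ∑ r, ∑ t ∈ Finset.range N, (w t ω r) ^ 2 := by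
        rw [Finset.sum_comm]
        simp [EuclideanSpace.real_norm_sq_eq]
    _ ≤ ∑ r, B r * (1 + N) := Finset.sum_le_sum fun r _ => hB r N
    _ = _ := by rw [Finset.sum_mul]

theorem condExp_modeInd_sub (hs : IIDSwitching μ (state A x0 s w) s p)
    (hw : NoiseAssumption μ (state A x0 s w) s w α C) (i : Fin k) (t : ℕ) :
    μ[fun ω => modeInd s i t ω - p i | past (state A x0 s w) s t] =ᵐ[μ] 0 := by
  have hm : StronglyMeasurable[MeasurableSpace.comap (s t) inferInstance]
      (fun ω => modeInd s i t ω - p i) :=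
    (stronglyMeasurable_const.indicator
      (comap_measurable (s t) (measurableSet_singleton i))).sub stronglyMeasurable_const
  refine (condExp_indep_eq (hs.measurable t).comap_le
    (past_le (fun j _ => measurable_state hs.measurable hw.measurable j) fun j _ =>
      hs.measurable j) hm (hs.indep_past t)).trans (ae_of_all _ fun ω => ?_)
  have hi : Integrable (modeInd s i t) μ :=
    (integrable_const 1).indicator (hs.measurable t (measurableSet_singleton i))
  simp [integral_sub hi (integrable_const _), integral_modeInd hs]

theorem abs_mul_rpow_half_le (a b : ℝ) {q : ℝ} (hq : 0 < q) :
    |a * b| ^ (q / 2) ≤ |a| ^ q + |b| ^ q := by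
  have key : ∀ a b : ℝ, |a| ≤ |b| → |a * b| ^ (q / 2) ≤ |b| ^ q := fun a b h => by
    calc |a * b| ^ (q / 2) ≤ (|b| ^ (2 : ℝ)) ^ (q / 2) := by
          refine Real.rpow_le_rpow (abs_nonneg _) ?_ (by positivity)
          rw [abs_mul, Real.rpow_two, sq]
          exact mul_le_mul_of_nonneg_right h (abs_nonneg _)
      _ = |b| ^ q := by rw [← Real.rpow_mul (abs_nonneg _)]; congr 1; ring
  have h1 : 0 ≤ |a| ^ q := by positivity
  have h2 : 0 ≤ |b| ^ q := by positivity
  rcases le_total |a| |b| with h | h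
  · linarith [key a b h]
  · rw [mul_comm]; linarith [key b a h]

/-- Given the past before s_{t+1}, the noise product is known and the mode indicator is centred; the
tower property descends to the smaller history at time t. A product of two coordinates keeps only
moments of order q/2. -/
theorem isNoise_modeInd_mul (hs : IIDSwitching μ (state A x0 s w) s p)
    (hw : NoiseAssumption μ (state A x0 s w) s w α C) {q : ℝ} (hq : 2 < q) (hqα : q ≤ α) (K : ℕ)
    (i : Fin k) (a b : Fin n) :
    IsNoise μ (historyFiltration (measurable_state (A := A) (x0 := x0) hs.measurable hw.measurable)
        hs.measurable)
      (fun t ω => (modeInd s i (t + 1) ω - p i) * (truncNoise μ (state A x0 s w) s w α K a t ω *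
        truncNoise μ (state A x0 s w) s w α K b t ω)) (q / 2) (2 * (1 + K)) := by
  have hmx := measurable_state (A := A) (x0 := x0) hs.measurable hw.measurable
  set x := state A x0 s w with hx
  set F := historyFiltration (x := x) hmx hs.measurable with hF
  set ε := truncNoise μ x s w α K with hε
  have hna := isNoise_truncNoise hs hw (by linarith) hqα K a
  have hnb := isNoise_truncNoise hs hw (by linarith) hqα K b
  have hpast : ∀ t, past x s (t + 1) ≤ _ := fun t =>
    past_le (fun j _ => hmx j) fun j _ => hs.measurable j
  have hem : ∀ t, StronglyMeasurable[F (t + 1)] fun ω => modeInd s i (t + 1) ω - p i := fun t =>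
    (stronglyMeasurable_const.indicator
      (measurable_mode_history le_rfl (measurableSet_singleton i))).sub stronglyMeasurable_const
  have hem' : ∀ t, AEStronglyMeasurable (fun ω => modeInd s i (t + 1) ω - p i) μ := fun t =>
    ((hem t).mono (F.le _)).aestronglyMeasurable
  have habm : ∀ t, StronglyMeasurable[past x s (t + 1)] (ε a t * ε b t) := fun t =>
    (stronglyMeasurable_truncNoise_past K a t).mul (stronglyMeasurable_truncNoise_past K b t)
  have hab : ∀ t, Integrable (ε a t * ε b t) μ := fun t => by
    have h := ((hna.condExp_sq_le hq.le t).1.add (hnb.condExp_sq_le hq.le t).1)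
    refine h.mono' ((habm t).mono (hpast t)).aestronglyMeasurable (ae_of_all _ fun ω => ?_)
    simp only [Pi.mul_apply, Pi.add_apply, Real.norm_eq_abs, abs_mul]
    change |ε a t ω| * |ε b t ω| ≤ ε a t ω ^ 2 + ε b t ω ^ 2
    nlinarith [sq_nonneg (|ε a t ω| - |ε b t ω|), sq_abs (ε a t ω), sq_abs (ε b t ω),
      sq_nonneg (ε a t ω), sq_nonneg (ε b t ω)]
  have hint : ∀ t, Integrable ((fun ω => modeInd s i (t + 1) ω - p i) * (ε a t * ε b t)) μ :=
    fun t => (hab t).bdd_mul (c := 1) (hem' t) (ae_of_all _ (abs_modeInd_sub_le hs i (t + 1)))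
  have hbd : ∀ t ω, |(modeInd s i (t + 1) ω - p i) * (ε a t ω * ε b t ω)| ^ (q / 2)
      ≤ |ε a t ω| ^ q + |ε b t ω| ^ q := fun t ω => by
    refine le_trans (Real.rpow_le_rpow (abs_nonneg _) ?_ (by linarith))
      (abs_mul_rpow_half_le (ε a t ω) (ε b t ω) (by linarith))
    rw [abs_mul (modeInd s i (t + 1) ω - p i)]
    exact mul_le_of_le_one_left (abs_nonneg _) (abs_modeInd_sub_le hs i _ ω)
  have hbi : ∀ t, Integrable (fun ω => |ε a t ω| ^ q + |ε b t ω| ^ q) μ := fun t =>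
    (hna.integrable_rpow t).add (hnb.integrable_rpow t)
  have hpi : ∀ t, Integrable (fun ω => |(modeInd s i (t + 1) ω - p i) *
      (ε a t ω * ε b t ω)| ^ (q / 2)) μ := fun t => by
    refine (hbi t).mono' ((hint t).1.aemeasurable.abs.pow_const _).aestronglyMeasurable
      (ae_of_all _ fun ω => ?_)
    rw [Real.norm_eq_abs, abs_of_nonneg (by positivity)]
    exact hbd t ω
  refine ⟨fun t => ?_, hint, fun t => ?_, hpi, fun t => ?_⟩
  · exact (hem t).mul ((habm t).mono (past_le_history (t + 1)))
  · have h1 : μ[(fun ω => modeInd s i (t + 1) ω - p i) * (ε a t * ε b t) | past x s (t + 1)]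
        =ᵐ[μ] 0 := by
      have hei : Integrable (fun ω => modeInd s i (t + 1) ω - p i) μ :=
        Integrable.of_bound (hem' t) 1 (ae_of_all _ (abs_modeInd_sub_le hs i (t + 1)))
      refine (condExp_mul_of_stronglyMeasurable_right (habm t) (hint t) hei).trans ?_
      filter_upwards [condExp_modeInd_sub hs hw i (t + 1)] with ω h
      rw [Pi.mul_apply, h]
      simp
    have h2 := condExp_condExp_of_le (μ := μ) (history_le_past_succ (x := x) (s := s) t) (hpast t)
      (f := (fun ω => modeInd s i (t + 1) ω - p i) * (ε a t * ε b t))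
    refine h2.symm.trans ((condExp_congr_ae h1).trans ?_)
    simp
  · have h1 := condExp_mono (m := F t) (hpi t) (hbi t) (ae_of_all _ (hbd t))
    have h2 : μ[fun ω => |ε a t ω| ^ q + |ε b t ω| ^ q | F t] =ᵐ[μ]
        μ[fun ω => |ε a t ω| ^ q | F t] + μ[fun ω => |ε b t ω| ^ q | F t] :=
      condExp_add (hna.integrable_rpow t) (hnb.integrable_rpow t) _
    filter_upwards [h1, h2, hna.condMoment_le t, hnb.condMoment_le t] with ω h1 h2 h3 h4
    rw [h2, Pi.add_apply] at h1
    linarith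

theorem summable_bound_rpow {β : ℝ} (hβ : 1 < β) :
    ∃ c, ∀ N, ∑ k ∈ Finset.range N, (1 / ((k : ℝ) + 1)) ^ β ≤ c := by
  have h : Summable fun k : ℕ => (1 / ((k : ℝ) + 1)) ^ β := by
    have h1 := (summable_nat_add_iff 1).2 (Real.summable_one_div_nat_rpow.2 hβ)
    refine h1.congr fun k => ?_
    push_cast
    rw [Real.div_rpow zero_le_one (by positivity), Real.one_rpow]
  exact ⟨_, fun N => h.sum_le_tsum _ fun k _ => by positivity⟩

theorem ae_abs_sum_modeInd_mul_le (hs : IIDSwitching μ (state A x0 s w) s p)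
    (hw : NoiseAssumption μ (state A x0 s w) s w α C) (hα : 2 < α) :
    ∃ β : ℝ, 0 < β ∧ β < 1 ∧ ∀ᵐ ω ∂μ, ∀ i a b, ∃ B, ∀ N : ℕ,
      |∑ t ∈ Finset.range (N + 1), (modeInd s i (t + 1) ω - p i) * (w t ω a * w t ω b)|
        ≤ B * ((N : ℝ) + 1) ^ β := by
  set q := min α 4 with hq
  have hq2 : 2 < q := lt_min hα (by norm_num)
  have hq4 : q ≤ 4 := min_le_right α 4
  -- The midpoint of 2/q and 1: above 2/q the series of k^(-βq/2) converges, below 1 the deviation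
  -- is o(N).
  set β : ℝ := (1 + 2 / q) / 2 with hβ
  have h2q : 2 / q < 1 := by rw [div_lt_one (by linarith)]; exact hq2
  have hβ0 : 0 < β := by positivity
  have hβ1 : β < 1 := by rw [hβ]; linarith
  have hβq : 1 < β * (q / 2) := by
    have : β * (q / 2) = (q / 2 + 1) / 2 := by rw [hβ]; field_simp
    rw [this]; linarith
  obtain ⟨c, hc⟩ := summable_bound_rpow hβq
  refine ⟨β, hβ0, hβ1, ae_all_iff.2 fun i => ae_all_iff.2 fun a => ae_all_iff.2 fun b => ?_⟩
  have key : ∀ K : ℕ, _ := fun K =>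
    (isNoise_modeInd_mul hs hw hq2 (min_le_left α 4) K i a b).weighted_sum_bounded
      (by linarith) (by linarith) (c := fun _ _ => 1) (U := fun k _ => ((k : ℝ) + 1) ^ β)
      (fun _ => stronglyMeasurable_const) (fun _ => stronglyMeasurable_const)
      (fun ω k l hkl => Real.rpow_le_rpow (by positivity) (by simpa using hkl) hβ0.le)
      (fun k ω => by positivity)
      (fun k ω => by
        rw [abs_one]; exact Real.one_le_rpow (by linarith [(Nat.cast_nonneg k : (0 : ℝ) ≤ k)]) hβ0.le)
      (C := c) (fun N ω => by
        refine le_trans (le_of_eq (Finset.sum_congr rfl fun k _ => ?_)) (hc N)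
        rw [abs_one, Real.rpow_mul (by positivity), Real.div_rpow zero_le_one (by positivity) β,
          Real.one_rpow])
  filter_upwards [ae_all_iff.2 key, ae_exists_forall_mem_momentSet hw] with ω h ⟨K, hK⟩
  simpa only [truncNoise_eq hK, one_mul] using h K

end NoiseLaws

/-! ### Extreme eigenvalues as bounds for quadratic forms. -/

section Spectral

variable {n : ℕ} {M : Matrix (Fin n) (Fin n) ℝ}

theorem Matrix.IsHermitian.dotProduct_self_eq_sum (hM : M.IsHermitian) (x : Fin n → ℝ) :
    x ⬝ᵥ x = ∑ i, (x ⬝ᵥ (hM.eigenvectorBasis i).ofLp) ^ 2 := by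
  have h := hM.eigenvectorBasis.sum_inner_mul_inner (WithLp.toLp 2 x) (WithLp.toLp 2 x)
  simp only [EuclideanSpace.inner_eq_star_dotProduct, star_trivial] at h
  rw [← h]
  refine Finset.sum_congr rfl fun i _ => ?_
  rw [dotProduct_comm x, sq]

theorem Matrix.IsHermitian.dotProduct_mulVec_eq_sum (hM : M.IsHermitian) (x : Fin n → ℝ) :
    x ⬝ᵥ (M *ᵥ x) = ∑ i, hM.eigenvalues i * (x ⬝ᵥ (hM.eigenvectorBasis i).ofLp) ^ 2 := by
  have h := hM.eigenvectorBasis.sum_inner_mul_inner (WithLp.toLp 2 x) (WithLp.toLp 2 (M *ᵥ x))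
  simp only [EuclideanSpace.inner_eq_star_dotProduct, star_trivial] at h
  rw [dotProduct_comm, ← h]
  refine Finset.sum_congr rfl fun i _ => ?_
  have hs : Mᵀ = M := by simpa [Matrix.IsHermitian] using hM
  rw [dotProduct_comm (M *ᵥ x), dotProduct_mulVec_comm_of_isSymm hs,
    hM.mulVec_eigenvectorBasis i, dotProduct_smul, dotProduct_comm _ x, smul_eq_mul]
  ring

theorem abs_image_spectrum_finite (hM : M.IsHermitian) :
    ((fun r : ℝ => |r|) '' spectrum ℝ M).Finite := by
  rw [hM.spectrum_real_eq_range_eigenvalues]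
  exact (Set.finite_range _).image _

theorem abs_eigenvalues_mem (hM : M.IsHermitian) (i : Fin n) :
    |hM.eigenvalues i| ∈ (fun r : ℝ => |r|) '' spectrum ℝ M :=
  ⟨_, hM.eigenvalues_mem_spectrum_real i, rfl⟩

theorem abs_eigenvalues_le_lambdaMax (hM : M.IsHermitian) (i : Fin n) :
    |hM.eigenvalues i| ≤ lambdaMax M :=
  le_csSup (abs_image_spectrum_finite hM).bddAbove (abs_eigenvalues_mem hM i)

theorem lambdaMin_le_abs_eigenvalues (hM : M.IsHermitian) (i : Fin n) :
    lambdaMin M ≤ |hM.eigenvalues i| :=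
  csInf_le (abs_image_spectrum_finite hM).bddBelow (abs_eigenvalues_mem hM i)

theorem lambdaMax_nonneg (M : Matrix (Fin n) (Fin n) ℝ) : 0 ≤ lambdaMax M :=
  Real.sSup_nonneg (by rintro _ ⟨r, _, rfl⟩; exact abs_nonneg r)

theorem dotProduct_mulVec_le_lambdaMax (hM : M.IsHermitian) (x : Fin n → ℝ) :
    x ⬝ᵥ (M *ᵥ x) ≤ lambdaMax M * (x ⬝ᵥ x) := by
  rw [hM.dotProduct_mulVec_eq_sum, hM.dotProduct_self_eq_sum, Finset.mul_sum]
  exact Finset.sum_le_sum fun i _ => mul_le_mul_of_nonneg_right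
    ((le_abs_self _).trans (abs_eigenvalues_le_lambdaMax hM i)) (sq_nonneg _)

theorem eigenvalues_eq_dotProduct (hM : M.IsHermitian) (i : Fin n) :
    (hM.eigenvectorBasis i).ofLp ⬝ᵥ (hM.eigenvectorBasis i).ofLp = 1 ∧
    hM.eigenvalues i
      = (hM.eigenvectorBasis i).ofLp ⬝ᵥ (M *ᵥ (hM.eigenvectorBasis i).ofLp) := by
  have h1 : (hM.eigenvectorBasis i).ofLp ⬝ᵥ (hM.eigenvectorBasis i).ofLp = 1 := by
    have h2 : ‖hM.eigenvectorBasis i‖ ^ 2 = 1 := by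
      rw [hM.eigenvectorBasis.orthonormal.1 i]; norm_num
    rw [EuclideanSpace.real_norm_sq_eq] at h2
    simpa [dotProduct, sq] using h2
  refine ⟨h1, ?_⟩
  rw [hM.mulVec_eigenvectorBasis i, dotProduct_smul, h1, smul_eq_mul, mul_one]

theorem eigenvalues_ge_of_quadratic (hM : M.IsHermitian) {c : ℝ}
    (hc : ∀ x : Fin n → ℝ, x ⬝ᵥ x = 1 → c ≤ x ⬝ᵥ (M *ᵥ x)) (i : Fin n) :
    c ≤ hM.eigenvalues i := by
  obtain ⟨h1, h2⟩ := eigenvalues_eq_dotProduct hM i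
  rw [h2]
  exact hc _ h1

/-- Semidefiniteness makes the absolute values in `lambdaMin` harmless. -/
theorem lambdaMin_mul_le_dotProduct_mulVec (hM : M.IsHermitian)
    (h0 : ∀ x : Fin n → ℝ, 0 ≤ x ⬝ᵥ (M *ᵥ x)) (x : Fin n → ℝ) :
    lambdaMin M * (x ⬝ᵥ x) ≤ x ⬝ᵥ (M *ᵥ x) := by
  rw [hM.dotProduct_mulVec_eq_sum, hM.dotProduct_self_eq_sum, Finset.mul_sum]
  refine Finset.sum_le_sum fun i _ => mul_le_mul_of_nonneg_right ?_ (sq_nonneg _)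
  have h := eigenvalues_ge_of_quadratic hM (c := 0) (fun x _ => h0 x) i
  simpa [abs_of_nonneg h] using lambdaMin_le_abs_eigenvalues hM i

/-- In dimension 0 the spectrum is empty and the infimum defaults to 0, hence `hn`. -/
theorem le_lambdaMin_of_quadratic (hM : M.IsHermitian) (hn : 0 < n) {c : ℝ}
    (hc : ∀ x : Fin n → ℝ, x ⬝ᵥ x = 1 → c ≤ x ⬝ᵥ (M *ᵥ x)) : c ≤ lambdaMin M := by
  refine le_csInf ⟨_, abs_eigenvalues_mem hM ⟨0, hn⟩⟩ ?_
  rw [hM.spectrum_real_eq_range_eigenvalues]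
  rintro _ ⟨_, ⟨i, rfl⟩, rfl⟩
  exact (eigenvalues_ge_of_quadratic hM hc i).trans (le_abs_self _)

theorem lambdaMin_le_lambdaMax (hM : M.IsHermitian) (hn : 0 < n) : lambdaMin M ≤ lambdaMax M :=
  (lambdaMin_le_abs_eigenvalues hM ⟨0, hn⟩).trans (abs_eigenvalues_le_lambdaMax hM ⟨0, hn⟩)

theorem trace_le_mul_lambdaMax (hM : M.IsHermitian) : M.trace ≤ n * lambdaMax M := by
  rw [hM.trace_eq_sum_eigenvalues]
  calc ∑ i, ((hM.eigenvalues i : ℝ)) ≤ ∑ _i : Fin n, lambdaMax M :=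
        Finset.sum_le_sum fun i _ => (le_abs_self _).trans (abs_eigenvalues_le_lambdaMax hM i)
    _ = _ := by simp

theorem dotProduct_self_eq_norm_sq (v : EuclideanSpace ℝ (Fin n)) :
    v.ofLp ⬝ᵥ v.ofLp = ‖v‖ ^ 2 := by
  rw [EuclideanSpace.real_norm_sq_eq]
  simp [dotProduct, sq]

theorem norm_toEuclideanLin_le (A : Matrix (Fin n) (Fin n) ℝ) (v : EuclideanSpace ℝ (Fin n)) :
    ‖Matrix.toEuclideanLin A v‖ ≤ sigmaMax A * ‖v‖ := by
  have hH : (Aᵀ * A).IsHermitian := by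
    simp [Matrix.IsHermitian, Matrix.conjTranspose_eq_transpose_of_trivial]
  have h := dotProduct_mulVec_le_lambdaMax hH v.ofLp
  rw [← Matrix.mulVec_mulVec, Matrix.dotProduct_mulVec, Matrix.vecMul_transpose,
    dotProduct_self_eq_norm_sq] at h
  have h2 : A *ᵥ v.ofLp = (Matrix.toEuclideanLin A v).ofLp := rfl
  rw [h2, dotProduct_self_eq_norm_sq] at h
  rw [← abs_of_nonneg (norm_nonneg (Matrix.toEuclideanLin A v)), ← Real.sqrt_sq_eq_abs,
    sigmaMax, ← Real.sqrt_sq (norm_nonneg v), ← Real.sqrt_mul (lambdaMax_nonneg _)]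
  refine Real.sqrt_le_sqrt ?_
  rwa [WithLp.toLp_ofLp] at h

end Spectral

/-! ### Subexponential growth of a scalar recursion. -/

section Growth

/-- Since a singular value may vanish, σ is first raised to a small δ > 0, which the strict
inequality permits. The mean logarithm is then at most 0, and shifting all rates up by its absolute
value makes their mean exactly 0. -/
theorem exists_dominating_rates {k : ℕ} {σ p : Fin k → ℝ} (hσ : ∀ i, 0 ≤ σ i)
    (hp : ∀ i, 0 < p i) (hp1 : ∑ i, p i = 1) (h : ∏ i, σ i ^ p i < 1) :
    ∃ g : Fin k → ℝ, (∀ i, σ i ≤ Real.exp (g i)) ∧ ∑ i, p i * g i = 0 := by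
  have hcont : Tendsto (fun δ : ℝ => ∏ i, (max (σ i) δ) ^ p i) (𝓝[>] 0) (𝓝 (∏ i, σ i ^ p i)) := by
    refine tendsto_finsetProd _ fun i _ => ?_
    have h1 : Tendsto (fun δ : ℝ => max (σ i) δ) (𝓝[>] 0) (𝓝 (σ i)) := by
      have h2 : Tendsto (fun δ : ℝ => max (σ i) δ) (𝓝 0) (𝓝 (max (σ i) 0)) :=
        (continuous_const.max continuous_id).tendsto 0
      rw [max_eq_left (hσ i)] at h2
      exact h2.mono_left nhdsWithin_le_nhds
    exact h1.rpow_const (Or.inr (hp i).le)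
  obtain ⟨δ, hδ1, hδ0⟩ := ((hcont.eventually_lt_const h).and self_mem_nhdsWithin).exists
  have hδ0 : 0 < δ := hδ0
  have hpos : ∀ i, 0 < max (σ i) δ := fun i => lt_max_of_lt_right hδ0
  set m : ℝ := ∑ i, p i * Real.log (max (σ i) δ) with hm
  have hm0 : m ≤ 0 := by
    have h1 : Real.log (∏ i, (max (σ i) δ) ^ p i) = m := by
      rw [Real.log_prod fun i _ => (Real.rpow_pos_of_pos (hpos i) _).ne']
      exact Finset.sum_congr rfl fun i _ => Real.log_rpow (hpos i) _
    rw [← h1]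
    exact Real.log_nonpos (Finset.prod_nonneg fun i _ => (Real.rpow_pos_of_pos (hpos i) _).le) hδ1.le
  refine ⟨fun i => Real.log (max (σ i) δ) - m, fun i => ?_, ?_⟩
  · calc σ i ≤ max (σ i) δ := le_max_left _ _
      _ = Real.exp (Real.log (max (σ i) δ)) := (Real.exp_log (hpos i)).symm
      _ ≤ _ := Real.exp_le_exp.2 (by linarith)
  · simp_rw [mul_sub]
    rw [Finset.sum_sub_distrib, ← Finset.sum_mul, hp1, ← hm]
    ring

theorem exists_abs_le_of_div_tendsto_zero {G : ℕ → ℝ}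
    (h : Tendsto (fun N : ℕ => G N / N) atTop (𝓝 0)) {η : ℝ} (hη : 0 < η) :
    ∃ c, ∀ N, |G N| ≤ η * N + c := by
  obtain ⟨N0, hN0⟩ := eventually_atTop.1 (h.abs.eventually_lt_const (by simpa using hη))
  have hc0 : 0 ≤ ∑ k ∈ Finset.range (N0 + 1), |G k| := Finset.sum_nonneg fun _ _ => abs_nonneg _
  refine ⟨∑ k ∈ Finset.range (N0 + 1), |G k|, fun N => ?_⟩
  rcases le_or_gt N N0 with hN | hN
  · have := Finset.single_le_sum (f := fun k => |G k|) (fun k _ => abs_nonneg _)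
      (Finset.mem_range.2 (Nat.lt_succ_of_le hN))
    have h2 : 0 ≤ η * N := by positivity
    linarith
  · have h1 := hN0 N hN.le
    have hNpos : (0 : ℝ) < N := by exact_mod_cast (Nat.zero_le N0).trans_lt hN
    rw [abs_div, abs_of_pos hNpos, div_lt_iff₀ hNpos] at h1
    linarith

theorem natCast_add_one_le_exp {η : ℝ} (hη : 0 < η) (N : ℕ) :
    (N : ℝ) + 1 ≤ (1 + 1 / η) * Real.exp (η * N) := by
  have h1 := Real.add_one_le_exp (η * N)
  have h2 : (1 : ℝ) ≤ Real.exp (η * N) := Real.one_le_exp (by positivity)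
  have h3 : (N : ℝ) ≤ 1 / η * Real.exp (η * N) := by
    rw [div_mul_eq_mul_div, one_mul, le_div_iff₀ hη]; linarith
  linarith

/-- Variation of constants: with G the partial sums of g, y_N is at most e^{G_N}(y_0 + ∑ b_j
e^{-G_{j+1}}), and |G_N| is o(N). The exponents cost η/4 for G_N, η/4 for −G_{j+1} and η/4 for the
linear growth of ∑ b, in total less than η. -/
theorem exists_exp_bound_of_recursion {y g b : ℕ → ℝ} (hy0 : ∀ t, 0 ≤ y t) (hb : ∀ t, 0 ≤ b t)
    (hrec : ∀ t, y (t + 1) ≤ Real.exp (g t) * y t + b t) {B : ℝ}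
    (hB : ∀ N : ℕ, ∑ t ∈ Finset.range N, b t ^ 2 ≤ B * (1 + N))
    (hg : Tendsto (fun N : ℕ => (∑ t ∈ Finset.range N, g t) / N) atTop (𝓝 0)) {η : ℝ}
    (hη : 0 < η) : ∃ D, 0 ≤ D ∧ ∀ N : ℕ, y N ≤ D * Real.exp (η * N) := by
  set G : ℕ → ℝ := fun N => ∑ t ∈ Finset.range N, g t with hG
  obtain ⟨c, hc⟩ := exists_abs_le_of_div_tendsto_zero hg (show 0 < η / 4 by positivity)
  have hB0 : 0 ≤ B := by simpa using hB 0
  have h1 : ∀ N, y N ≤ Real.exp (G N) *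
      (y 0 + ∑ j ∈ Finset.range N, b j * Real.exp (-G (j + 1))) := by
    intro N
    induction N with
    | zero => simp [hG]
    | succ N ih =>
      have hGs : G (N + 1) = g N + G N := by simp [hG, Finset.sum_range_succ, add_comm]
      have hcancel : Real.exp (G (N + 1)) * Real.exp (-G (N + 1)) = 1 := by
        rw [← Real.exp_add]; simp
      calc y (N + 1) ≤ Real.exp (g N) * y N + b N := hrec N
        _ ≤ Real.exp (g N) * (Real.exp (G N) *
            (y 0 + ∑ j ∈ Finset.range N, b j * Real.exp (-G (j + 1)))) + b N := by gcongr
        _ = Real.exp (G (N + 1)) * (y 0 + ∑ j ∈ Finset.range N, b j * Real.exp (-G (j + 1)))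
            + b N * (Real.exp (G (N + 1)) * Real.exp (-G (N + 1))) := by
          rw [hcancel, hGs, Real.exp_add]; ring
        _ = _ := by rw [Finset.sum_range_succ]; ring
  set E : ℝ := 1 + 1 / (η / 4) with hE
  have hE0 : 0 < E := by positivity
  refine ⟨Real.exp c * (y 0 + Real.exp (c + η / 4) * ((B + 1) * E)), ?_, fun N => ?_⟩
  · have := hy0 0; positivity
  have hbsum : ∑ j ∈ Finset.range N, b j ≤ (B + 1) * E * Real.exp (η / 4 * N) := by
    calc ∑ j ∈ Finset.range N, b j ≤ ∑ j ∈ Finset.range N, (1 + b j ^ 2) :=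
          Finset.sum_le_sum fun j _ => by nlinarith [sq_nonneg (b j - 1)]
      _ = N + ∑ j ∈ Finset.range N, b j ^ 2 := by simp [Finset.sum_add_distrib]
      _ ≤ (B + 1) * ((N : ℝ) + 1) := by linarith [hB N]
      _ ≤ (B + 1) * (E * Real.exp (η / 4 * N)) := by
          gcongr; exact natCast_add_one_le_exp (by positivity) N
      _ = _ := by ring
  have hsum : ∑ j ∈ Finset.range N, b j * Real.exp (-G (j + 1))
      ≤ Real.exp (c + η / 4) * ((B + 1) * E) * Real.exp (η / 2 * N) := by
    calc ∑ j ∈ Finset.range N, b j * Real.exp (-G (j + 1))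
        ≤ ∑ j ∈ Finset.range N, b j * Real.exp (η / 4 * N + (c + η / 4)) := by
          refine Finset.sum_le_sum fun j hj => mul_le_mul_of_nonneg_left ?_ (hb j)
          refine Real.exp_le_exp.2 ?_
          have h2 := (neg_le_abs _).trans (hc (j + 1))
          have h3 : (j : ℝ) ≤ N := by exact_mod_cast (Finset.mem_range.1 hj).le
          push_cast at h2
          nlinarith
      _ = (∑ j ∈ Finset.range N, b j) * Real.exp (η / 4 * N + (c + η / 4)) := by
          rw [Finset.sum_mul]
      _ ≤ ((B + 1) * E * Real.exp (η / 4 * N)) * Real.exp (η / 4 * N + (c + η / 4)) := by gcongr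
      _ = _ := by
          rw [show η / 2 * (N : ℝ) = η / 4 * N + η / 4 * N by ring,
            Real.exp_add (η / 4 * N) (η / 4 * N), Real.exp_add (η / 4 * N) (c + η / 4)]
          ring
  have hexp1 : Real.exp (G N) ≤ Real.exp c * Real.exp (η / 4 * N) := by
    rw [← Real.exp_add]
    exact Real.exp_le_exp.2 (by linarith [(le_abs_self _).trans (hc N)])
  have h0 := hy0 0
  calc y N ≤ _ := h1 N
    _ ≤ (Real.exp c * Real.exp (η / 4 * N)) *
        (y 0 * Real.exp (η / 2 * N)
          + Real.exp (c + η / 4) * ((B + 1) * E) * Real.exp (η / 2 * N)) := by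
        gcongr
        · refine add_nonneg h0 (Finset.sum_nonneg fun j _ => ?_)
          have := hb j; positivity
        · exact le_mul_of_one_le_right h0 (Real.one_le_exp (by positivity))
    _ = Real.exp c * (y 0 + Real.exp (c + η / 4) * ((B + 1) * E)) *
        (Real.exp (η / 4 * N) * Real.exp (η / 2 * N)) := by ring
    _ ≤ _ := by
        rw [← Real.exp_add]
        gcongr
        have : 0 ≤ η * N := by positivity
        linarith

theorem exists_log_sum_sq_le {y : ℕ → ℝ} (hy0 : ∀ t, 0 ≤ y t)
    (h : ∀ η : ℝ, 0 < η → ∃ D, 0 ≤ D ∧ ∀ N : ℕ, y N ≤ D * Real.exp (η * N)) {η : ℝ}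
    (hη : 0 < η) :
    ∃ c, ∀ N : ℕ, Real.log (1 + ∑ t ∈ Finset.range N, y t ^ 2) ≤ η * N + c := by
  obtain ⟨D, hD0, hD⟩ := h (η / 4) (by positivity)
  set E : ℝ := 1 + 1 / (η / 2) with hE
  have hE0 : 0 < E := by positivity
  refine ⟨Real.log ((1 + D ^ 2) * E), fun N => ?_⟩
  have hs0 : 0 ≤ ∑ t ∈ Finset.range N, y t ^ 2 := Finset.sum_nonneg fun _ _ => sq_nonneg _
  have h1 : ∑ t ∈ Finset.range N, y t ^ 2 ≤ N * (D ^ 2 * Real.exp (η / 2 * N)) := by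
    calc ∑ t ∈ Finset.range N, y t ^ 2
        ≤ ∑ _t ∈ Finset.range N, D ^ 2 * Real.exp (η / 2 * N) := by
          refine Finset.sum_le_sum fun t ht => ?_
          have h2 : (t : ℝ) ≤ N := by exact_mod_cast (Finset.mem_range.1 ht).le
          have h3 : y t ≤ D * Real.exp (η / 4 * N) := (hD t).trans (by gcongr)
          calc y t ^ 2 ≤ (D * Real.exp (η / 4 * N)) ^ 2 := by gcongr; exact hy0 t
            _ = _ := by rw [mul_pow, ← Real.exp_nat_mul]; congr 2; push_cast; ring
      _ = _ := by simp
  have h2 : 1 + ∑ t ∈ Finset.range N, y t ^ 2 ≤ (1 + D ^ 2) * E * Real.exp (η * N) := by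
    have h3 : (1 : ℝ) ≤ Real.exp (η / 2 * N) := Real.one_le_exp (by positivity)
    have h4 := natCast_add_one_le_exp (show 0 < η / 2 by positivity) N
    have h5 : Real.exp (η * N) = Real.exp (η / 2 * N) * Real.exp (η / 2 * N) := by
      rw [← Real.exp_add]; congr 1; ring
    calc 1 + ∑ t ∈ Finset.range N, y t ^ 2
        ≤ Real.exp (η / 2 * N) + N * (D ^ 2 * Real.exp (η / 2 * N)) := add_le_add h3 h1
      _ ≤ (1 + D ^ 2) * ((N : ℝ) + 1) * Real.exp (η / 2 * N) := by
          have : 0 ≤ (N + D ^ 2) * Real.exp (η / 2 * N) := by positivity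
          nlinarith
      _ ≤ (1 + D ^ 2) * (E * Real.exp (η / 2 * N)) * Real.exp (η / 2 * N) := by gcongr
      _ = _ := by rw [h5]; ring
  calc Real.log (1 + ∑ t ∈ Finset.range N, y t ^ 2)
      ≤ Real.log ((1 + D ^ 2) * E * Real.exp (η * N)) := Real.log_le_log (by positivity) h2
    _ = _ := by
        rw [Real.log_mul (by positivity) (Real.exp_pos _).ne', Real.log_exp]; ring

end Growth

/-! ### Growth of the switched state. -/

section SwitchedGrowth

variable {Ω : Type*} [MeasurableSpace Ω] {μ : Measure Ω} [IsProbabilityMeasure μ] {n k : ℕ}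
  {A : Fin k → Matrix (Fin n) (Fin n) ℝ} {x0 : EuclideanSpace ℝ (Fin n)} {s : ℕ → Ω → Fin k}
  {w : ℕ → Ω → EuclideanSpace ℝ (Fin n)} {p : Fin k → ℝ} {α : ℝ}
  {C : Matrix (Fin n) (Fin n) ℝ}

theorem ae_tendsto_average_modes (hs : IIDSwitching μ (state A x0 s w) s p) (g : Fin k → ℝ) :
    ∀ᵐ ω ∂μ, Tendsto (fun N : ℕ => (∑ t ∈ Finset.range N, g (s t ω)) / N) atTop
      (𝓝 (∑ i, p i * g i)) := by
  have hgm : Measurable g := measurable_of_countable g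
  have hi : ∀ i, Integrable (modeInd s i 0) μ := fun i =>
    (integrable_const 1).indicator (hs.measurable 0 (measurableSet_singleton i))
  have hsum : (fun ω => g (s 0 ω)) = fun ω => ∑ i, modeInd s i 0 ω * g i := by
    ext ω; simp [modeInd_eq]
  have hint : Integrable (fun ω => g (s 0 ω)) μ := by
    rw [hsum]; exact integrable_finsetSum _ fun i _ => (hi i).mul_const _
  have hmean : ∫ ω, g (s 0 ω) ∂μ = ∑ i, p i * g i := by
    rw [hsum, integral_finsetSum _ fun i _ => (hi i).mul_const _]
    refine Finset.sum_congr rfl fun i _ => ?_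
    rw [integral_mul_const, integral_modeInd hs]
  rw [← hmean]
  refine strong_law_ae_real (fun t ω => g (s t ω)) hint (fun i j hij => ?_) fun t => ?_
  · exact (hs.indep.indepFun hij).comp hgm hgm
  · have h : IdentDistrib (s t) (s 0) μ μ := by
      refine ⟨(hs.measurable t).aemeasurable, (hs.measurable 0).aemeasurable,
        Measure.ext_of_singleton fun i => ?_⟩
      rw [Measure.map_apply (hs.measurable t) (measurableSet_singleton i),
        Measure.map_apply (hs.measurable 0) (measurableSet_singleton i)]
      exact (hs.law t i).trans (hs.law 0 i).symm
    exact h.comp hgm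

/-- The state grows subexponentially. -/
theorem ae_log_sum_norm_sq_le (hs : IIDSwitching μ (state A x0 s w) s p)
    (hw : NoiseAssumption μ (state A x0 s w) s w α C) (hα : 2 < α)
    (hstable : ∏ i, sigmaMax (A i) ^ p i < 1) :
    ∀ᵐ ω ∂μ, ∀ η : ℝ, 0 < η → ∃ c, ∀ N : ℕ,
      Real.log (1 + ∑ t ∈ Finset.range N, ‖state A x0 s w t ω‖ ^ 2) ≤ η * N + c := by
  obtain ⟨g, hg, hg0⟩ := exists_dominating_rates (σ := fun i => sigmaMax (A i))
    (fun i => Real.sqrt_nonneg _) hs.pmf_pos hs.pmf_sum hstable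
  filter_upwards [ae_tendsto_average_modes hs g, ae_sum_noise_sq_le hs hw hα] with ω h1 ⟨B, hB⟩ η hη
  rw [hg0] at h1
  refine exists_log_sum_sq_le (fun t => norm_nonneg _) (fun η hη => ?_) hη
  refine exists_exp_bound_of_recursion (y := fun t => ‖state A x0 s w t ω‖)
    (b := fun t => ‖w t ω‖) (fun t => norm_nonneg _)
    (fun t => norm_nonneg _) (fun t => ?_) hB h1 hη
  calc ‖state A x0 s w (t + 1) ω‖
      ≤ ‖Matrix.toEuclideanLin (A (s t ω)) (state A x0 s w t ω)‖ + ‖w t ω‖ := norm_add_le _ _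
    _ ≤ sigmaMax (A (s t ω)) * ‖state A x0 s w t ω‖ + ‖w t ω‖ := by
        gcongr; exact norm_toEuclideanLin_le _ _
    _ ≤ _ := by gcongr; exact hg _

end SwitchedGrowth

/-! ### Calculus of o(N) upper bounds. -/

section Sublinear

/-- `f N ≤ η N + O(1)` for every `η > 0`. -/
def IsSublinear (f : ℕ → ℝ) : Prop :=
  ∀ η : ℝ, 0 < η → ∃ c, ∀ N : ℕ, f N ≤ η * N + c

theorem IsSublinear.const (a : ℝ) : IsSublinear fun _ => a := fun η hη =>
  ⟨a, fun N => by have : 0 ≤ η * N := by positivity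
                  linarith⟩

theorem IsSublinear.add {f g : ℕ → ℝ} (hf : IsSublinear f) (hg : IsSublinear g) :
    IsSublinear fun N => f N + g N := fun η hη => by
  obtain ⟨c, hc⟩ := hf (η / 2) (by positivity)
  obtain ⟨d, hd⟩ := hg (η / 2) (by positivity)
  exact ⟨c + d, fun N => by linarith [hc N, hd N]⟩

theorem IsSublinear.const_mul {f : ℕ → ℝ} (hf : IsSublinear f) {a : ℝ} (ha : 0 ≤ a) :
    IsSublinear fun N => a * f N := fun η hη => by
  obtain ⟨c, hc⟩ := hf (η / (a + 1)) (by positivity)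
  refine ⟨a * c, fun N => ?_⟩
  have h1 := mul_le_mul_of_nonneg_left (hc N) ha
  have h2 : a * (η / (a + 1) * N) ≤ η * N := by
    have : a * (η / (a + 1) * N) = (a / (a + 1)) * (η * N) := by ring
    rw [this]
    exact mul_le_of_le_one_left (by positivity) ((div_le_one (by positivity)).2 (by linarith))
  linarith

theorem IsSublinear.mono {f g : ℕ → ℝ} (hf : IsSublinear f) (h : ∀ N, g N ≤ f N) :
    IsSublinear g := fun η hη => by
  obtain ⟨c, hc⟩ := hf η hη
  exact ⟨c, fun N => (h N).trans (hc N)⟩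

theorem IsSublinear.comp_succ {f : ℕ → ℝ} (hf : IsSublinear f) :
    IsSublinear fun N => f (N + 1) := fun η hη => by
  obtain ⟨c, hc⟩ := hf η hη
  refine ⟨η + c, fun N => (hc (N + 1)).trans ?_⟩
  push_cast
  linarith

theorem isSublinear_rpow {β : ℝ} (hβ : β < 1) : IsSublinear fun N => (N : ℝ) ^ β := fun η hη => by
  have h : Tendsto (fun N : ℕ => (N : ℝ) ^ (-(1 - β))) atTop (𝓝 0) :=
    (tendsto_rpow_neg_atTop (by linarith)).comp tendsto_natCast_atTop_atTop
  obtain ⟨N0, hN0⟩ := eventually_atTop.1 (h.eventually_lt_const hη)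
  have hs0 : 0 ≤ ∑ k ∈ Finset.range (N0 + 1), (k : ℝ) ^ β :=
    Finset.sum_nonneg fun _ _ => by positivity
  refine ⟨∑ k ∈ Finset.range (N0 + 1), (k : ℝ) ^ β, fun N => ?_⟩
  rcases le_or_gt N N0 with hN | hN
  · have h1 := Finset.single_le_sum (f := fun k : ℕ => (k : ℝ) ^ β) (fun k _ => by positivity)
      (Finset.mem_range.2 (Nat.lt_succ_of_le hN))
    have h2 : 0 ≤ η * N := by positivity
    linarith
  · have hpos : (0 : ℝ) < N := by exact_mod_cast (Nat.zero_le N0).trans_lt hN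
    have h1 : (N : ℝ) ^ β = (N : ℝ) ^ (-(1 - β)) * N := by
      rw [← Real.rpow_add_one hpos.ne']; congr 1; ring
    have h2 := mul_le_mul_of_nonneg_right (hN0 N hN.le).le hpos.le
    simp only [h1]
    linarith

theorem IsSublinear.tendsto_div {f : ℕ → ℝ} (hf : IsSublinear f) (h0 : ∀ N, 0 ≤ f N) :
    Tendsto (fun N : ℕ => f N / N) atTop (𝓝 0) := by
  rw [Metric.tendsto_atTop]
  intro δ hδ
  obtain ⟨c, hc⟩ := hf (δ / 2) (by positivity)
  obtain ⟨N0, hN0⟩ := exists_nat_gt (2 * |c| / δ)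
  refine ⟨N0 + 1, fun N hN => ?_⟩
  have h1 : (N0 : ℝ) + 1 ≤ N := by exact_mod_cast hN
  have hpos : (0 : ℝ) < N := by linarith [(Nat.cast_nonneg N0 : (0 : ℝ) ≤ N0)]
  rw [Real.dist_eq, sub_zero, abs_of_nonneg (div_nonneg (h0 N) hpos.le), div_lt_iff₀ hpos]
  rw [div_lt_iff₀ hδ] at hN0
  have := le_abs_self c
  nlinarith [hc N]

end Sublinear

/-! ### Excitation by the noise, uniformly in the direction. -/

section NoiseExcitation

variable {n : ℕ}

theorem dotProduct_outer_mulVec (v : Fin n → ℝ) (y : EuclideanSpace ℝ (Fin n)) :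
    v ⬝ᵥ (outer y *ᵥ v) = (v ⬝ᵥ y.ofLp) ^ 2 := by
  rw [outer, dotProduct_vecMulVec_mulVec, dotProduct_comm y.ofLp, sq]

theorem eventually_mul_le_sum_sq {w : ℕ → EuclideanSpace ℝ (Fin n)}
    {C : Matrix (Fin n) (Fin n) ℝ}
    (hC : IsMatrixLiminf (fun T => (1 / (T : ℝ)) • ∑ t ∈ Finset.range T, outer (w t)) C)
    (v : Fin n → ℝ) {c : ℝ} (hc : c < v ⬝ᵥ (C *ᵥ v)) :
    ∀ᶠ N : ℕ in atTop, c * N ≤ ∑ t ∈ Finset.range N, (v ⬝ᵥ (w t).ofLp) ^ 2 := by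
  have h1 : (c : EReal) < liminf (fun T : ℕ =>
      ((v ⬝ᵥ (((1 / (T : ℝ)) • ∑ t ∈ Finset.range T, outer (w t)) *ᵥ v) : ℝ) : EReal)) atTop := by
    rw [hC v]; exact_mod_cast hc
  filter_upwards [eventually_lt_of_lt_liminf h1, eventually_gt_atTop 0] with N hN hN0
  have hN' : c < v ⬝ᵥ (((1 / (N : ℝ)) • ∑ t ∈ Finset.range N, outer (w t)) *ᵥ v) := by
    exact_mod_cast hN
  rw [Matrix.smul_mulVec, dotProduct_smul, Matrix.sum_mulVec, dotProduct_sum] at hN'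
  simp only [dotProduct_outer_mulVec, smul_eq_mul] at hN'
  have hpos : (0 : ℝ) < N := by exact_mod_cast hN0
  rw [one_div, inv_mul_eq_div, lt_div_iff₀ hpos] at hN'
  exact hN'.le

theorem abs_apply_le_one_of_dotProduct_self {v : Fin n → ℝ} (hv : v ⬝ᵥ v = 1) (a : Fin n) :
    |v a| ≤ 1 := by
  have h1 : v a * v a ≤ v ⬝ᵥ v :=
    Finset.single_le_sum (f := fun i => v i * v i) (fun i _ => mul_self_nonneg _)
      (Finset.mem_univ a)
  exact abs_le_one_iff_mul_self_le_one.2 (by linarith)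

/-- If the empirical quadratic forms of the noise are bounded below one direction at a time, they
are so uniformly over the unit sphere. -/
theorem exists_uniform_sum_sq_ge {w : ℕ → EuclideanSpace ℝ (Fin n)}
    {C : Matrix (Fin n) (Fin n) ℝ} (hCpos : C.PosDef)
    (hC : IsMatrixLiminf (fun T => (1 / (T : ℝ)) • ∑ t ∈ Finset.range T, outer (w t)) C)
    {B : ℝ} (hB : ∀ N : ℕ, ∑ t ∈ Finset.range N, ‖w t‖ ^ 2 ≤ B * (1 + N)) :
    ∃ c, 0 < c ∧ ∀ᶠ N : ℕ in atTop, ∀ v : Fin n → ℝ, v ⬝ᵥ v = 1 →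
      c * N ≤ ∑ t ∈ Finset.range N, (v ⬝ᵥ (w t).ofLp) ^ 2 := by
  have hB0 : 0 ≤ B := by simpa using hB 0
  have hdot : Continuous fun v : Fin n → ℝ => v ⬝ᵥ v := by
    simp only [dotProduct]; fun_prop
  have hcompact : IsCompact {v : Fin n → ℝ | v ⬝ᵥ v = 1} := by
    refine Metric.isCompact_of_isClosed_isBounded (isClosed_eq hdot continuous_const) ?_
    refine (Metric.isBounded_closedBall (x := 0) (r := 1)).subset fun v hv => ?_
    rw [mem_closedBall_zero_iff, pi_norm_le_iff_of_nonneg zero_le_one]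
    exact fun i => abs_apply_le_one_of_dotProduct_self hv i
  suffices h : ∃ c, 0 < c ∧ ∀ᶠ N : ℕ in atTop, ∀ v ∈ {v : Fin n → ℝ | v ⬝ᵥ v = 1},
      c * N ≤ ∑ t ∈ Finset.range N, (v ⬝ᵥ (w t).ofLp) ^ 2 from h
  refine hcompact.induction_on (p := fun S => ∃ c, 0 < c ∧ ∀ᶠ N : ℕ in atTop, ∀ v ∈ S,
      c * N ≤ ∑ t ∈ Finset.range N, (v ⬝ᵥ (w t).ofLp) ^ 2) ?_ ?_ ?_ ?_
  · exact ⟨1, one_pos, by simp⟩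
  · rintro S S' hSS' ⟨c, hc, h⟩
    exact ⟨c, hc, h.mono fun N hN v hv => hN v (hSS' hv)⟩
  · rintro S S' ⟨c, hc, h⟩ ⟨c', hc', h'⟩
    refine ⟨min c c', lt_min hc hc', ?_⟩
    filter_upwards [h, h'] with N hN hN' v hv
    have hNn : (0 : ℝ) ≤ N := Nat.cast_nonneg N
    rcases hv with hv | hv
    · exact (mul_le_mul_of_nonneg_right (min_le_left _ _) hNn).trans (hN v hv)
    · exact (mul_le_mul_of_nonneg_right (min_le_right _ _) hNn).trans (hN' v hv)
  · intro v0 hv0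
    have hv0ne : v0 ≠ 0 := by
      rintro rfl
      simp at hv0
    have hq : 0 < v0 ⬝ᵥ (C *ᵥ v0) := by simpa using hCpos.dotProduct_mulVec_pos hv0ne
    set q := v0 ⬝ᵥ (C *ᵥ v0) with hq_def
    -- The form at v0 is eventually at least qN/2. Half of it survives the comparison below, and ρ
    -- is chosen so that the perturbation costs at most qN/8, which leaves qN/8.
    set ρ := q / (16 * (B + 1)) with hρ
    have hρ0 : 0 < ρ := by positivity
    refine ⟨{v | (v - v0) ⬝ᵥ (v - v0) < ρ}, mem_nhdsWithin_of_mem_nhds ?_, q / 8, by positivity, ?_⟩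
    · refine (isOpen_lt (hdot.comp (continuous_id.sub continuous_const))
        continuous_const).mem_nhds ?_
      simpa using hρ0
    filter_upwards [eventually_mul_le_sum_sq hC v0 (half_lt_self hq), eventually_ge_atTop 1]
      with N hN hN1 v hv
    have hN1' : (1 : ℝ) ≤ N := by exact_mod_cast hN1
    -- From a²/2 ≤ b² + (b − a)², whose defect is (2b − a)²/2, and Cauchy–Schwarz for b − a.
    have hpt : ∀ t, (v0 ⬝ᵥ (w t).ofLp) ^ 2 / 2 - ρ * ‖w t‖ ^ 2 ≤ (v ⬝ᵥ (w t).ofLp) ^ 2 := by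
      intro t
      have h1 := dotProduct_sq_le (v - v0) (w t).ofLp
      rw [dotProduct_self_eq_norm_sq (w t)] at h1
      have h2 : (v - v0) ⬝ᵥ (v - v0) * ‖w t‖ ^ 2 ≤ ρ * ‖w t‖ ^ 2 :=
        mul_le_mul_of_nonneg_right (le_of_lt hv) (sq_nonneg _)
      rw [sub_dotProduct] at h1
      nlinarith [sq_nonneg (2 * (v ⬝ᵥ (w t).ofLp) - v0 ⬝ᵥ (w t).ofLp)]
    have hsum := Finset.sum_le_sum fun t (_ : t ∈ Finset.range N) => hpt t
    rw [Finset.sum_sub_distrib, ← Finset.sum_div, ← Finset.mul_sum] at hsum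
    have h3 : ρ * ∑ t ∈ Finset.range N, ‖w t‖ ^ 2 ≤ q / 8 * N := by
      calc ρ * ∑ t ∈ Finset.range N, ‖w t‖ ^ 2 ≤ ρ * (B * (1 + N)) := by gcongr; exact hB N
        _ ≤ ρ * ((B + 1) * (2 * N)) := by gcongr <;> linarith
        _ = q / 8 * N := by rw [hρ]; field_simp; ring
    linarith

theorem abs_sum_mul_dotProduct_sq_le {w : ℕ → Fin n → ℝ} {d : ℕ → ℝ} {N : ℕ}
    {b : Fin n → Fin n → ℝ} (hb : ∀ i j, |∑ t ∈ Finset.range N, d t * (w t i * w t j)| ≤ b i j)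
    {v : Fin n → ℝ} (hv : v ⬝ᵥ v = 1) :
    |∑ t ∈ Finset.range N, d t * (v ⬝ᵥ w t) ^ 2| ≤ ∑ i, ∑ j, b i j := by
  have h : ∑ t ∈ Finset.range N, d t * (v ⬝ᵥ w t) ^ 2
      = ∑ i, ∑ j, v i * v j * ∑ t ∈ Finset.range N, d t * (w t i * w t j) := by
    have h1 : ∀ t, d t * (v ⬝ᵥ w t) ^ 2
        = ∑ i, ∑ j, v i * v j * (d t * (w t i * w t j)) := fun t => by
      rw [sq, dotProduct, Finset.sum_mul_sum, Finset.mul_sum]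
      refine Finset.sum_congr rfl fun i _ => ?_
      rw [Finset.mul_sum]
      exact Finset.sum_congr rfl fun j _ => by ring
    simp_rw [h1]
    rw [Finset.sum_comm]
    refine Finset.sum_congr rfl fun i _ => ?_
    rw [Finset.sum_comm]
    exact Finset.sum_congr rfl fun j _ => by rw [Finset.mul_sum]
  rw [h]
  refine (Finset.abs_sum_le_sum_abs _ _).trans (Finset.sum_le_sum fun i _ => ?_)
  refine (Finset.abs_sum_le_sum_abs _ _).trans (Finset.sum_le_sum fun j _ => ?_)
  rw [abs_mul, abs_mul]
  have h1 := abs_apply_le_one_of_dotProduct_self hv i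
  have h2 := abs_apply_le_one_of_dotProduct_self hv j
  have h3 : |v i| * |v j| ≤ 1 := mul_le_one₀ h1 (abs_nonneg _) h2
  exact (mul_le_of_le_one_left (abs_nonneg _) h3).trans (hb i j)

end NoiseExcitation

theorem IsSublinear.eventually_le {f : ℕ → ℝ} (hf : IsSublinear f) {η : ℝ} (hη : 0 < η) :
    ∀ᶠ N : ℕ in atTop, f N ≤ η * N := by
  obtain ⟨c, hc⟩ := hf (η / 2) (by positivity)
  obtain ⟨N0, hN0⟩ := exists_nat_gt (2 * c / η)
  filter_upwards [eventually_ge_atTop N0] with N hN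
  have h1 : (N0 : ℝ) ≤ N := by exact_mod_cast hN
  rw [div_lt_iff₀ hη] at hN0
  nlinarith [hc N]

/-! ### Deterministic analysis along one trajectory. -/

section Trajectory

variable {n k : ℕ}

/-- The regressor `x_t`, set to zero at the times when the mode is not `i`. -/
noncomputable def selected (x : ℕ → EuclideanSpace ℝ (Fin n)) (σ : ℕ → Fin k) (i : Fin k) (t : ℕ) :
    Fin n → ℝ :=
  (if σ t = i then (1 : ℝ) else 0) • (x t).ofLp

/-- The predictable part of `x_{t+1}`, set to zero when the next mode is not `i`. -/
noncomputable def selectedDrift (A : Fin k → Matrix (Fin n) (Fin n) ℝ)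
    (x : ℕ → EuclideanSpace ℝ (Fin n)) (σ : ℕ → Fin k) (i : Fin k) (t : ℕ) : Fin n → ℝ :=
  (if σ (t + 1) = i then (1 : ℝ) else 0) • (Matrix.toEuclideanLin (A (σ t)) (x t)).ofLp

/-- The conclusion of the self-normalized bound, along a trajectory. -/
def SelfNormalizedBound (z : ℕ → Fin n → ℝ) (e : ℕ → ℝ) (c : ℝ) : Prop :=
  0 ≤ c ∧ ∀ (N : ℕ) (θ : Fin n → ℝ), 2 * (θ ⬝ᵥ ∑ t ∈ Finset.range N, e t • z t)
    ≤ θ ⬝ᵥ θ + ∑ t ∈ Finset.range N, (θ ⬝ᵥ z t) ^ 2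
      + c * (1 + Real.log (1 + ∑ t ∈ Finset.range N, z t ⬝ᵥ z t))

theorem sum_modeTimes (σ : ℕ → Fin k) (i : Fin k) (T : ℕ) {β : Type*} [AddCommMonoid β]
    (f : ℕ → β) : ∑ t ∈ modeTimes σ i T, f t
      = ∑ t ∈ Finset.range (T + 1), if σ t = i then f t else 0 :=
  Finset.sum_filter _ _

theorem empCov_isHermitian (x : ℕ → EuclideanSpace ℝ (Fin n)) (σ : ℕ → Fin k) (i : Fin k)
    (T : ℕ) : (empCov x σ i T).IsHermitian := by
  simp [Matrix.IsHermitian, empCov, Matrix.conjTranspose_eq_transpose_of_trivial, outer,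
    Matrix.transpose_sum, Matrix.transpose_vecMulVec]

theorem dotProduct_empCov_mulVec (x : ℕ → EuclideanSpace ℝ (Fin n)) (σ : ℕ → Fin k) (i : Fin k)
    (T : ℕ) (v : Fin n → ℝ) : v ⬝ᵥ (empCov x σ i T *ᵥ v)
      = ∑ t ∈ Finset.range (T + 1), (v ⬝ᵥ selected x σ i t) ^ 2 := by
  rw [empCov, Matrix.sum_mulVec, dotProduct_sum, sum_modeTimes]
  refine Finset.sum_congr rfl fun t _ => ?_
  by_cases h : σ t = i <;> simp [selected, h, dotProduct_outer_mulVec]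

theorem trace_empCov (x : ℕ → EuclideanSpace ℝ (Fin n)) (σ : ℕ → Fin k) (i : Fin k) (T : ℕ) :
    (empCov x σ i T).trace
      = ∑ t ∈ Finset.range (T + 1), selected x σ i t ⬝ᵥ selected x σ i t := by
  rw [empCov, Matrix.trace_sum, sum_modeTimes]
  refine Finset.sum_congr rfl fun t _ => ?_
  by_cases h : σ t = i <;> simp [selected, h, outer, Matrix.trace_vecMulVec]

theorem norm_sub_toEuclideanLin_sq (y x : EuclideanSpace ℝ (Fin n))
    (D : Matrix (Fin n) (Fin n) ℝ) :
    ‖y - Matrix.toEuclideanLin D x‖ ^ 2 = ∑ r, (y r - D r ⬝ᵥ x.ofLp) ^ 2 := by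
  rw [EuclideanSpace.real_norm_sq_eq]
  rfl

/-- The basic inequality of least squares. -/
theorem sum_quadratic_error_le {A : Fin k → Matrix (Fin n) (Fin n) ℝ}
    {x w : ℕ → EuclideanSpace ℝ (Fin n)} {σ : ℕ → Fin k}
    (hx : ∀ t, x (t + 1) = Matrix.toEuclideanLin (A (σ t)) (x t) + w t) {i : Fin k} {T : ℕ}
    {B : Matrix (Fin n) (Fin n) ℝ} (hB : IsLeastSquares x σ i T B) :
    ∑ r, ∑ t ∈ Finset.range (T + 1), ((B - A i) r ⬝ᵥ selected x σ i t) ^ 2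
      ≤ ∑ r, 2 * ((B - A i) r ⬝ᵥ ∑ t ∈ Finset.range (T + 1), w t r • selected x σ i t) := by
  have h := hB (Set.mem_univ (A i))
  simp only [Set.mem_ofPred_eq] at h
  rw [← sub_nonpos, sum_modeTimes, sum_modeTimes, ← Finset.sum_sub_distrib] at h
  simp only [dotProduct_sum, dotProduct_smul, Finset.mul_sum, smul_eq_mul]
  rw [← sub_nonpos, ← Finset.sum_sub_distrib]
  refine le_trans (le_of_eq ?_) h
  simp_rw [← Finset.sum_sub_distrib]
  rw [Finset.sum_comm]
  refine Finset.sum_congr rfl fun t _ => ?_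
  by_cases hσ : σ t = i
  · simp only [hσ, if_true, norm_sub_toEuclideanLin_sq, ← Finset.sum_sub_distrib]
    refine Finset.sum_congr rfl fun r _ => ?_
    have h1 : x (t + 1) r = A i r ⬝ᵥ (x t).ofLp + w t r := by rw [hx t, hσ]; rfl
    have h2 : (B - A i) r ⬝ᵥ selected x σ i t
        = B r ⬝ᵥ (x t).ofLp - A i r ⬝ᵥ (x t).ofLp := by
      simp only [selected, hσ, if_true, one_smul]
      rw [← sub_dotProduct]; rfl
    rw [h1, h2]
    ring
  · simp [hσ, selected]

/-- The basic inequality bounds the quadratic error by a noise term that is itself at most half of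
that error plus a logarithm. Once λ_min ≥ 1, the regularizing term ‖θ‖² is also dominated by the
quadratic error. -/
theorem lambdaMin_mul_sum_sq_le {A : Fin k → Matrix (Fin n) (Fin n) ℝ}
    {x w : ℕ → EuclideanSpace ℝ (Fin n)} {σ : ℕ → Fin k}
    (hx : ∀ t, x (t + 1) = Matrix.toEuclideanLin (A (σ t)) (x t) + w t) {i : Fin k} {c : Fin n → ℝ}
    (hc : ∀ r, SelfNormalizedBound (selected x σ i) (fun t => w t r) (c r)) {T : ℕ}
    {B : Matrix (Fin n) (Fin n) ℝ} (hB : IsLeastSquares x σ i T B)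
    (hmin : 1 ≤ lambdaMin (empCov x σ i T)) :
    lambdaMin (empCov x σ i T) * ∑ r, (B - A i) r ⬝ᵥ (B - A i) r
      ≤ 8 * (∑ r, c r) * (1 + Real.log (1 + (empCov x σ i T).trace)) := by
  set θ : Fin n → Fin n → ℝ := fun r => (B - A i) r with hθ
  set Λ := 1 + Real.log (1 + (empCov x σ i T).trace) with hΛ
  set q : Fin n → ℝ := fun r => ∑ t ∈ Finset.range (T + 1), (θ r ⬝ᵥ selected x σ i t) ^ 2 with hq
  have hqge : ∀ r, lambdaMin (empCov x σ i T) * (θ r ⬝ᵥ θ r) ≤ q r := fun r => by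
    simp only [hq]
    rw [← dotProduct_empCov_mulVec]
    refine lambdaMin_mul_le_dotProduct_mulVec (empCov_isHermitian x σ i T) (fun v => ?_) _
    rw [dotProduct_empCov_mulVec]
    positivity
  have hθ0 : ∀ r, 0 ≤ θ r ⬝ᵥ θ r := fun r => by simpa using dotProduct_star_self_nonneg (θ r)
  have hup : ∀ r, 2 * (θ r ⬝ᵥ ∑ t ∈ Finset.range (T + 1), w t r • selected x σ i t)
      ≤ q r / 2 + 4 * (c r * Λ) := fun r => by
    -- Scaling θ by 1/4 and multiplying the bound by 4 puts the factor 1/4 on ‖θ‖² + q, so at most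
    -- q/2 appears on the right.
    have h := (hc r).2 (T + 1) ((1 / 4 : ℝ) • θ r)
    simp only [smul_dotProduct, dotProduct_smul, smul_eq_mul, mul_pow, ← Finset.mul_sum] at h
    rw [← trace_empCov] at h
    have h1 : θ r ⬝ᵥ θ r ≤ q r := le_trans (le_mul_of_one_le_left (hθ0 r) hmin) (hqge r)
    have h2 : q r = ∑ t ∈ Finset.range (T + 1), (θ r ⬝ᵥ selected x σ i t) ^ 2 := rfl
    rw [← h2] at h
    linarith
  have hbasic := sum_quadratic_error_le hx hB
  have h1 : ∑ r, q r ≤ ∑ r, (q r / 2 + 4 * (c r * Λ)) :=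
    hbasic.trans (Finset.sum_le_sum fun r _ => hup r)
  rw [Finset.sum_add_distrib, ← Finset.sum_div, ← Finset.mul_sum, ← Finset.sum_mul] at h1
  rw [Finset.mul_sum]
  have h2 := Finset.sum_le_sum fun r (_ : r ∈ Finset.univ) => hqge r
  linarith

theorem maxAbs_le_sqrt (D : Matrix (Fin n) (Fin n) ℝ) : maxAbs D ≤ √(∑ r, D r ⬝ᵥ D r) := by
  refine Real.iSup_le (fun ij => Real.abs_le_sqrt ?_) (Real.sqrt_nonneg _)
  have h0 : ∀ r, 0 ≤ D r ⬝ᵥ D r := fun r => by simpa using dotProduct_star_self_nonneg (D r)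
  have h1 : D ij.1 ij.2 ^ 2 ≤ D ij.1 ⬝ᵥ D ij.1 := by
    rw [sq]
    exact Finset.single_le_sum (f := fun j => D ij.1 j * D ij.1 j)
      (fun j _ => mul_self_nonneg _) (Finset.mem_univ ij.2)
  exact h1.trans (Finset.single_le_sum (f := fun r => D r ⬝ᵥ D r) (fun r _ => h0 r)
    (Finset.mem_univ ij.1))

theorem maxAbs_nonneg (D : Matrix (Fin n) (Fin n) ℝ) : 0 ≤ maxAbs D :=
  Real.iSup_nonneg fun _ => abs_nonneg _

/-- Replacing the indicator by its mean p costs only O(N^β), uniformly over the unit sphere since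
the deviation is controlled entry by entry; half of pcN absorbs it. -/
theorem exists_selected_noise_sum_ge {w : ℕ → EuclideanSpace ℝ (Fin n)} {σ : ℕ → Fin k}
    {i : Fin k} {c p β : ℝ} (hc : 0 < c) (hp : 0 < p) (hβ : β < 1)
    (hexc : ∀ᶠ N : ℕ in atTop, ∀ v : Fin n → ℝ, v ⬝ᵥ v = 1 →
      c * N ≤ ∑ t ∈ Finset.range N, (v ⬝ᵥ (w t).ofLp) ^ 2)
    (hdev : ∀ a b, ∃ B, ∀ N : ℕ, |∑ t ∈ Finset.range (N + 1),
      ((if σ (t + 1) = i then (1 : ℝ) else 0) - p) * (w t a * w t b)| ≤ B * ((N : ℝ) + 1) ^ β) :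
    ∀ᶠ N : ℕ in atTop, ∀ v : Fin n → ℝ, v ⬝ᵥ v = 1 → p * c / 2 * N
      ≤ ∑ t ∈ Finset.range N, (if σ (t + 1) = i then (1 : ℝ) else 0) * (v ⬝ᵥ (w t).ofLp) ^ 2 := by
  choose B hB using hdev
  have hB0 : 0 ≤ ∑ a, ∑ b, B a b := by
    refine Finset.sum_nonneg fun a _ => Finset.sum_nonneg fun b _ => ?_
    simpa using (abs_nonneg _).trans (hB a b 0)
  have hsub := ((isSublinear_rpow hβ).const_mul hB0).eventually_le
    (show 0 < p * c / 2 by positivity)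
  filter_upwards [hexc, hsub, eventually_ge_atTop 1] with N hN hsub hN1 v hv
  obtain ⟨N, rfl⟩ : ∃ M, N = M + 1 := ⟨N - 1, by omega⟩
  have h1 := abs_sum_mul_dotProduct_sq_le (w := fun t => (w t).ofLp)
    (d := fun t => (if σ (t + 1) = i then (1 : ℝ) else 0) - p) (fun a b => hB a b N) hv
  simp_rw [← Finset.sum_mul] at h1
  simp only [sub_mul, Finset.sum_sub_distrib] at h1
  rw [← Finset.mul_sum] at h1
  have h2 := (abs_le.1 h1).1
  have h3 := mul_le_mul_of_nonneg_left (hN v hv) hp.le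
  push_cast at hsub h3 ⊢
  linarith

/-- In the expanded square of drift plus noise, the self-normalized bound makes the cross term at
least minus the drift energy, up to a logarithm. The drift energy thus cancels, and nothing about
its size is needed beyond that logarithm. -/
theorem sum_selected_sq_ge {A : Fin k → Matrix (Fin n) (Fin n) ℝ}
    {x w : ℕ → EuclideanSpace ℝ (Fin n)} {σ : ℕ → Fin k}
    (hx : ∀ t, x (t + 1) = Matrix.toEuclideanLin (A (σ t)) (x t) + w t) {i : Fin k} {c : Fin n → ℝ}
    (hc : ∀ r, SelfNormalizedBound (selectedDrift A x σ i) (fun t => w t r) (c r)) (N : ℕ)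
    {v : Fin n → ℝ} (hv : v ⬝ᵥ v = 1) :
    ∑ t ∈ Finset.range N, (if σ (t + 1) = i then (1 : ℝ) else 0) * (v ⬝ᵥ (w t).ofLp) ^ 2
      - 1 - (∑ r, c r) * (1 + Real.log (1 + ∑ t ∈ Finset.range N,
        selectedDrift A x σ i t ⬝ᵥ selectedDrift A x σ i t))
      ≤ ∑ t ∈ Finset.range (N + 1), (v ⬝ᵥ selected x σ i t) ^ 2 := by
  set y := selectedDrift A x σ i with hy
  set Λ := 1 + Real.log (1 + ∑ t ∈ Finset.range N, y t ⬝ᵥ y t) with hΛ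
  have hterm : ∀ t, (v ⬝ᵥ selected x σ i (t + 1)) ^ 2 = (v ⬝ᵥ y t) ^ 2
      + 2 * ∑ r, v r * (v ⬝ᵥ (w t r • y t))
      + (if σ (t + 1) = i then (1 : ℝ) else 0) * (v ⬝ᵥ (w t).ofLp) ^ 2 := by
    intro t
    have h1 : ∑ r, v r * (v ⬝ᵥ (w t r • y t)) = (v ⬝ᵥ (w t).ofLp) * (v ⬝ᵥ y t) := by
      rw [dotProduct, Finset.sum_mul]
      exact Finset.sum_congr rfl fun r _ => by rw [dotProduct_smul, smul_eq_mul]; ring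
    rw [h1]
    by_cases h : σ (t + 1) = i
    · simp only [hy, selected, selectedDrift, h, if_true, one_smul, hx t, WithLp.ofLp_add,
        dotProduct_add]
      ring
    · simp [hy, selected, selectedDrift, h]
  have hcross : ∀ r, -(v r ^ 2 * (1 + ∑ t ∈ Finset.range N, (v ⬝ᵥ y t) ^ 2)) - c r * Λ
      ≤ 2 * (v r * (v ⬝ᵥ ∑ t ∈ Finset.range N, w t r • y t)) := by
    intro r
    -- The factor −v_r gives the lower bound with weight v_r²; these weights sum to 1 over the
    -- coordinates.
    have h := (hc r).2 N (-(v r) • v)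
    simp only [smul_dotProduct, dotProduct_smul, smul_eq_mul, mul_pow, ← Finset.mul_sum, hv] at h
    have h2 : (-v r) ^ 2 = v r ^ 2 := by ring
    rw [h2] at h
    linarith
  have hvr : ∑ r, v r ^ 2 = 1 := by rw [← hv]; simp [dotProduct, sq]
  have hsum := Finset.sum_le_sum fun r (_ : r ∈ Finset.univ) => hcross r
  rw [Finset.sum_sub_distrib, Finset.sum_neg_distrib, ← Finset.sum_mul, ← Finset.sum_mul, hvr,
    one_mul, ← Finset.mul_sum] at hsum
  have hswap : ∑ r, v r * (v ⬝ᵥ ∑ t ∈ Finset.range N, w t r • y t)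
      = ∑ t ∈ Finset.range N, ∑ r, v r * (v ⬝ᵥ (w t r • y t)) := by
    rw [Finset.sum_comm]
    exact Finset.sum_congr rfl fun r _ => by rw [dotProduct_sum, Finset.mul_sum]
  -- The time-0 term is split off, being the only one not produced by the recursion; it is
  -- nonnegative and is discarded.
  rw [Finset.sum_range_succ', Finset.sum_congr rfl fun t _ => hterm t, Finset.sum_add_distrib,
    Finset.sum_add_distrib, ← Finset.mul_sum, ← hswap]
  have h0 := sq_nonneg (v ⬝ᵥ selected x σ i 0)
  linarith

theorem selectedDrift_dotProduct_le (A : Fin k → Matrix (Fin n) (Fin n) ℝ)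
    (x : ℕ → EuclideanSpace ℝ (Fin n)) (σ : ℕ → Fin k) (i : Fin k) (t : ℕ) :
    selectedDrift A x σ i t ⬝ᵥ selectedDrift A x σ i t
      ≤ (∑ j, sigmaMax (A j) ^ 2) * ‖x t‖ ^ 2 := by
  have h1 : ‖Matrix.toEuclideanLin (A (σ t)) (x t)‖ ^ 2
      ≤ (∑ j, sigmaMax (A j) ^ 2) * ‖x t‖ ^ 2 := by
    calc ‖Matrix.toEuclideanLin (A (σ t)) (x t)‖ ^ 2 ≤ (sigmaMax (A (σ t)) * ‖x t‖) ^ 2 := by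
          gcongr; exact norm_toEuclideanLin_le _ _
      _ = sigmaMax (A (σ t)) ^ 2 * ‖x t‖ ^ 2 := mul_pow _ _ _
      _ ≤ _ := by
          gcongr
          exact Finset.single_le_sum (f := fun j => sigmaMax (A j) ^ 2) (fun j _ => sq_nonneg _)
            (Finset.mem_univ (σ t))
  by_cases h : σ (t + 1) = i
  · simp only [selectedDrift, h, if_true, one_smul]
    rwa [dotProduct_self_eq_norm_sq (Matrix.toEuclideanLin (A (σ t)) (x t))]
  · simp only [selectedDrift, h, if_false, zero_smul, dotProduct_zero]
    exact (sq_nonneg _).trans h1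

theorem exists_mul_le_lambdaMin_empCov (hn : 0 < n) {A : Fin k → Matrix (Fin n) (Fin n) ℝ}
    {x w : ℕ → EuclideanSpace ℝ (Fin n)} {σ : ℕ → Fin k}
    (hx : ∀ t, x (t + 1) = Matrix.toEuclideanLin (A (σ t)) (x t) + w t) {i : Fin k} {c : Fin n → ℝ}
    (hc : ∀ r, SelfNormalizedBound (selectedDrift A x σ i) (fun t => w t r) (c r))
    (hlog : IsSublinear fun N => Real.log (1 + ∑ t ∈ Finset.range N, ‖x t‖ ^ 2)) {d : ℝ}
    (hd : 0 < d)
    (hexc : ∀ᶠ N : ℕ in atTop, ∀ v : Fin n → ℝ, v ⬝ᵥ v = 1 → d * N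
      ≤ ∑ t ∈ Finset.range N,
        (if σ (t + 1) = i then (1 : ℝ) else 0) * (v ⬝ᵥ (w t).ofLp) ^ 2) :
    ∀ᶠ N : ℕ in atTop, d / 2 * N ≤ lambdaMin (empCov x σ i N) := by
  set m := ∑ j, sigmaMax (A j) ^ 2 with hm
  have hm0 : 0 ≤ m := Finset.sum_nonneg fun _ _ => sq_nonneg _
  have hc0 : 0 ≤ ∑ r, c r := Finset.sum_nonneg fun r _ => (hc r).1
  have hΛ : ∀ N, Real.log (1 + ∑ t ∈ Finset.range N,
      selectedDrift A x σ i t ⬝ᵥ selectedDrift A x σ i t)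
      ≤ Real.log (1 + m) + Real.log (1 + ∑ t ∈ Finset.range N, ‖x t‖ ^ 2) := fun N => by
    have h0 : 0 ≤ ∑ t ∈ Finset.range N, ‖x t‖ ^ 2 := Finset.sum_nonneg fun _ _ => sq_nonneg _
    have h1 : 0 ≤ ∑ t ∈ Finset.range N, selectedDrift A x σ i t ⬝ᵥ selectedDrift A x σ i t :=
      Finset.sum_nonneg fun t _ => by
        simpa using dotProduct_star_self_nonneg (selectedDrift A x σ i t)
    rw [← Real.log_mul (by positivity) (by positivity)]
    refine Real.log_le_log (by positivity) ?_
    have h2 : ∑ t ∈ Finset.range N, selectedDrift A x σ i t ⬝ᵥ selectedDrift A x σ i t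
        ≤ m * ∑ t ∈ Finset.range N, ‖x t‖ ^ 2 := by
      rw [Finset.mul_sum]
      exact Finset.sum_le_sum fun t _ => selectedDrift_dotProduct_le A x σ i t
    nlinarith
  have hsub : IsSublinear fun N => 1 + (∑ r, c r) * (1 + (Real.log (1 + m)
      + Real.log (1 + ∑ t ∈ Finset.range N, ‖x t‖ ^ 2))) :=
    (IsSublinear.const 1).add (((IsSublinear.const 1).add
      ((IsSublinear.const (Real.log (1 + m))).add hlog)).const_mul hc0)
  filter_upwards [hexc, hsub.eventually_le (half_pos hd)] with N hN hN'
  refine le_lambdaMin_of_quadratic (empCov_isHermitian x σ i N) hn fun v hv => ?_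
  rw [dotProduct_empCov_mulVec]
  refine le_trans ?_ (sum_selected_sq_ge hx hc N hv)
  have h1 := mul_le_mul_of_nonneg_left (hΛ N) hc0
  have h2 := hN v hv
  linarith

/-- Once λ_max ≥ e, its logarithm is at least 1 and absorbs the additive constants, so the trace may
be replaced by λ_max at the cost of a factor. -/
theorem one_add_log_le {lam : ℝ} (hlam : Real.exp 1 ≤ lam) (n : ℕ) {τ : ℝ} (hτ0 : 0 ≤ τ)
    (hτ : τ ≤ n * lam) :
    1 + Real.log (1 + τ) ≤ (2 + Real.log (1 + n)) * Real.log lam := by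
  have hlam0 : 0 < lam := (Real.exp_pos 1).trans_le hlam
  have hlog : 1 ≤ Real.log lam := (Real.le_log_iff_exp_le hlam0).2 hlam
  have hlam1 : 1 ≤ lam := by linarith [Real.add_one_le_exp (1 : ℝ)]
  have h1 : Real.log (1 + τ) ≤ Real.log (1 + n) + Real.log lam := by
    rw [← Real.log_mul (by positivity) hlam0.ne']
    exact Real.log_le_log (by positivity) (by nlinarith)
  have h2 : 0 ≤ Real.log (1 + (n : ℝ)) :=
    Real.log_nonneg (by linarith [(Nat.cast_nonneg n : (0 : ℝ) ≤ n)])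
  nlinarith

theorem trace_empCov_le (x : ℕ → EuclideanSpace ℝ (Fin n)) (σ : ℕ → Fin k) (i : Fin k) (T : ℕ) :
    0 ≤ (empCov x σ i T).trace ∧
      (empCov x σ i T).trace ≤ ∑ t ∈ Finset.range (T + 1), ‖x t‖ ^ 2 := by
  rw [trace_empCov]
  refine ⟨Finset.sum_nonneg fun t _ => by
    simpa using dotProduct_star_self_nonneg (selected x σ i t),
    Finset.sum_le_sum fun t _ => ?_⟩
  by_cases h : σ t = i
  · simp only [selected, h, if_true, one_smul]
    exact (dotProduct_self_eq_norm_sq (x t)).le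
  · simp only [selected, h, if_false, zero_smul, dotProduct_zero]
    exact sq_nonneg _

/-- Consistency and rate of the switched least squares estimate along a single trajectory. -/
theorem consistency_of_excitation (hn : 0 < n) {A : Fin k → Matrix (Fin n) (Fin n) ℝ}
    {x w : ℕ → EuclideanSpace ℝ (Fin n)} {σ : ℕ → Fin k}
    (hx : ∀ t, x (t + 1) = Matrix.toEuclideanLin (A (σ t)) (x t) + w t) {i : Fin k} {c : Fin n → ℝ}
    (hc : ∀ r, SelfNormalizedBound (selected x σ i) (fun t => w t r) (c r))
    (hlog : IsSublinear fun N => Real.log (1 + ∑ t ∈ Finset.range N, ‖x t‖ ^ 2)) {d : ℝ}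
    (hd : 0 < d) (hmin : ∀ᶠ N : ℕ in atTop, d * N ≤ lambdaMin (empCov x σ i N))
    {B : ℕ → Matrix (Fin n) (Fin n) ℝ} (hB : ∀ T, IsLeastSquares x σ i T (B T)) :
    Tendsto (fun T => maxAbs (B T - A i)) atTop (𝓝 0) ∧
      (fun T => maxAbs (B T - A i)) =O[atTop] fun T =>
        √(Real.log (lambdaMax (empCov x σ i T)) / lambdaMin (empCov x σ i T)) := by
  set K := 8 * ∑ r, c r with hK
  have hK0 : 0 ≤ K := mul_nonneg (by norm_num) (Finset.sum_nonneg fun r _ => (hc r).1)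
  -- The threshold e serves twice: it forces λ_min ≥ 1 for the error bound, and log λ_max ≥ 1 for
  -- the rate.
  have hlarge : ∀ᶠ N : ℕ in atTop, Real.exp 1 ≤ d * N :=
    (tendsto_natCast_atTop_atTop.const_mul_atTop hd).eventually_ge_atTop _
  have hexp1 : (1 : ℝ) ≤ Real.exp 1 := by linarith [Real.add_one_le_exp (1 : ℝ)]
  have key : ∀ᶠ N : ℕ in atTop, maxAbs (B N - A i) ≤
      √(K * (1 + Real.log (1 + (empCov x σ i N).trace)) / lambdaMin (empCov x σ i N)) := by
    filter_upwards [hmin, hlarge] with N h1 h2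
    refine (maxAbs_le_sqrt _).trans (Real.sqrt_le_sqrt ?_)
    rw [le_div_iff₀ (by linarith), mul_comm]
    exact lambdaMin_mul_sum_sq_le hx hc (hB N) (by linarith)
  constructor
  · set f : ℕ → ℝ := fun N =>
      K / d * (1 + Real.log (1 + ∑ t ∈ Finset.range (N + 1), ‖x t‖ ^ 2)) with hf
    have hs0 : ∀ N, 0 ≤ ∑ t ∈ Finset.range N, ‖x t‖ ^ 2 := fun N =>
      Finset.sum_nonneg fun _ _ => sq_nonneg _
    have hfsub : IsSublinear f :=
      ((IsSublinear.const 1).add hlog.comp_succ).const_mul (by positivity)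
    have hf0 : ∀ N, 0 ≤ f N := fun N => by
      have := Real.log_nonneg (show 1 ≤ 1 + ∑ t ∈ Finset.range (N + 1), ‖x t‖ ^ 2 by
        linarith [hs0 (N + 1)])
      positivity
    have hlim : Tendsto (fun N : ℕ => √(f N / N)) atTop (𝓝 0) := by
      simpa using (hfsub.tendsto_div hf0).sqrt
    refine squeeze_zero' (Eventually.of_forall fun N => maxAbs_nonneg _) ?_ hlim
    filter_upwards [key, hmin, hlarge, eventually_gt_atTop 0] with N h1 h2 h3 h4
    refine h1.trans (Real.sqrt_le_sqrt ?_)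
    have hNpos : (0 : ℝ) < N := by exact_mod_cast h4
    obtain ⟨ht0, ht1⟩ := trace_empCov_le x σ i N
    have h5 : Real.log (1 + (empCov x σ i N).trace)
        ≤ Real.log (1 + ∑ t ∈ Finset.range (N + 1), ‖x t‖ ^ 2) :=
      Real.log_le_log (by positivity) (by linarith)
    have h6 : 0 ≤ Real.log (1 + (empCov x σ i N).trace) := Real.log_nonneg (by linarith)
    calc K * (1 + Real.log (1 + (empCov x σ i N).trace)) / lambdaMin (empCov x σ i N)
        ≤ K * (1 + Real.log (1 + ∑ t ∈ Finset.range (N + 1), ‖x t‖ ^ 2)) / (d * N) := by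
          gcongr
          exact mul_nonneg hK0 (by linarith)
      _ = f N / N := by simp only [hf]; field_simp
  · refine IsBigO.of_bound (√(K * (2 + Real.log (1 + n)))) ?_
    filter_upwards [key, hmin, hlarge] with N h1 h2 h3
    have hH := empCov_isHermitian x σ i N
    have hlam : Real.exp 1 ≤ lambdaMax (empCov x σ i N) :=
      (h3.trans h2).trans (lambdaMin_le_lambdaMax hH hn)
    have h4 := one_add_log_le hlam n (trace_empCov_le x σ i N).1 (trace_le_mul_lambdaMax hH)
    have hpos : 0 < lambdaMin (empCov x σ i N) := by linarith
    have hn0 : 0 ≤ Real.log (1 + (n : ℝ)) :=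
      Real.log_nonneg (by linarith [(Nat.cast_nonneg n : (0 : ℝ) ≤ n)])
    rw [Real.norm_of_nonneg (maxAbs_nonneg _), Real.norm_of_nonneg (Real.sqrt_nonneg _),
      ← Real.sqrt_mul (by positivity)]
    refine h1.trans (Real.sqrt_le_sqrt ?_)
    calc K * (1 + Real.log (1 + (empCov x σ i N).trace)) / lambdaMin (empCov x σ i N)
        ≤ K * ((2 + Real.log (1 + n)) * Real.log (lambdaMax (empCov x σ i N)))
          / lambdaMin (empCov x σ i N) := by gcongr
      _ = _ := by ring

end Trajectory

/-! ### Predictability of the two regressors. -/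

section Measurability

variable {Ω : Type*} {m : MeasurableSpace Ω} {n k : ℕ} {x : ℕ → Ω → EuclideanSpace ℝ (Fin n)}
  {s : ℕ → Ω → Fin k} {t : ℕ}

theorem measurable_ite_mul_apply (i : Fin k) (r : Fin n) {σ : Ω → Fin k}
    {y : Ω → EuclideanSpace ℝ (Fin n)} (hσ : Measurable σ) (hy : Measurable y) :
    Measurable fun ω => (if σ ω = i then (1 : ℝ) else 0) * y ω r := by
  have h1 : Measurable fun v : EuclideanSpace ℝ (Fin n) => v r := by fun_prop
  have h2 : Measurable fun a : Fin k => if a = i then (1 : ℝ) else 0 := measurable_of_countable _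
  exact (h2.comp hσ).mul (h1.comp hy)

theorem measurable_selected (i : Fin k) (r : Fin n) (hs : Measurable (s t))
    (hx : Measurable (x t)) :
    Measurable fun ω => selected (fun t => x t ω) (fun t => s t ω) i t r :=
  measurable_ite_mul_apply i r hs hx

theorem measurable_selectedDrift (A : Fin k → Matrix (Fin n) (Fin n) ℝ) (i : Fin k) (r : Fin n)
    (hs : Measurable (s t)) (hs' : Measurable (s (t + 1))) (hx : Measurable (x t)) :
    Measurable fun ω => selectedDrift A (fun t => x t ω) (fun t => s t ω) i t r :=
  measurable_ite_mul_apply i r hs' (measurable_toEuclideanLin_apply A hs hx)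

end Measurability

/-! ### Assembly on a single almost sure event. -/

theorem theorem1 {Ω : Type*} [MeasurableSpace Ω] (μ : Measure Ω) [IsProbabilityMeasure μ]
    {n k : ℕ} (A : Fin k → Matrix (Fin n) (Fin n) ℝ) (x0 : EuclideanSpace ℝ (Fin n))
    (s : ℕ → Ω → Fin k) (w : ℕ → Ω → EuclideanSpace ℝ (Fin n)) (p : Fin k → ℝ)
    (hs : IIDSwitching μ (state A x0 s w) s p)
    (α : ℝ) (hα : 2 < α) (C : Matrix (Fin n) (Fin n) ℝ) (hC : C.PosDef)
    (hw : NoiseAssumption μ (state A x0 s w) s w α C)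
    (hstable : ∏ i, sigmaMax (A i) ^ p i < 1)
    (Ahat : Fin k → ℕ → Ω → Matrix (Fin n) (Fin n) ℝ)
    (hAhat : ∀ᵐ ω ∂μ, ∀ i T,
      IsLeastSquares (fun t => state A x0 s w t ω) (fun t => s t ω) i T (Ahat i T ω)) :
    ∀ i, ∀ᵐ ω ∂μ,
      Tendsto (fun T => maxAbs (Ahat i T ω - A i)) atTop (𝓝 0) ∧
      (fun T => maxAbs (Ahat i T ω - A i)) =O[atTop]
        (fun T => √(Real.log (lambdaMax
            (empCov (fun t => state A x0 s w t ω) (fun t => s t ω) i T)) /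
          lambdaMin (empCov (fun t => state A x0 s w t ω) (fun t => s t ω) i T))) := by
  intro i
  -- Dimension 0 is allowed: `maxAbs` is then a supremum over an empty type, equal to 0.
  rcases Nat.eq_zero_or_pos n with rfl | hn
  · have h0 : ∀ D : Matrix (Fin 0) (Fin 0) ℝ, maxAbs D = 0 := fun D => Real.iSup_of_isEmpty _
    refine ae_of_all _ fun ω => ?_
    simp only [h0]
    exact ⟨tendsto_const_nhds, isBigO_zero _ _⟩
  have hnext : ∀ t, Measurable[history (state A x0 s w) s t ⊔
      MeasurableSpace.comap (s (t + 1)) inferInstance] (s (t + 1)) := fun t =>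
    (comap_measurable (s (t + 1))).mono le_sup_right le_rfl
  have hstate : ∀ t, Measurable[history (state A x0 s w) s t ⊔
      MeasurableSpace.comap (s (t + 1)) inferInstance] (state A x0 s w t) := fun t =>
    (measurable_state_history le_rfl).mono le_sup_left le_rfl
  have hmode : ∀ t, Measurable[history (state A x0 s w) s t ⊔
      MeasurableSpace.comap (s (t + 1)) inferInstance] (s t) := fun t =>
    (measurable_mode_history le_rfl).mono le_sup_left le_rfl
  have hbound := ae_two_mul_dotProduct_sum_noise_le hs hw hα
    (z := fun t ω => selected (fun t => state A x0 s w t ω) (fun t => s t ω) i t)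
    fun t r => measurable_selected i r (hmode t) (hstate t)
  have hboundDrift := ae_two_mul_dotProduct_sum_noise_le hs hw hα
    (z := fun t ω => selectedDrift A (fun t => state A x0 s w t ω) (fun t => s t ω) i t)
    fun t r => measurable_selectedDrift A i r (hmode t) (hnext t) (hstate t)
  -- The almost sure events are chosen before intersecting; after that, everything is a statement
  -- about one trajectory.
  obtain ⟨β, -, hβ, hdev⟩ := ae_abs_sum_modeInd_mul_le hs hw hα
  filter_upwards [hAhat, hbound, hboundDrift, hdev, ae_sum_noise_sq_le hs hw hα, hw.covariance,
    ae_log_sum_norm_sq_le hs hw hα hstable] with ω hLS h1 h2 h3 ⟨B, hB⟩ hcov hlog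
  have h1' : ∀ r, ∃ c, SelfNormalizedBound
      (selected (fun t => state A x0 s w t ω) (fun t => s t ω) i) (fun t => w t ω r) c := h1
  have h2' : ∀ r, ∃ c, SelfNormalizedBound
      (selectedDrift A (fun t => state A x0 s w t ω) (fun t => s t ω) i) (fun t => w t ω r) c := h2
  choose c hc using h1'
  choose c' hc' using h2'
  obtain ⟨d, hd, hexc⟩ := exists_uniform_sum_sq_ge (w := fun t => w t ω) hC hcov hB
  have hdev' := h3 i
  simp only [modeInd_eq] at hdev'
  have hpi := hs.pmf_pos i
  have hsel := exists_selected_noise_sum_ge (w := fun t => w t ω) (σ := fun t => s t ω) (i := i)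
    hd hpi hβ hexc hdev'
  have hx : ∀ t, state A x0 s w (t + 1) ω
      = Matrix.toEuclideanLin (A (s t ω)) (state A x0 s w t ω) + w t ω := fun t => rfl
  have hmin := exists_mul_le_lambdaMin_empCov hn (x := fun t => state A x0 s w t ω)
    (w := fun t => w t ω) (σ := fun t => s t ω) hx hc' hlog (by positivity) hsel
  exact consistency_of_excitation hn (x := fun t => state A x0 s w t ω)
    (w := fun t => w t ω) (σ := fun t => s t ω) hx hc hlog (by positivity) hmin (hLS i)
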